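/- Let $T$ be a finite tree embedded in a closed disk $D^2$ so that a vertex lies on the boundary exactly when it is a leaf; every vertex that is not a leaf (an interior vertex) has degree at least $3$. Let $V^o$ be the set of interior vertices. The faces of $T$ are the regions cut out by $T$ in $D^2$; a corner $(v,F)$ is an interior vertex $v$ with a face $F$ containing it. **Facets and flips.** $[u,v]$ denotes the path in $T$ between $u$ and $v$. An arc (resp. segment) is a path between two distinct leaves (resp. two distinct interior vertices) any two consecutive edges of which are incident to a common face. An arc cuts the set of faces into two regions; $\mathrm{Reg}(p,F)$ is the region of the arc $p$ containing $F$. Two arcs cross if there is a segment contained in both and no region of either arc is contained in a region of the other. An arc is a boundary arc if its vertices lie on a common face. A facet $\mathcal F$ is an inclusion-maximal set of pairwise noncrossing non-boundary arcs. An arc $p$ contains the corner $(v,F)$ if $F$ is the face incident to two edges of $p$ at $v$; an arc $p$ of $\mathcal F$ (or boundary arc) is marked at a corner $(v,F)$ contained in it if $\mathrm{Reg}(q,F)\subseteq\mathrm{Reg}(p,F)$ for all arcs $q$ containing $(v,F)$ that are in $\mathcal F$ or are boundary arcs. Write $\mathcal F\xrightarrow{s}\mathcal F'$ if $\mathcal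 F,\mathcal F'$ are facets, $\mathcal F'=(\mathcal F\setminus\{p\})\cup\{q\}$ with $p\in\mathcal F$, $q\notin\mathcal F$, the arc $p$ is marked in $\mathcal F$ at two corners $(u,F),(v,G)$ with $u\ne v$, the arc $q$ is marked in $\mathcal F'$ at the corners immediately clockwise from $(u,F)$ about $u$ and from $(v,G)$ about $v$, and $s=[u,v]$. Put $$S_r(\mathcal F)=\{s:\exists \mathcal F'\xrightarrow{s}\mathcal F\},\qquad S_g(\mathcal F)=\{s:\exists \mathcal F\xrightarrow{s}\mathcal F'\}.$$ **Coloured segments.** Fix small disjoint open disks around the interior vertices. An admissible curve for a green (resp. red) segment $s=[u,v]$ is a simple curve in $D^2$ that avoids these disks and all of $T$ except the edges of $s$, starts on the boundary of the disk around $u$ in the corner to the left (resp. right) of the edge of $s$ at $u$, oriented away from $u$, and ends on the boundary of the disk around $v$ in the corner to the left (resp. right) of the edge of $s$ at $v$, oriented away from $v$; for each corner the endpoint chosen in it is fixed. Up to isotopy this curve is unique and is determined by the corners it passes along $s$. Two coloured segments are noncrossing if they admit disjoint admissible curves (curves with a common endpoint are not disjoint). A red-green tree is a set of pairwise noncrossing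 coloured segments such that any two vertices in $V^o$ are connected by a sequence of them. **Noncrossing tree partitions.** For $B\subseteq V^o$ let $\mathrm{Seg}(B)$ be the set of inclusion-minimal segments with both endpoints in $B$; $B$ is segment-connected if any two of its elements are joined by a sequence of segments in $\mathrm{Seg}(B)$. For a set partition $\mathbf B$ of $V^o$ let $\mathrm{Seg}(\mathbf B)$ be the union of $\mathrm{Seg}(B)$ over its blocks $B$. $\mathbf B$ is a noncrossing tree partition, $\mathbf B\in\mathrm{NCP}(T)$, if its blocks are segment-connected and any two distinct segments of $\mathrm{Seg}(\mathbf B)$, all coloured red, are noncrossing. For a facet $\mathcal F$ let $\rho(\mathcal F)$ be the set partition of $V^o$ whose blocks are the classes of vertices joined by sequences of segments in $S_r(\mathcal F)$. **Theorem.** 1. For every facet $\mathcal F$, the segments $S_r(\mathcal F)$ coloured red and $S_g(\mathcal F)$ coloured green form a red-green tree. 2. Every red-green tree is of this form for some facet $\mathcal F$. 3. $\rho$ is a bijection from the set of facets to $\mathrm{NCP}(T)$, and $\mathrm{Seg}(\rho(\mathcal F))=S_r(\mathcal F)$ for all facets $\mathcal F$. 4. For every $\mathbf B\in\mathrm{NCP}(T)$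 there is exactly one $\mathbf B'\in\mathrm{NCP}(T)$ with $\mathrm{Seg}(\mathbf B')=S_g(\rho^{-1}(\mathbf B))$. Writing $\mathrm{Kr}(\mathbf B)=\mathbf B'$ (the Kreweras complement), the map $\mathrm{Kr}:\mathrm{NCP}(T)\to\mathrm{NCP}(T)$ is a bijection. 5. For every $\mathbf B\in\mathrm{NCP}(T)$ there is exactly one red-green tree whose set of red segments is $\mathrm{Seg}(\mathbf B)$, and its set of green segments is $\mathrm{Seg}(\mathrm{Kr}(\mathbf B))$. -/

import Mathlib

/-- A tree embedded in a disk, a vertex being on the boundary circle exactly when it is a leaf.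
Up to isotopy such an embedding is the same as a cyclic ordering of the neighbours of each vertex:
`rot v` sends a neighbour of `v` to the next one in counterclockwise order (and fixes all vertices
that are not neighbours of `v`). Every vertex that is not a leaf has degree at least 3. -/
structure PlaneTree (V : Type*) where
  graph : SimpleGraph V
  isTree : graph.IsTree
  rot : V → Equiv.Perm V
  rot_fix : ∀ v w, ¬ graph.Adj v w → rot v w = w
  rot_cycle : ∀ v w w', graph.Adj v w → graph.Adj v w' → (rot v).SameCycle w w'
  three_le : ∀ v, (graph.neighborSet v).ncard ≠ 1 → 3 ≤ (graph.neighborSet v).ncard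

/-- The two colours of segments. -/
inductive SegColor where
  | red : SegColor
  | green : SegColor

namespace PlaneTree

variable {V : Type*} (T : PlaneTree V)

/-- Leaves. -/
def IsLeaf (v : V) : Prop := (T.graph.neighborSet v).ncard = 1

/-- Interior vertices. -/
def IsInner (v : V) : Prop := ¬ T.IsLeaf v

/-- The type of interior vertices. -/
abbrev Inner : Type _ := {v : V // T.IsInner v}

/-! ### Faces and corners -/

/-- Walking along the dart `d` with a face on the left, and arriving at an interior vertex, the same
face is on the left of the dart `d'` obtained by turning left. At a leaf the walk stops, since there
the face reaches the boundary of the disk. -/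
def faceStep (d d' : T.graph.Dart) : Prop :=
  T.IsInner d.snd ∧ d'.fst = d.snd ∧ d'.snd = (T.rot d.snd).symm d.fst

/-- A face, i.e. a two-dimensional region of the disk cut out by the tree, is a class of darts,
namely of those that have the face on their left. -/
def Face : Type _ := Quot T.faceStep

/-- The face on the left of a dart. -/
def leftFace (d : T.graph.Dart) : T.Face := Quot.mk _ d

/-- The face `F` contains the vertex `v`. -/
def FaceContains (F : T.Face) (v : V) : Prop :=
  ∃ d : T.graph.Dart, T.leftFace d = F ∧ (d.fst = v ∨ d.snd = v)

/-- A corner at the interior vertex `vertex`. It is the corner on the left of the edge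
from `vertex` to `next` (oriented away from `vertex`); so it lies between that edge and the
edge from `vertex` to `rot vertex next`. -/
structure Corner where
  vertex : V
  next : V
  inner : T.IsInner vertex
  adj : T.graph.Adj vertex next

/-- The face of a corner. -/
def Corner.face {T : PlaneTree V} (c : T.Corner) : T.Face :=
  T.leftFace ⟨(c.vertex, c.next), c.adj⟩

/-- `c'` is the corner immediately clockwise from the corner `c` (about the same vertex). -/
def ImmClockwise (c c' : T.Corner) : Prop :=
  c'.vertex = c.vertex ∧ c'.next = (T.rot c.vertex).symm c.next

/-! ### Acyclic paths, arcs and segments (identified with their vertex sets) -/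

/-- The acyclic path `[u, v]` with endpoints `u` and `v`, as a set of vertices. -/
def path (u v : V) : Set V := {x | ∃ p : T.graph.Walk u v, p.IsPath ∧ x ∈ p.support}

/-- Any two edges of `s` that meet at a vertex `b` are incident to a common face, i.e. they
are consecutive in the cyclic order at `b`. -/
def ConsecutiveEdges (s : Set V) : Prop :=
  ∀ a b c, a ∈ s → b ∈ s → c ∈ s → T.graph.Adj b a → T.graph.Adj b c → a ≠ c →
    T.rot b a = c ∨ T.rot b c = a

/-- Arcs: the endpoints are distinct leaves. -/
def IsArc (p : Set V) : Prop :=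
  ∃ u v, u ≠ v ∧ T.IsLeaf u ∧ T.IsLeaf v ∧ p = T.path u v ∧ T.ConsecutiveEdges p

/-- Segments: the endpoints are distinct interior vertices. -/
def IsSegment (s : Set V) : Prop :=
  ∃ u v, u ≠ v ∧ T.IsInner u ∧ T.IsInner v ∧ s = T.path u v ∧ T.ConsecutiveEdges s

/-- `v` is an endpoint of the acyclic path `s`. -/
def IsEndpoint (s : Set V) (v : V) : Prop := ∃ w, s = T.path v w

/-! ### The reduced noncrossing complex -/

/-- Two faces share an edge that does not belong to `p`. -/
def AdjacentOff (p : Set V) (F G : T.Face) : Prop :=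
  ∃ d : T.graph.Dart, ¬ (d.fst ∈ p ∧ d.snd ∈ p) ∧ F = T.leftFace d ∧ G = T.leftFace d.symm

/-- `Reg(p, F)`: the faces in the same component as `F` of the disk cut along the arc `p`. -/
def reg (p : Set V) (F : T.Face) : Set T.Face :=
  {G | Relation.ReflTransGen (T.AdjacentOff p) F G}

/-- The arcs `p` and `q` cross (along some segment). -/
def ArcsCross (p q : Set V) : Prop :=
  ∃ s, T.IsSegment s ∧ s ⊆ p ∧ s ⊆ q ∧
    ∀ F G : T.Face, ¬ (T.reg p F ⊆ T.reg q G) ∧ ¬ (T.reg q G ⊆ T.reg p F)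

/-- Boundary arcs: all the vertices lie on a common face. -/
def IsBoundaryArc (p : Set V) : Prop :=
  T.IsArc p ∧ ∃ F : T.Face, ∀ v ∈ p, T.FaceContains F v

/-- The simplices of the reduced noncrossing complex: sets of pairwise noncrossing arcs that
contain no boundary arc. -/
def IsReducedSimplex (F : Set (Set V)) : Prop :=
  (∀ p ∈ F, T.IsArc p ∧ ¬ T.IsBoundaryArc p) ∧ ∀ p ∈ F, ∀ q ∈ F, ¬ T.ArcsCross p q

/-- The facets of the reduced noncrossing complex. -/
def IsFacet (F : Set (Set V)) : Prop := Maximal T.IsReducedSimplex F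

/-- The set of facets of the reduced noncrossing complex, the vertices of the flip graph. -/
def Facet : Type _ := {F : Set (Set V) // T.IsFacet F}

/-- The facet of the (unreduced) noncrossing complex that corresponds to `F`: all boundary arcs
are added. -/
def withBoundary (F : Set (Set V)) : Set (Set V) := F ∪ {p | T.IsBoundaryArc p}

/-- The arc `p` contains the corner `c`: the two edges that bound the corner belong to `p`. -/
def ContainsCorner (p : Set V) (c : T.Corner) : Prop :=
  c.vertex ∈ p ∧ c.next ∈ p ∧ T.rot c.vertex c.next ∈ p

/-- The arc `p` of the facet `F` (or one of the added boundary arcs) is marked at the corner `c`: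
it is the largest among the arcs containing that corner. -/
def IsMarked (F : Set (Set V)) (p : Set V) (c : T.Corner) : Prop :=
  p ∈ T.withBoundary F ∧ T.ContainsCorner p c ∧
    ∀ q ∈ T.withBoundary F, T.ContainsCorner q c → T.reg q c.face ⊆ T.reg p c.face

/-! ### The oriented flip graph -/

/-- There is an edge `F → F'` labelled `s` in the oriented flip graph: `F'` is
obtained from `F` by flipping an arc `p` to an arc `q`, the arc `p` is marked in `F` at two
corners `c`, `d`, the arc `q` is marked in `F'` at the corners immediately clockwise from those,
and `s` is the segment between the vertices of these corners. -/
def OrientedFlip (F F' : T.Facet) (s : Set V) : Prop :=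
  ∃ p q, p ∈ F.1 ∧ q ∉ F.1 ∧ F'.1 = insert q (F.1 \ {p}) ∧
    ∃ c d c' d' : T.Corner, c.vertex ≠ d.vertex ∧
      T.ImmClockwise c c' ∧ T.ImmClockwise d d' ∧
      T.IsMarked F.1 p c ∧ T.IsMarked F.1 p d ∧
      T.IsMarked F'.1 q c' ∧ T.IsMarked F'.1 q d' ∧
      s = T.path c.vertex d.vertex

/-- The lower labels `S_r` of a facet. -/
def lowerLabels (F : T.Facet) : Set (Set V) := {s | ∃ F', T.OrientedFlip F' F s}

/-- The upper labels `S_g` of a facet. -/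
def upperLabels (F : T.Facet) : Set (Set V) := {s | ∃ F', T.OrientedFlip F F' s}

/-! ### Coloured segments and their admissible curves

The admissible curve of a coloured segment `s` starts in a corner at one endpoint, runs along `s`
and ends in a corner at the other endpoint. It may cross edges of `s`, but neither the
other edges of the tree nor small disks around the interior vertices. The region in which it may move is
simply connected, so up to isotopy the curve is determined by the corners through which it passes:

* at an endpoint `v` of `s`, it starts (or ends) in the corner to the left (green) or to the
  right (red) of the edge of `s` at `v`, oriented away from `v`;
* at any other vertex `v` of `s`, it passes through the corner between the two edges of `s` at `v`.

Next to each edge of `s` it therefore runs as a single strand parallel to that edge. -/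

/-- The coloured segment `x` has an endpoint (in the sense of corners) at `c`. -/
def IsEndCorner (x : SegColor × Set V) (c : T.Corner) : Prop :=
  T.IsEndpoint x.2 c.vertex ∧
    match x.1 with
    | SegColor.green => c.next ∈ x.2
    | SegColor.red => T.rot c.vertex c.next ∈ x.2

open Classical in
/-- What the curve of `x` does when, running along an edge of the segment from `v` to `w`, it
arrives at `w`. The four possibilities are ordered from left to right:
`0`: it turns left around `w`, staying outside of all curves that end in the corner there;
`1`: it ends in the corner at `w` on the left of the edge (red);
`2`: it ends in the corner at `w` on the right of the edge (green);
`3`: it turns right around `w`, staying outside of all curves that end in the corner there. -/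
noncomputable def exitPos (x : SegColor × Set V) (v w : V) : ℕ :=
  if (T.rot w).symm v ∈ x.2 then 0
  else if T.rot w v ∈ x.2 then 3
  else match x.1 with
    | SegColor.red => 1
    | SegColor.green => 2

/-- `L` describes a drawing of the curves of `x` and `y` without intersection, where `L v w` says
that on the edge between `v` and `w`, travelling from `v` to `w`, the strand of `x` is on the left
of the strand of `y`. Strands do not change sides along an edge or around a corner
that both of them pass, and if they separate at `w`, then the one
that exits further to the left has to be on the left. -/
structure IsDrawing (x y : SegColor × Set V) (L : V → V → Prop) : Prop where
  swap : ∀ v w, T.graph.Adj v w → v ∈ x.2 → w ∈ x.2 → v ∈ y.2 → w ∈ y.2 →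
    (L v w ↔ ¬ L w v)
  turn : ∀ u v w, T.graph.Adj u v → T.graph.Adj v w → u ≠ w →
    u ∈ x.2 → v ∈ x.2 → w ∈ x.2 → u ∈ y.2 → v ∈ y.2 → w ∈ y.2 → (L u v ↔ L v w)
  left : ∀ v w, T.graph.Adj v w → v ∈ x.2 → w ∈ x.2 → v ∈ y.2 → w ∈ y.2 →
    T.exitPos x v w < T.exitPos y v w → L v w
  right : ∀ v w, T.graph.Adj v w → v ∈ x.2 → w ∈ x.2 → v ∈ y.2 → w ∈ y.2 →
    T.exitPos y v w < T.exitPos x v w → ¬ L v w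

/-- Two coloured segments are noncrossing: they admit admissible curves that do not intersect; in
particular the curves have no common endpoint. -/
def Noncrossing (x y : SegColor × Set V) : Prop :=
  (∀ c : T.Corner, ¬ (T.IsEndCorner x c ∧ T.IsEndCorner y c)) ∧ ∃ L, T.IsDrawing x y L

/-! ### Noncrossing tree partitions -/

/-- `Seg(B)`: the inclusion-minimal segments whose endpoints lie in `B`. -/
def seg (B : Set V) : Set (Set V) :=
  {s | Minimal (fun t => T.IsSegment t ∧ ∀ v, T.IsEndpoint t v → v ∈ B) s}

/-- `B` is segment-connected. -/
def SegmentConnected (B : Set V) : Prop :=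
  ∀ u ∈ B, ∀ v ∈ B,
    Relation.ReflTransGen (fun x y => x ∈ B ∧ y ∈ B ∧ T.path x y ∈ T.seg B) u v

/-- The blocks of a set partition of the interior vertices, as sets of vertices. -/
def blocks (P : Setoid T.Inner) : Set (Set V) :=
  {B | ∃ C ∈ P.classes, B = Subtype.val '' C}

/-- `Seg(𝐁)` for a set partition `𝐁` of the interior vertices. -/
def segOf (P : Setoid T.Inner) : Set (Set V) := {s | ∃ B ∈ T.blocks P, s ∈ T.seg B}

/-- Noncrossing tree partitions (only red segments are used). -/
def IsNCP (P : Setoid T.Inner) : Prop :=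
  (∀ s ∈ T.segOf P, ∀ t ∈ T.segOf P, s ≠ t → T.Noncrossing (SegColor.red, s) (SegColor.red, t)) ∧
    ∀ B ∈ T.blocks P, T.SegmentConnected B

/-- The set `NCP(T)` of noncrossing tree partitions. -/
def NCP : Type _ := {P : Setoid T.Inner // T.IsNCP P}

/-- The partition `ρ(F)` of the interior vertices: two vertices are in the same block when they are
joined by a sequence of segments that are lower labels of `F`. -/
def rho (F : T.Facet) : Setoid T.Inner :=
  Relation.EqvGen.setoid (fun u v => T.path u.1 v.1 ∈ T.lowerLabels F)

/-- `B'` is a Kreweras complement of `B`: the segments of `B'` are the upper labels of the facet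
`ρ⁻¹(B)`. -/
def IsKrewerasComplement (B B' : T.NCP) : Prop :=
  ∃ F : T.Facet, T.rho F = B.1 ∧ T.segOf B'.1 = T.upperLabels F

/-! ### Red-green trees -/

/-- A red-green tree: a collection of pairwise noncrossing coloured segments such that any two
interior vertices are connected by a sequence of curves in the collection. -/
structure IsRedGreenTree (𝒯 : Set (SegColor × Set V)) : Prop where
  isSegment : ∀ x ∈ 𝒯, T.IsSegment x.2
  noncrossing : ∀ x ∈ 𝒯, ∀ y ∈ 𝒯, x ≠ y → T.Noncrossing x y
  connected : ∀ u v, T.IsInner u → T.IsInner v →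
    Relation.ReflTransGen (fun a b => ∃ x ∈ 𝒯, x.2 = T.path a b) u v

/-- The segments of colour `κ` in a collection of coloured segments. -/
def colorPart (κ : SegColor) (𝒯 : Set (SegColor × Set V)) : Set (Set V) := {s | (κ, s) ∈ 𝒯}

/-- The collection with red segments `R` and green segments `G`. -/
def redGreen (R G : Set (Set V)) : Set (SegColor × Set V) :=
  Prod.mk SegColor.red '' R ∪ Prod.mk SegColor.green '' G

end PlaneTree

/-! A facet is encoded by a set `X` of segments. An arc is compatible with `X` (`Good`) if every
segment at both of whose ends it turns left lies in `X`, and none at both of whose ends it turns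
right does. Crossing of arcs means that one turns left and the other right at both ends of a common
segment (`arcsCross_iff`), so compatible arcs never cross. If `X` is biclosed, the compatible arcs
other than boundary arcs form a facet (`facetOf_maximal`). Every facet arises so (`exists_facetOf`):
let the doubly left-turning pieces of its arcs generate `X`. An arc is marked at `v` exactly when
each of its turns, seen from `v`, is to the left if and only if the segment from `v` to that turn
lies in `X` (`isMarked_iff`). Each side of an arc carries at most one mark. If there are two, at `a`
and `b`, the segment `[a, b]` is a lower label when it belongs to `X` and an upper label otherwise
(`mem_lowerLabels`, `mem_upperLabels`); a downward flip deletes this segment from a suitable `X`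
(`LowerMark.exists_flip`). Reflecting the tree and complementing `X` exchanges left with right and
lower with upper, which halves the work.

The geometric core is that the arc carrying a label separates the ends of that label, while no other
compatible arc does (`Mark.sep`, `Mark.not_sep`). Hence the labels form a tree on the interior
vertices: a vertex can be moved towards another by crossing one separating arc at a time
(`marks_connected`), and each label is a bridge (`labelGraph_isTree`). Comparing turns of the
carrying arcs shows that labels are noncrossing, so every facet gives a red-green tree.

For `ρ`, a red path leaving a vertex towards another vertex of its block must start with a lower
label along the segment between them (`RedConn.exists_label`), whence `segOf_rho`. Conversely,
pairwise noncrossing red segments `S` generate a biclosed set `span S` whose lower labels are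
precisely the members of `S` (`RedFamily.exists_lowerMark`, `RedFamily.path_mem`). This gives
surjectivity of `ρ`.

Given any red-green tree, let `X` be the span of its red part. Every curve starts in a corner
belonging to some label of `X`, and no two curves share a corner. The labels form a tree and the
curves a connected graph, so by counting all these corners are used (`Extends.exists_of_colorMark`).
Induction on the size of the far side of the carrying arc then identifies the curves with the labels
(`Extends.mem_of_colorMark`). Thus a red-green tree is determined by its red part. Since the labels
also determine which vertices a marked arc separates, they determine the facet
(`facet_eq_of_lowerLabels`), and `ρ` is injective. The Kreweras map is the inverse of `ρ` followed
by the analogous bijection for the reflected tree. -/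

namespace PlaneTree

variable {V : Type*}

/-! ### Paths, directions and nearest-point projection in a tree -/

section TreePaths

variable (T : PlaneTree V)

/-- The acyclic walk between two vertices. -/
noncomputable def walk (u v : V) : T.graph.Walk u v := (T.isTree.existsUnique_path u v).choose

/-- The vertex after `u` on the way from `u` to `v`. -/
noncomputable def dir (u v : V) : V := (T.walk u v).snd

variable {T}

lemma walk_isPath (u v : V) : (T.walk u v).IsPath :=
  (T.isTree.existsUnique_path u v).choose_spec.1

lemma eq_walk {u v : V} {p : T.graph.Walk u v} (hp : p.IsPath) : p = T.walk u v :=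
  (T.isTree.existsUnique_path u v).unique hp (walk_isPath u v)

lemma mem_path {u v x : V} : x ∈ T.path u v ↔ x ∈ (T.walk u v).support := by
  constructor
  · rintro ⟨p, hp, hx⟩
    rwa [← eq_walk hp]
  · exact fun h => ⟨_, walk_isPath u v, h⟩

lemma left_mem (u v : V) : u ∈ T.path u v := mem_path.2 (SimpleGraph.Walk.start_mem_support _)

lemma right_mem (u v : V) : v ∈ T.path u v := mem_path.2 (SimpleGraph.Walk.end_mem_support _)

lemma path_comm (u v : V) : T.path u v = T.path v u := by
  ext x
  rw [mem_path, mem_path, ← eq_walk (walk_isPath (T := T) v u).reverse,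
    SimpleGraph.Walk.support_reverse, List.mem_reverse]

lemma path_self (u : V) : T.path u u = {u} := by
  ext x
  rw [mem_path, ← eq_walk (T := T) (SimpleGraph.Walk.IsPath.nil (u := u))]
  simp

lemma path_finite (u v : V) : (T.path u v).Finite := by
  have : T.path u v = {x | x ∈ (T.walk u v).support} := by ext; exact mem_path
  rw [this]
  exact List.finite_toSet _

lemma walk_split {u v w : V} (h : w ∈ T.path u v) :
    T.walk u v = (T.walk u w).append (T.walk w v) := by
  classical
  have h' := mem_path.1 h
  rw [← eq_walk ((walk_isPath (T := T) u v).takeUntil h'),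
    ← eq_walk ((walk_isPath (T := T) u v).dropUntil h'), SimpleGraph.Walk.take_spec]

lemma path_split {u v w : V} (h : w ∈ T.path u v) : T.path u v = T.path u w ∪ T.path w v := by
  ext x
  rw [Set.mem_union, mem_path, mem_path, mem_path, walk_split h,
    SimpleGraph.Walk.mem_support_append_iff]

lemma path_subset_left {u v w : V} (h : w ∈ T.path u v) : T.path u w ⊆ T.path u v := by
  rw [path_split h]; exact Set.subset_union_left

lemma path_subset_right {u v w : V} (h : w ∈ T.path u v) : T.path w v ⊆ T.path u v := by
  rw [path_split h]; exact Set.subset_union_right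

lemma path_inter {u v w x : V} (h : w ∈ T.path u v) (h1 : x ∈ T.path u w) (h2 : x ∈ T.path w v) :
    x = w := by
  have hp := walk_isPath (T := T) u v
  rw [walk_split h] at hp
  by_contra hne
  have hd := hp.support_nodup
  rw [SimpleGraph.Walk.support_append] at hd
  have := List.disjoint_of_nodup_append hd
  refine this (mem_path.1 h1) ?_
  have h3 := mem_path.1 h2
  rw [← SimpleGraph.Walk.cons_tail_support] at h3
  rcases List.mem_cons.1 h3 with h4 | h4
  · exact absurd h4 hne
  · exact h4

lemma adj_dir {u v : V} (h : u ≠ v) : T.graph.Adj u (T.dir u v) :=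
  SimpleGraph.Walk.adj_snd (SimpleGraph.Walk.not_nil_of_ne h)

lemma dir_ne {u v : V} (h : u ≠ v) : T.dir u v ≠ u := (adj_dir h).ne'

lemma dir_mem {u v : V} : T.dir u v ∈ T.path u v :=
  mem_path.2 (SimpleGraph.Walk.getVert_mem_support _ _)

lemma dir_of_adj {u v : V} (h : T.graph.Adj u v) : T.dir u v = v := by
  have : (SimpleGraph.Walk.cons h SimpleGraph.Walk.nil).IsPath := by
    simp [h.ne]
  rw [dir, ← eq_walk this]
  rfl

lemma dir_eq_of_mem {u v x : V} (h : x ∈ T.path u v) (hx : x ≠ u) : T.dir u x = T.dir u v := by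
  classical
  have h' := mem_path.1 h
  rw [dir, ← eq_walk ((walk_isPath (T := T) u v).takeUntil h'), SimpleGraph.Walk.snd_takeUntil hx]
  rfl

lemma mem_path_of_dir_ne {u v w : V} (hu : w ≠ u) (hv : w ≠ v) (h : T.dir w u ≠ T.dir w v) :
    w ∈ T.path u v := by
  refine ⟨(T.walk w u).reverse.append (T.walk w v), ?_, ?_⟩
  · rw [SimpleGraph.Walk.isPath_def, SimpleGraph.Walk.support_append, List.nodup_append]
    refine ⟨(walk_isPath w u).reverse.support_nodup,
      (walk_isPath w v).support_nodup.sublist (List.tail_sublist _), ?_⟩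
    rintro x hx _ hy rfl
    rw [SimpleGraph.Walk.support_reverse, List.mem_reverse] at hx
    have hne : x ≠ w := by
      rintro rfl
      have := (walk_isPath (T := T) x v).support_nodup
      rw [← SimpleGraph.Walk.cons_tail_support] at this
      exact (List.nodup_cons.1 this).1 hy
    exact h (((dir_eq_of_mem (mem_path.2 hx) hne)).symm.trans
      (dir_eq_of_mem (mem_path.2 (List.mem_of_mem_tail hy)) hne))
  · simp

lemma dir_ne_of_mem {u v w : V} (hu : w ≠ u) (h : w ∈ T.path u v) :
    T.dir w u ≠ T.dir w v := by
  intro h1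
  have h2 : T.dir w u ∈ T.path u w := by rw [path_comm]; exact dir_mem
  exact dir_ne hu (path_inter h h2 (h1 ▸ dir_mem))

lemma path_subset {a b u v : V} (ha : a ∈ T.path u v) (hb : b ∈ T.path u v) :
    T.path a b ⊆ T.path u v := by
  have hb' := hb
  rw [path_split ha] at hb'
  rcases hb' with h | h
  · rw [path_comm a b]
    exact (path_subset_right h).trans (path_subset_left ha)
  · exact (path_subset_left h).trans (path_subset_right ha)

/-- Of three vertices on a path, one lies between the other two. -/
lemma path_trichotomy {a b c u v : V} (ha : a ∈ T.path u v) (hb : b ∈ T.path u v)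
    (hc : c ∈ T.path u v) : b ∈ T.path a c ∨ a ∈ T.path b c ∨ c ∈ T.path a b := by
  have key : ∀ {x y z : V}, y ∈ T.path x z → ∀ {t}, t ∈ T.path x z →
      t ∈ T.path x y ∨ y ∈ T.path x t := by
    intro x y z hy t ht
    rw [path_split hy] at ht
    rcases ht with h | h
    · exact Or.inl h
    · right
      by_cases h1 : y = x
      · subst h1; exact left_mem _ _
      by_cases h2 : y = t
      · subst h2; exact right_mem _ _
      refine mem_path_of_dir_ne h1 h2 ?_
      rw [dir_eq_of_mem h (Ne.symm h2)]
      exact dir_ne_of_mem h1 hy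
  have hb' := hb
  rw [path_split ha] at hb'
  have hc' := hc
  rw [path_split ha] at hc'
  have mid : ∀ {x y : V}, x ∈ T.path u a → y ∈ T.path a v → a ∈ T.path x y := by
    intro x y hx hy
    by_cases h1 : a = x
    · subst h1; exact left_mem _ _
    by_cases h2 : a = y
    · subst h2; exact right_mem _ _
    refine mem_path_of_dir_ne h1 h2 ?_
    rw [path_comm] at hx
    rw [dir_eq_of_mem hx (Ne.symm h1), dir_eq_of_mem hy (Ne.symm h2)]
    refine dir_ne_of_mem ?_ ha
    rintro rfl
    rw [path_self] at hx
    exact h1 hx.symm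
  rcases hb' with h1 | h1 <;> rcases hc' with h2 | h2
  · rw [path_comm] at h1 h2
    rcases key h1 h2 with h | h
    · exact Or.inr (Or.inr h)
    · exact Or.inl h
  · exact Or.inr (Or.inl (mid h1 h2))
  · right; left; rw [path_comm]; exact mid h2 h1
  · rcases key h1 h2 with h | h
    · exact Or.inr (Or.inr h)
    · exact Or.inl h

/-- A neighbour in a path of a vertex of that path. -/
lemma adj_mem_path {u v w n : V} (hw : w ∈ T.path u v) (hn : n ∈ T.path u v)
    (h : T.graph.Adj w n) : (w ≠ u ∧ n = T.dir w u) ∨ (w ≠ v ∧ n = T.dir w v) := by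
  rw [path_split hw] at hn
  rcases hn with h1 | h1
  · left
    rw [path_comm] at h1
    refine ⟨?_, by rw [← dir_eq_of_mem h1 h.ne', dir_of_adj h]⟩
    rintro rfl
    rw [path_self] at h1
    exact h.ne' h1
  · right
    refine ⟨?_, by rw [← dir_eq_of_mem h1 h.ne', dir_of_adj h]⟩
    rintro rfl
    rw [path_self] at h1
    exact h.ne' h1

/-- A vertex `g` of the path nearest to `z` works: if it were not on the way to some `y`, its
neighbours towards `z` and towards `y` would coincide and be a nearer vertex of the path. -/
lemma exists_gate (u v z : V) : ∃ g ∈ T.path u v, ∀ y ∈ T.path u v, g ∈ T.path z y := by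
  obtain ⟨g, hg, hmin⟩ := (path_finite (T := T) u v).exists_minimalFor
    (fun g => (T.path z g).ncard) _ ⟨u, left_mem u v⟩
  refine ⟨g, hg, fun y hy => ?_⟩
  by_contra hcon
  have h1 : g ≠ z := by rintro rfl; exact hcon (left_mem _ _)
  have h2 : g ≠ y := by rintro rfl; exact hcon (right_mem _ _)
  have h3 : T.dir g z = T.dir g y := by
    by_contra h; exact hcon (mem_path_of_dir_ne h1 h2 h)
  have h4 : T.dir g z ∈ T.path u v := path_subset hg hy (h3 ▸ dir_mem)
  have h5 : T.dir g z ∈ T.path z g := by rw [path_comm]; exact dir_mem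
  have h6 : T.path z (T.dir g z) ⊂ T.path z g := by
    refine ⟨path_subset_left h5, fun h => ?_⟩
    have := h (right_mem z g)
    exact dir_ne h1 (path_inter h5 this (right_mem _ _)).symm
  have h7 := Set.ncard_lt_ncard h6 (path_finite _ _)
  exact absurd (hmin h4 h7.le) (not_le.2 h7)

open Classical in
/-- The vertex of `p` nearest to `z`, if `p` is a path. -/
noncomputable def gate (T : PlaneTree V) (p : Set V) (z : V) : V :=
  if h : ∃ g ∈ p, ∀ y ∈ p, g ∈ T.path z y then h.choose else z

/-- Vertex sets of acyclic paths. -/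
def IsPathSet (T : PlaneTree V) (p : Set V) : Prop := ∃ u v, p = T.path u v

lemma IsPathSet.exists_gate {p : Set V} (hp : T.IsPathSet p) (z : V) :
    ∃ g ∈ p, ∀ y ∈ p, g ∈ T.path z y := by
  obtain ⟨u, v, rfl⟩ := hp
  exact PlaneTree.exists_gate u v z

lemma gate_mem {p : Set V} (hp : T.IsPathSet p) (z : V) : T.gate p z ∈ p := by
  rw [gate, dif_pos (hp.exists_gate z)]
  exact (hp.exists_gate z).choose_spec.1

lemma gate_mem_path {p : Set V} (hp : T.IsPathSet p) (z : V) {y : V} (hy : y ∈ p) :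
    T.gate p z ∈ T.path z y := by
  rw [gate, dif_pos (hp.exists_gate z)]
  exact (hp.exists_gate z).choose_spec.2 y hy

lemma gate_unique {p : Set V} (hp : T.IsPathSet p) {z g : V} (hg : g ∈ p)
    (h : ∀ y ∈ p, g ∈ T.path z y) : T.gate p z = g := by
  exact (path_inter (gate_mem_path hp z hg) (h _ (gate_mem hp z)) (right_mem _ _)).symm

lemma gate_of_mem {p : Set V} (hp : T.IsPathSet p) {z : V} (hz : z ∈ p) : T.gate p z = z :=
  gate_unique hp hz fun _ _ => left_mem _ _

lemma IsPathSet.subset {p : Set V} (hp : T.IsPathSet p) {a b : V} (ha : a ∈ p) (hb : b ∈ p) :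
    T.path a b ⊆ p := by
  obtain ⟨u, v, rfl⟩ := hp
  exact path_subset ha hb

lemma IsPathSet.trichotomy {p : Set V} (hp : T.IsPathSet p) {a b c : V} (ha : a ∈ p) (hb : b ∈ p)
    (hc : c ∈ p) : b ∈ T.path a c ∨ a ∈ T.path b c ∨ c ∈ T.path a b := by
  obtain ⟨u, v, rfl⟩ := hp
  exact path_trichotomy ha hb hc

lemma IsPathSet.dir_mem {p : Set V} (hp : T.IsPathSet p) {a b : V} (ha : a ∈ p) (hb : b ∈ p) :
    T.dir a b ∈ p := hp.subset ha hb PlaneTree.dir_mem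

/-- The neighbours in a path of a vertex between two others. -/
lemma IsPathSet.adj_mem {p : Set V} (hp : T.IsPathSet p) {a b c n : V} (ha : a ∈ p) (hc : c ∈ p)
    (hb : b ∈ T.path a c) (hba : b ≠ a) (hbc : b ≠ c) (hn : n ∈ p) (h : T.graph.Adj b n) :
    n = T.dir b a ∨ n = T.dir b c := by
  have hb' := hp.subset ha hc hb
  have h1 := hp.dir_mem hb' ha
  have h2 := hp.dir_mem hb' hc
  have h3 := dir_ne_of_mem hba hb
  have h4 := adj_dir (T := T) hba
  have h5 := adj_dir (T := T) hbc
  obtain ⟨u, v, rfl⟩ := hp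
  have k1 := adj_mem_path hb' h1 h4
  have k2 := adj_mem_path hb' h2 h5
  have k3 := adj_mem_path hb' hn h
  grind

lemma isPathSet_path (u v : V) : T.IsPathSet (T.path u v) := ⟨u, v, rfl⟩

lemma mem_path_of_adj {w n z : V} (h : T.graph.Adj w n) (hz : w = z ∨ T.dir w z ≠ n) :
    w ∈ T.path n z := by
  by_cases hwz : w = z
  · subst hwz; exact right_mem _ _
  refine mem_path_of_dir_ne h.ne hwz ?_
  rw [dir_of_adj h]
  exact (hz.resolve_left hwz).symm

lemma dir_back {w n z : V} (h : T.graph.Adj w n) (hz : w = z ∨ T.dir w z ≠ n) :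
    T.dir n z = w := by
  rw [← dir_eq_of_mem (mem_path_of_adj h hz) h.ne, dir_of_adj h.symm]

lemma path_eq_insert {u v : V} (h : u ≠ v) : T.path u v = insert u (T.path (T.dir u v) v) := by
  rw [path_split (dir_mem (u := u) (v := v))]
  have h1 : T.path u (T.dir u v) = {u, T.dir u v} := by
    ext x
    constructor
    · intro hx
      by_cases hxu : x = u
      · exact Or.inl hxu
      right
      have h2 := dir_eq_of_mem hx hxu
      rw [dir_of_adj (adj_dir h)] at h2
      have h3 : T.dir u x ∈ T.path u x := dir_mem
      rw [h2] at h3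
      exact path_inter h3 hx (right_mem _ _) |>.trans rfl
    · rintro (rfl | rfl)
      · exact left_mem _ _
      · exact right_mem _ _
  rw [h1]
  ext x
  simp only [Set.mem_union, Set.mem_insert_iff, Set.mem_singleton_iff]
  constructor
  · rintro ((h | rfl) | h)
    · exact Or.inl h
    · exact Or.inr (left_mem _ _)
    · exact Or.inr h
  · rintro (h | h)
    · exact Or.inl (Or.inl h)
    · exact Or.inr h

lemma notMem_path_dir {u v : V} (h : u ≠ v) : u ∉ T.path (T.dir u v) v := by
  intro hu
  exact dir_ne h (path_inter (dir_mem (u := u) (v := v)) (left_mem _ _) hu).symm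

/-- The endpoints of an acyclic path are determined by its vertex set. -/
lemma path_inj_right {u v w : V} (h : T.path u v = T.path u w) : v = w := by
  have h1 : w ∈ T.path u v := h ▸ right_mem u w
  have h2 : v ∈ T.path u w := h ▸ right_mem u v
  exact path_inter h1 h2 (right_mem _ _)

lemma endpoint_iff {u v x : V} : T.IsEndpoint (T.path u v) x ↔ x = u ∨ x = v := by
  constructor
  · rintro ⟨w, hw⟩
    by_contra hcon
    push Not at hcon
    have hx : x ∈ T.path u v := hw ▸ left_mem x w
    have hu : u ∈ T.path x w := hw ▸ left_mem u v
    have hv : v ∈ T.path x w := hw ▸ right_mem u v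
    apply dir_ne_of_mem hcon.1 hx
    rw [dir_eq_of_mem hu hcon.1.symm, dir_eq_of_mem hv hcon.2.symm]
  · rintro (rfl | rfl)
    · exact ⟨v, rfl⟩
    · exact ⟨u, path_comm _ _⟩

lemma path_eq_iff {a b u v : V} :
    T.path a b = T.path u v ↔ (a = u ∧ b = v) ∨ (a = v ∧ b = u) := by
  constructor
  · intro h
    have ha : T.IsEndpoint (T.path u v) a := ⟨b, h.symm⟩
    rcases endpoint_iff.1 ha with rfl | rfl
    · exact Or.inl ⟨rfl, path_inj_right h⟩
    · rw [path_comm u] at h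
      exact Or.inr ⟨rfl, path_inj_right h⟩
  · rintro (⟨rfl, rfl⟩ | ⟨rfl, rfl⟩)
    · rfl
    · exact path_comm _ _

/-- If the way from `v` to `z` leaves the path `p` at `y`, it does so at the gate. -/
lemma gate_dir_notMem {p : Set V} (hp : T.IsPathSet p) {z : V} (hz : z ∉ p) :
    T.dir (T.gate p z) z ∉ p := by
  intro h
  have hne : T.gate p z ≠ z := fun h => hz (h ▸ gate_mem hp z)
  have h1 := gate_mem_path hp z h
  have h2 : T.dir (T.gate p z) z ∈ T.path z (T.gate p z) := by rw [path_comm]; exact dir_mem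
  exact dir_ne hne (path_inter h2 h1 (right_mem _ _)).symm

/-- Adjacent vertices have the same gate, unless both of them belong to the path. -/
lemma gate_eq_of_adj {p : Set V} (hp : T.IsPathSet p) {x y : V} (h : T.graph.Adj x y)
    (hxy : ¬ (x ∈ p ∧ y ∈ p)) : T.gate p x = T.gate p y := by
  wlog hx : x ∉ p generalizing x y
  · push Not at hx
    exact (this h.symm (fun h => hxy h.symm) fun hy => hxy ⟨hx, hy⟩).symm
  have hne : ∀ w ∈ p, x ≠ w := fun w hw h => hx (h ▸ hw)
  have hg := gate_mem hp x
  have hdir : ∀ w ∈ p, T.dir x w = T.dir x (T.gate p x) := fun w hw =>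
    (dir_eq_of_mem (gate_mem_path hp x hw) (hne _ hg).symm).symm
  refine (gate_unique hp hg fun w hw => ?_).symm
  have h1 := gate_mem_path hp x hw
  by_cases hn : T.dir x (T.gate p x) = y
  · rw [path_eq_insert (hne w hw), hdir w hw, hn] at h1
    exact h1.resolve_left (hne _ hg).symm
  · exact path_subset_right (mem_path_of_adj h (Or.inr (by rwa [hdir w hw]))) h1

end TreePaths

/-! ### Left and right turns along paths; segments and arcs -/

section Turns

variable {T : PlaneTree V}

lemma rot_adj {v n : V} (h : T.graph.Adj v n) : T.graph.Adj v (T.rot v n) := by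
  by_contra hcon
  have h1 := T.rot_fix v _ hcon
  have h2 := (T.rot v).injective h1
  rw [h2] at hcon
  exact hcon h

lemma rot_symm_adj {v n : V} (h : T.graph.Adj v n) : T.graph.Adj v ((T.rot v).symm n) := by
  by_contra hcon
  have h1 := T.rot_fix v _ hcon
  rw [Equiv.apply_symm_apply] at h1
  rw [← h1] at hcon
  exact hcon h

lemma rot_ne {v n : V} (hv : T.IsInner v) (h : T.graph.Adj v n) : T.rot v n ≠ n := by
  intro hfix
  have h3 := T.three_le v hv
  have hsub : T.graph.neighborSet v ⊆ {n} := by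
    intro w hw
    obtain ⟨k, hk⟩ := T.rot_cycle v n w h hw
    rw [Equiv.Perm.zpow_apply_eq_self_of_apply_eq_self hfix] at hk
    exact hk.symm
  have := Set.ncard_le_ncard hsub
  rw [Set.ncard_singleton] at this
  omega

/-- Degree at least three enters here: the neighbours on the two sides of an edge are different, so
that a turn cannot be both left and right. -/
lemma rot_rot_ne {v n : V} (hv : T.IsInner v) (h : T.graph.Adj v n) :
    T.rot v (T.rot v n) ≠ n := by
  intro hfix
  have h3 := T.three_le v hv
  have hsub : T.graph.neighborSet v ⊆ {n, T.rot v n} := by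
    intro w hw
    obtain ⟨k, hk⟩ := T.rot_cycle v n w h hw
    have := Equiv.Perm.zpow_apply_eq_of_apply_apply_eq_self hfix k
    rw [hk] at this
    exact this
  have := Set.ncard_le_ncard hsub
  have h4 : ({n, T.rot v n} : Set V).ncard ≤ 2 :=
    (Set.ncard_insert_le _ _).trans (by rw [Set.ncard_singleton])
  omega

lemma rot_symm_ne {v n : V} (hv : T.IsInner v) (h : T.graph.Adj v n) : (T.rot v).symm n ≠ n := by
  intro h1
  rw [Equiv.symm_apply_eq] at h1
  exact rot_ne hv h h1.symm

lemma rot_symm_ne_rot {v n : V} (hv : T.IsInner v) (h : T.graph.Adj v n) :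
    (T.rot v).symm n ≠ T.rot v n := by
  intro h1
  rw [Equiv.symm_apply_eq] at h1
  exact rot_rot_ne hv h h1.symm

lemma inner_of_adj_adj {v m n : V} (hm : T.graph.Adj v m) (hn : T.graph.Adj v n) (h : m ≠ n) :
    T.IsInner v := by
  intro hl
  obtain ⟨x, hx⟩ := Set.ncard_eq_one.1 hl
  have h1 : m ∈ ({x} : Set V) := hx ▸ hm
  have h2 : n ∈ ({x} : Set V) := hx ▸ hn
  exact h (h1.trans h2.symm)

/-- The vertex `b` lies strictly between `a` and `c`. -/
def Btw (T : PlaneTree V) (a b c : V) : Prop := b ≠ a ∧ b ≠ c ∧ b ∈ T.path a c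

lemma Btw.symm {a b c : V} (h : T.Btw a b c) : T.Btw c b a :=
  ⟨h.2.1, h.1, path_comm a c ▸ h.2.2⟩

/-- Betweenness is a local condition at the middle vertex, which reduces order arguments on paths to
comparisons of first edges. -/
lemma btw_iff {a b c : V} : T.Btw a b c ↔ b ≠ a ∧ b ≠ c ∧ T.dir b a ≠ T.dir b c :=
  ⟨fun h => ⟨h.1, h.2.1, dir_ne_of_mem h.1 h.2.2⟩,
    fun h => ⟨h.1, h.2.1, mem_path_of_dir_ne h.1 h.2.1 h.2.2⟩⟩

lemma Btw.dir_left {a b c : V} (h : T.Btw a b c) : T.dir a b = T.dir a c :=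
  dir_eq_of_mem h.2.2 h.1

lemma Btw.dir_right {a b c : V} (h : T.Btw a b c) : T.dir c b = T.dir c a :=
  h.symm.dir_left

lemma Btw.dir_ne {a b c : V} (h : T.Btw a b c) : T.dir b a ≠ T.dir b c := (btw_iff.1 h).2.2

lemma Btw.ne {a b c : V} (h : T.Btw a b c) : a ≠ c := by
  rintro rfl
  have := h.2.2
  rw [path_self] at this
  exact h.1 this

lemma Btw.inner {a b c : V} (h : T.Btw a b c) : T.IsInner b :=
  inner_of_adj_adj (adj_dir h.1) (adj_dir h.2.1) h.dir_ne

lemma btw_or_eq_of_mem {a b c : V} (h : b ∈ T.path a c) : b = a ∨ b = c ∨ T.Btw a b c := by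
  by_cases h1 : b = a
  · exact Or.inl h1
  by_cases h2 : b = c
  · exact Or.inr (Or.inl h2)
  exact Or.inr (Or.inr ⟨h1, h2, h⟩)

lemma IsPathSet.btw_trichotomy {p : Set V} (hp : T.IsPathSet p) {a b c : V} (ha : a ∈ p)
    (hb : b ∈ p) (hc : c ∈ p) (hab : a ≠ b) (hac : a ≠ c) (hbc : b ≠ c) :
    T.Btw a b c ∨ T.Btw b a c ∨ T.Btw a c b := by
  rcases hp.trichotomy ha hb hc with h | h | h
  · exact Or.inl ⟨hab.symm, hbc, h⟩
  · exact Or.inr (Or.inl ⟨hab, hac, h⟩)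
  · exact Or.inr (Or.inr ⟨hac.symm, hbc.symm, h⟩)

/-- If `b` is between `a` and `c` and `c` is between `b` and `d`, then both are between `a`
and `d`. -/
lemma Btw.trans_right {a b c d : V} (h : T.Btw a b c) (h' : T.Btw b c d) : T.Btw a b d :=
  btw_iff.2 ⟨h.1, by rintro rfl; exact h'.ne rfl, by rw [← h'.dir_left]; exact h.dir_ne⟩

/-- The path `p`, when coming from `v`, turns left at `w`. -/
def OutL (T : PlaneTree V) (p : Set V) (v w : V) : Prop := (T.rot w).symm (T.dir w v) ∈ p

/-- The path `p`, when coming from `v`, turns right at `w`. -/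
def OutR (T : PlaneTree V) (p : Set V) (v w : V) : Prop := T.rot w (T.dir w v) ∈ p

/-- Acyclic paths any two consecutive edges of which are incident to a common face. -/
structure Strip (T : PlaneTree V) (p : Set V) : Prop where
  isPathSet : T.IsPathSet p
  consecutive : T.ConsecutiveEdges p

lemma ConsecutiveEdges.mono {p q : Set V} (h : T.ConsecutiveEdges p)
    (hq : q ⊆ p) : T.ConsecutiveEdges q :=
  fun a b c ha hb hc => h a b c (hq ha) (hq hb) (hq hc)

namespace Strip

variable {p : Set V} {a b c : V}

lemma path_subset (hp : T.Strip p) (ha : a ∈ p) (hb : b ∈ p) : T.path a b ⊆ p :=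
  hp.isPathSet.subset ha hb

lemma sub (hp : T.Strip p) (ha : a ∈ p) (hb : b ∈ p) : T.Strip (T.path a b) :=
  ⟨isPathSet_path a b, hp.consecutive.mono (hp.path_subset ha hb)⟩

lemma btw_mem (hp : T.Strip p) (ha : a ∈ p) (hc : c ∈ p) (h : T.Btw a b c) : b ∈ p :=
  hp.path_subset ha hc h.2.2

lemma turn (hp : T.Strip p) (ha : a ∈ p) (hc : c ∈ p) (h : T.Btw a b c) :
    T.rot b (T.dir b a) = T.dir b c ∨ T.rot b (T.dir b c) = T.dir b a :=
  have hb := hp.btw_mem ha hc h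
  hp.consecutive _ b _ (hp.isPathSet.dir_mem hb ha) hb (hp.isPathSet.dir_mem hb hc)
    (adj_dir h.1) (adj_dir h.2.1) h.dir_ne

lemma outL_iff (hp : T.Strip p) (ha : a ∈ p) (hc : c ∈ p) (h : T.Btw a b c) :
    T.OutL p a b ↔ T.rot b (T.dir b c) = T.dir b a := by
  have hb := hp.btw_mem ha hc h
  constructor
  · intro h1
    rcases hp.isPathSet.adj_mem ha hc h.2.2 h.1 h.2.1 h1 (rot_symm_adj (adj_dir h.1)) with h2 | h2
    · exact absurd h2 (rot_symm_ne h.inner (adj_dir h.1))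
    · rw [← h2, Equiv.apply_symm_apply]
  · intro h1
    rw [OutL, ← h1, Equiv.symm_apply_apply]
    exact hp.isPathSet.dir_mem hb hc

lemma outR_iff (hp : T.Strip p) (ha : a ∈ p) (hc : c ∈ p) (h : T.Btw a b c) :
    T.OutR p a b ↔ T.rot b (T.dir b a) = T.dir b c := by
  have hb := hp.btw_mem ha hc h
  constructor
  · intro h1
    rcases hp.isPathSet.adj_mem ha hc h.2.2 h.1 h.2.1 h1 (rot_adj (adj_dir h.1)) with h2 | h2
    · exact absurd h2 (rot_ne h.inner (adj_dir h.1))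
    · exact h2
  · intro h1
    rw [OutR, h1]
    exact hp.isPathSet.dir_mem hb hc

/-- The relations between the turns at three vertices of a path. -/
lemma line (hp : T.Strip p) (ha : a ∈ p) (hc : c ∈ p) (h : T.Btw a b c) :
    (T.OutL p b a ↔ T.OutL p c a) ∧ (T.OutR p b a ↔ T.OutR p c a) ∧
    (T.OutL p b c ↔ T.OutL p a c) ∧ (T.OutR p b c ↔ T.OutR p a c) ∧
    (T.OutL p a b ↔ T.OutR p c b) ∧ (T.OutR p a b ↔ T.OutL p c b) ∧
    (T.OutL p a b ↔ ¬ T.OutR p a b) := by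
  -- The turn at an outer vertex depends only on the edge by which it is entered, and that edge is
  -- the same from either of the other two; traversing the middle vertex backwards exchanges left
  -- and right.
  refine ⟨by rw [OutL, OutL, h.dir_left], by rw [OutR, OutR, h.dir_left],
    by rw [OutL, OutL, h.dir_right], by rw [OutR, OutR, h.dir_right], ?_, ?_, ?_⟩
  · rw [hp.outL_iff ha hc h, hp.outR_iff hc ha h.symm]
  · rw [hp.outR_iff ha hc h, hp.outL_iff hc ha h.symm]
  · rw [hp.outL_iff ha hc h, hp.outR_iff ha hc h]
    constructor
    · intro h1 h2
      rw [← h2] at h1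
      exact rot_rot_ne h.inner (adj_dir h.1) h1
    · exact (hp.turn ha hc h).resolve_left

/-- The turns of a path are those of any longer path. -/
lemma outL_sub (hp : T.Strip p) {q : Set V} (hq : T.Strip q) (ha : a ∈ p) (hc : c ∈ p)
    (ha' : a ∈ q) (hc' : c ∈ q) (h : T.Btw a b c) : T.OutL p a b ↔ T.OutL q a b := by
  rw [hp.outL_iff ha hc h, hq.outL_iff ha' hc' h]

end Strip

/-- The only neighbour of an endpoint on the path is the one it is entered from. So a segment makes
neither turn at its endpoints, unlike an arc, which continues past every interior vertex. -/
lemma not_out_right {u v a : V} (hv : T.IsInner v) (ha : a ∈ T.path u v) (hav : a ≠ v) :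
    ¬ T.OutL (T.path u v) a v ∧ ¬ T.OutR (T.path u v) a v := by
  have hu : v ≠ u := by
    rintro rfl
    rw [path_self] at ha
    exact hav ha
  have h1 : T.dir v a = T.dir v u := dir_eq_of_mem (path_comm u v ▸ ha) hav
  constructor <;> intro h
  · rcases adj_mem_path (right_mem u v) h (rot_symm_adj (adj_dir hav.symm)) with h2 | h2
    · rw [h1] at h2
      exact rot_symm_ne hv (adj_dir hu) h2.2
    · exact h2.1 rfl
  · rcases adj_mem_path (right_mem u v) h (rot_adj (adj_dir hav.symm)) with h2 | h2
    · rw [h1] at h2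
      exact rot_ne hv (adj_dir hu) h2.2
    · exact h2.1 rfl

lemma not_out_left {u v a : V} (hu : T.IsInner u) (ha : a ∈ T.path u v) (hau : a ≠ u) :
    ¬ T.OutL (T.path u v) a u ∧ ¬ T.OutR (T.path u v) a u := by
  rw [path_comm] at ha ⊢
  exact not_out_right hu ha hau

/-- The path from `a` to `b` is a segment. -/
structure IsSeg (T : PlaneTree V) (a b : V) : Prop where
  ne : a ≠ b
  left : T.IsInner a
  right : T.IsInner b
  consecutive : T.ConsecutiveEdges (T.path a b)

lemma IsSeg.symm {a b : V} (h : T.IsSeg a b) : T.IsSeg b a :=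
  ⟨h.ne.symm, h.right, h.left, path_comm a b ▸ h.consecutive⟩

lemma IsSeg.strip {a b : V} (h : T.IsSeg a b) : T.Strip (T.path a b) :=
  ⟨isPathSet_path a b, h.consecutive⟩

lemma isSegment_iff {s : Set V} : T.IsSegment s ↔ ∃ a b, T.IsSeg a b ∧ s = T.path a b := by
  constructor
  · rintro ⟨u, v, h1, h2, h3, rfl, h4⟩
    exact ⟨u, v, ⟨h1, h2, h3, h4⟩, rfl⟩
  · rintro ⟨u, v, h, rfl⟩
    exact ⟨u, v, h.ne, h.left, h.right, rfl, h.consecutive⟩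

lemma Strip.isSeg {p : Set V} {a b : V} (hp : T.Strip p) (ha : a ∈ p) (hb : b ∈ p)
    (hab : a ≠ b) (hai : T.IsInner a) (hbi : T.IsInner b) : T.IsSeg a b :=
  ⟨hab, hai, hbi, (hp.sub ha hb).consecutive⟩

lemma IsSeg.sub_left {a b c : V} (h : T.IsSeg a c) (hb : T.Btw a b c) : T.IsSeg a b :=
  h.strip.isSeg (left_mem _ _) hb.2.2 hb.1.symm h.left hb.inner

lemma IsSeg.sub_right {a b c : V} (h : T.IsSeg a c) (hb : T.Btw a b c) : T.IsSeg b c :=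
  h.strip.isSeg hb.2.2 (right_mem _ _) hb.2.1 hb.inner h.right

lemma IsSegment.inner {s : Set V} (hs : T.IsSegment s) {a : V} (ha : a ∈ s) : T.IsInner a := by
  obtain ⟨u, v, h, rfl⟩ := isSegment_iff.1 hs
  rcases btw_or_eq_of_mem ha with rfl | rfl | h1
  · exact h.left
  · exact h.right
  · exact h1.inner

lemma IsSegment.strip {s : Set V} (hs : T.IsSegment s) : T.Strip s := by
  obtain ⟨u, v, h, rfl⟩ := isSegment_iff.1 hs
  exact h.strip

namespace IsArc

variable {p : Set V} {a b v w : V}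

lemma strip (hp : T.IsArc p) : T.Strip p := by
  obtain ⟨u, v, _, _, _, rfl, h⟩ := hp
  exact ⟨isPathSet_path u v, h⟩

lemma isSeg (hp : T.IsArc p) (ha : a ∈ p) (hb : b ∈ p)
    (hab : a ≠ b) (hai : T.IsInner a) (hbi : T.IsInner b) : T.IsSeg a b :=
  hp.strip.isSeg ha hb hab hai hbi

lemma exists_btw (hp : T.IsArc p) (hv : v ∈ p) (hw : w ∈ p) (hwi : T.IsInner w) (h : v ≠ w) :
    ∃ c ∈ p, T.Btw v w c := by
  obtain ⟨x, y, hxy, hx, hy, rfl, hc⟩ := hp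
  have hwx : w ≠ x := fun h => hwi (h ▸ hx)
  have hwy : w ≠ y := fun h => hwi (h ▸ hy)
  have hd := dir_ne_of_mem hwx hw
  by_cases h1 : T.dir w v = T.dir w x
  · exact ⟨y, right_mem _ _, btw_iff.2 ⟨h.symm, hwy, h1 ▸ hd⟩⟩
  · exact ⟨x, left_mem _ _, btw_iff.2 ⟨h.symm, hwx, h1⟩⟩

lemma outL_iff_not (hp : T.IsArc p) (hv : v ∈ p) (hw : w ∈ p) (hwi : T.IsInner w) (h : v ≠ w) :
    T.OutL p v w ↔ ¬ T.OutR p v w := by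
  obtain ⟨c, hc, hb⟩ := hp.exists_btw hv hw hwi h
  exact (hp.strip.line hv hc hb).2.2.2.2.2.2

end IsArc

end Turns

/-! ### Reflection of the plane tree -/

section Mirror

variable (T : PlaneTree V)

/-- The reflected plane tree. -/
def mirror : PlaneTree V where
  graph := T.graph
  isTree := T.isTree
  rot v := (T.rot v).symm
  rot_fix v w h := by
    rw [Equiv.symm_apply_eq]
    exact (T.rot_fix v w h).symm
  rot_cycle v w w' h h' := Equiv.Perm.sameCycle_inv.2 (T.rot_cycle v w w' h h')
  three_le := T.three_le

variable {T}

lemma mirror_path (u v : V) : T.mirror.path u v = T.path u v := rfl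

lemma mirror_isInner (v : V) : T.mirror.IsInner v ↔ T.IsInner v := Iff.rfl

lemma mirror_outL (p : Set V) (u v : V) : T.mirror.OutL p u v ↔ T.OutR p u v := Iff.rfl

lemma mirror_consecutiveEdges (p : Set V) :
    T.mirror.ConsecutiveEdges p ↔ T.ConsecutiveEdges p := by
  unfold ConsecutiveEdges
  refine forall₅_congr fun a b c _ _ => forall₄_congr fun _ _ _ _ => ?_
  change (T.rot b).symm a = c ∨ (T.rot b).symm c = a ↔ _
  rw [Equiv.symm_apply_eq, Equiv.symm_apply_eq]
  grind

lemma mirror_isArc (p : Set V) : T.mirror.IsArc p ↔ T.IsArc p := by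
  refine exists₂_congr fun u v => and_congr_right fun _ => and_congr_right fun _ =>
    and_congr_right fun _ => and_congr_right fun _ => mirror_consecutiveEdges p

lemma mirror_isSeg (a b : V) : T.mirror.IsSeg a b ↔ T.IsSeg a b :=
  ⟨fun h => ⟨h.1, h.2, h.3, (mirror_consecutiveEdges _).1 h.4⟩,
    fun h => ⟨h.1, h.2, h.3, (mirror_consecutiveEdges _).2 h.4⟩⟩

end Mirror

/-! ### Biclosed sets of segments and arcs compatible with them -/

section Good

variable (T : PlaneTree V)

/-- Continuing the segment from `a` to `b`, the path `p` turns left at both ends. -/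
structure LL (p : Set V) (a b : V) : Prop where
  ne : a ≠ b
  inner_left : T.IsInner a
  inner_right : T.IsInner b
  mem_left : a ∈ p
  mem_right : b ∈ p
  out_right : T.OutL p a b
  out_left : T.OutL p b a

/-- Continuing the segment from `a` to `b`, the path `p` turns right at both ends. -/
structure RR (p : Set V) (a b : V) : Prop where
  ne : a ≠ b
  inner_left : T.IsInner a
  inner_right : T.IsInner b
  mem_left : a ∈ p
  mem_right : b ∈ p
  out_right : T.OutR p a b
  out_left : T.OutR p b a

/-- The paths `p` and `q` leave a common segment on opposite sides at both of its ends. -/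
def Crosses (p q : Set V) : Prop := ∃ a b, (T.LL p a b ∧ T.RR q a b) ∨ (T.RR p a b ∧ T.LL q a b)

/-- The path `p` does not run along a single face. -/
def Bent (p : Set V) : Prop := ∃ a b, T.LL p a b ∨ T.RR p a b

/-- A biclosed set of segments, the segment from `a` to `b` being encoded by the pair `(a, b)`. -/
structure Biclosed (X : V → V → Prop) : Prop where
  symm : ∀ {a b}, X a b → X b a
  closed : ∀ {a b c}, T.IsSeg a c → T.Btw a b c → X a b → X b c → X a c
  coclosed : ∀ {a b c}, T.IsSeg a c → T.Btw a b c → X a c → X a b ∨ X b c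

/-- Arcs compatible with the set `X` of segments. -/
def Good (X : V → V → Prop) (p : Set V) : Prop :=
  (∀ a b, T.LL p a b → X a b) ∧ ∀ a b, T.RR p a b → ¬ X a b

/-- The turns of `p`, seen from `v`, are prescribed by `X`. -/
def Agrees (X : V → V → Prop) (p : Set V) (v : V) : Prop :=
  ∀ w ∈ p, T.IsInner w → w ≠ v → (X v w ↔ T.OutL p v w)

variable {T} {p q : Set V} {X : V → V → Prop} {a b v w : V}

lemma LL.symm (h : T.LL p a b) : T.LL p b a :=
  ⟨h.ne.symm, h.inner_right, h.inner_left, h.mem_right, h.mem_left, h.out_left, h.out_right⟩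

lemma RR.symm (h : T.RR p a b) : T.RR p b a :=
  ⟨h.ne.symm, h.inner_right, h.inner_left, h.mem_right, h.mem_left, h.out_left, h.out_right⟩

lemma mirror_LL : T.mirror.LL p a b ↔ T.RR p a b :=
  ⟨fun h => ⟨h.1, h.2, h.3, h.4, h.5, h.6, h.7⟩, fun h => ⟨h.1, h.2, h.3, h.4, h.5, h.6, h.7⟩⟩

lemma mirror_RR : T.mirror.RR p a b ↔ T.LL p a b :=
  ⟨fun h => ⟨h.1, h.2, h.3, h.4, h.5, h.6, h.7⟩, fun h => ⟨h.1, h.2, h.3, h.4, h.5, h.6, h.7⟩⟩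

lemma mirror_crosses : T.mirror.Crosses p q ↔ T.Crosses p q := by
  unfold Crosses
  simp only [mirror_LL, mirror_RR, or_comm]

lemma mirror_bent : T.mirror.Bent p ↔ T.Bent p := by
  unfold Bent
  simp only [mirror_LL, mirror_RR, or_comm]

/-- Complementation exchanges closedness and coclosedness. -/
lemma Biclosed.mirror (hX : T.Biclosed X) : T.mirror.Biclosed fun a b => ¬ X a b where
  symm h h' := h (hX.symm h')
  closed {a b c} hs hb h1 h2 h3 := by
    rcases hX.coclosed ((mirror_isSeg a c).1 hs) hb h3 with h | h
    exacts [h1 h, h2 h]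
  coclosed {a b c} hs hb h := by
    by_contra hcon
    push Not at hcon
    exact h (hX.closed ((mirror_isSeg a c).1 hs) hb hcon.1 hcon.2)

lemma mirror_good : T.mirror.Good (fun a b => ¬ X a b) p ↔ T.Good X p := by
  unfold Good
  simp only [mirror_LL, mirror_RR, not_not]
  exact and_comm

lemma mirror_agrees (hp : T.IsArc p) (hv : v ∈ p) :
    T.mirror.Agrees (fun a b => ¬ X a b) p v ↔ T.Agrees X p v := by
  refine forall₄_congr fun w hw hwi hwv => ?_
  have h1 := hp.outL_iff_not hv hw hwi hwv.symm
  rw [mirror_outL]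
  have h2 := mirror_isInner (T := T) w
  grind

lemma Crosses.symm (h : T.Crosses p q) : T.Crosses q p := by
  obtain ⟨a, b, h⟩ := h
  exact ⟨a, b, h.symm.imp And.symm And.symm⟩

lemma Crosses.bent (h : T.Crosses p q) : T.Bent p := by
  obtain ⟨a, b, h⟩ := h
  exact ⟨a, b, h.imp And.left And.left⟩

/-- At a crossing one arc would force the common segment into `X` and the other out of it. -/
lemma Good.not_crosses (hp : T.Good X p) (hq : T.Good X q) : ¬ T.Crosses p q := by
  rintro ⟨a, b, h | h⟩
  · exact hq.2 _ _ h.2 (hp.1 _ _ h.1)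
  · exact hp.2 _ _ h.1 (hq.1 _ _ h.2)

lemma good_of_not_bent (h : ¬ T.Bent p) : T.Good X p :=
  ⟨fun a b h' => absurd ⟨a, b, Or.inl h'⟩ h, fun a b h' => absurd ⟨a, b, Or.inr h'⟩ h⟩

lemma Biclosed.iff (hX : T.Biclosed X) : X a b ↔ X b a := ⟨hX.symm, hX.symm⟩

/-- If `v` lies between `a` and `b`, both halves belong to `X` and closedness applies. If `v` lies
beyond `a`, the arc turns left at `b` and right at `a` as seen from `v`, so `[v, b]` is in `X` and
`[v, a]` is not, and coclosedness applies; likewise beyond `b`. -/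
lemma Agrees.LL_of_good (hX : T.Biclosed X) (hp : T.IsArc p) (hv : v ∈ p) (hvi : T.IsInner v)
    (h : T.Agrees X p v) (hab : T.LL p a b) : X a b := by
  obtain ⟨hne, hai, hbi, ha, hb, h1, h2⟩ := hab
  by_cases hva : v = a
  · subst hva
    exact (h b hb hbi hne.symm).2 h1
  by_cases hvb : v = b
  · subst hvb
    exact hX.symm ((h a ha hai hne).2 h2)
  have ka := h a ha hai (Ne.symm hva)
  have kb := h b hb hbi (Ne.symm hvb)
  have oa := hp.outL_iff_not hv ha hai hva
  have ob := hp.outL_iff_not hv hb hbi hvb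
  rcases hp.strip.isPathSet.btw_trichotomy hv ha hb hva hvb hne with hc | hc | hc
  · have hl := hp.strip.line hv hb hc
    have hs := hp.isSeg hv hb hvb hvi hbi
    have := hX.coclosed hs hc
    grind
  · have hl := hp.strip.line ha hb hc
    have hs := hp.isSeg ha hb hne hai hbi
    have := hX.closed hs hc
    have := hX.iff (a := a) (b := v)
    grind
  · have hl := hp.strip.line hv ha hc
    have hs := hp.isSeg hv ha hva hvi hai
    have := hX.coclosed hs hc
    have := hX.iff (a := a) (b := b)
    grind

lemma Agrees.good (hX : T.Biclosed X) (hp : T.IsArc p) (hv : v ∈ p) (hvi : T.IsInner v)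
    (h : T.Agrees X p v) : T.Good X p := by
  refine ⟨fun a b => h.LL_of_good hX hp hv hvi, fun a b hab => ?_⟩
  exact ((mirror_agrees hp hv).2 h).LL_of_good hX.mirror ((mirror_isArc p).2 hp) hv hvi
    (mirror_LL.2 hab)

/-- On an arc, `v` and `w` lie on opposite sides if and only if the arc turns in the same
direction at the ends of the segment between them. -/
lemma IsArc.opp_iff (hp : T.IsArc p) {z : V} (hz : z ∈ p) (hzl : T.IsLeaf z) (ha : a ∈ p)
    (hb : b ∈ p) (hai : T.IsInner a) (hbi : T.IsInner b) (hab : a ≠ b) :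
    (T.OutL p a b ↔ T.OutL p b a) ↔ ¬ (T.OutL p z a ↔ T.OutL p z b) := by
  have hza : z ≠ a := by rintro rfl; exact hai hzl
  have hzb : z ≠ b := by rintro rfl; exact hbi hzl
  rcases hp.strip.isPathSet.btw_trichotomy hz ha hb hza hzb hab with hc | hc | hc
  · have hl := hp.strip.line hz hb hc
    grind
  · exact absurd hzl hc.inner
  · have hl := hp.strip.line hz ha hc
    grind

lemma IsArc.exists_leaf (hp : T.IsArc p) : ∃ z ∈ p, T.IsLeaf z := by
  obtain ⟨u, v, _, hu, _, rfl, _⟩ := hp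
  exact ⟨u, left_mem _ _, hu⟩

/-- On vertices on one side of an arc, the turns at the ends of each segment between two of them are
opposite, so "the turn at `w` seen from `v` agrees with `X`" is a tournament. Biclosedness makes it
transitive; the winner will be the mark on that side. -/
lemma beats_trans (hX : T.Biclosed X) (hp : T.IsArc p) {v w x : V} (hv : v ∈ p) (hw : w ∈ p)
    (hx : x ∈ p) (hvi : T.IsInner v) (hwi : T.IsInner w) (hxi : T.IsInner x) (hvw : v ≠ w)
    (hvx : v ≠ x) (hwx : w ≠ x)
    (h1 : T.OutL p v w ↔ ¬ T.OutL p w v) (h2 : T.OutL p v x ↔ ¬ T.OutL p x v)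
    (h3 : T.OutL p w x ↔ ¬ T.OutL p x w)
    (k1 : X v w ↔ T.OutL p v w) (k2 : X w x ↔ T.OutL p w x) : X v x ↔ T.OutL p v x := by
  have i1 := hX.iff (a := v) (b := w)
  have i2 := hX.iff (a := v) (b := x)
  have i3 := hX.iff (a := w) (b := x)
  rcases hp.strip.isPathSet.btw_trichotomy hv hw hx hvw hvx hwx with hc | hc | hc
  · have hl := hp.strip.line hv hx hc
    have hl' := hp.strip.line hx hv hc.symm
    have hs := hp.isSeg hv hx hvx hvi hxi
    have c1 := hX.closed hs hc
    have c2 := hX.coclosed hs hc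
    grind
  · have hl := hp.strip.line hw hx hc
    have hl' := hp.strip.line hx hw hc.symm
    have hs := hp.isSeg hw hx hwx hwi hxi
    have c1 := hX.closed hs hc
    have c2 := hX.coclosed hs hc
    grind
  · have hl := hp.strip.line hv hw hc
    have hl' := hp.strip.line hw hv hc.symm
    have hs := hp.isSeg hv hw hvw hvi hwi
    have c1 := hX.closed hs hc
    have c2 := hX.coclosed hs hc
    grind

/-- On each side of an arc there is a vertex which agrees with all vertices on the same side. -/
lemma exists_beats (hX : T.Biclosed X) (hp : T.IsArc p) {z : V} (hz : z ∈ p) (hzl : T.IsLeaf z)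
    (S : Finset V) (hS : S.Nonempty) (hSp : ∀ w ∈ S, w ∈ p ∧ T.IsInner w)
    (hside : ∀ v ∈ S, ∀ w ∈ S, (T.OutL p z v ↔ T.OutL p z w)) :
    ∃ v ∈ S, ∀ w ∈ S, w ≠ v → (X v w ↔ T.OutL p v w) := by
  classical
  have hsame : ∀ v ∈ S, ∀ w ∈ S, v ≠ w → (T.OutL p v w ↔ ¬ T.OutL p w v) := by
    intro v hv w hw hvw
    have := hp.opp_iff hz hzl (hSp v hv).1 (hSp w hw).1 (hSp v hv).2 (hSp w hw).2 hvw
    have := hside v hv w hw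
    grind
  clear hside
  induction hS using Finset.Nonempty.cons_induction with
  | singleton a =>
    refine ⟨a, Finset.mem_singleton_self a, fun w hw h => absurd (Finset.mem_singleton.1 hw) h⟩
  | cons a s ha hs ih =>
    obtain ⟨v, hv, hbest⟩ := ih (fun w hw => hSp w (Finset.mem_cons_of_mem hw))
      (fun v hv w hw => hsame v (Finset.mem_cons_of_mem hv) w (Finset.mem_cons_of_mem hw))
    have hva : v ≠ a := by rintro rfl; exact ha hv
    have ha' : a ∈ Finset.cons a s ha := Finset.mem_cons_self a s
    by_cases h : X v a ↔ T.OutL p v a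
    · refine ⟨v, Finset.mem_cons_of_mem hv, fun w hw hwv => ?_⟩
      rcases Finset.mem_cons.1 hw with rfl | hw
      · exact h
      · exact hbest w hw hwv
    -- `X` is symmetric while the two turns are opposite, so if `v` does not beat `a`, then `a`
    -- beats `v`, and by transitivity everything that `v` beats.
    · have hav : X a v ↔ T.OutL p a v := by
        have h1 := hsame v (Finset.mem_cons_of_mem hv) a ha' hva
        have h2 := hX.iff (a := a) (b := v)
        grind
      refine ⟨a, ha', fun w hw hwa => ?_⟩
      have hws := (Finset.mem_cons.1 hw).resolve_left hwa
      by_cases hwv : w = v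
      · subst hwv; exact hav
      have hv' : v ∈ Finset.cons a s ha := Finset.mem_cons_of_mem hv
      exact beats_trans hX hp (hSp a ha').1 (hSp v hv').1 (hSp w hw).1 (hSp a ha').2 (hSp v hv').2
        (hSp w hw).2 hva.symm (Ne.symm hwa) (Ne.symm hwv) (hsame a ha' v hv' hva.symm)
        (hsame a ha' w hw (Ne.symm hwa)) (hsame v hv' w hw (Ne.symm hwv)) hav (hbest w hws hwv)

/-- Each side of a compatible arc has a vertex from which all turns are prescribed by `X`. -/
lemma Good.exists_agrees [Finite V] (hX : T.Biclosed X) (hp : T.IsArc p) (hg : T.Good X p)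
    (ha : a ∈ p) (hai : T.IsInner a) :
    ∃ v ∈ p, T.IsInner v ∧ T.Agrees X p v ∧ (v ≠ a → (T.OutL p v a ↔ ¬ T.OutL p a v)) := by
  classical
  obtain ⟨z, hz, hzl⟩ := hp.exists_leaf
  obtain ⟨S, hS⟩ : ∃ S : Finset V, ∀ w, w ∈ S ↔ w ∈ p ∧ T.IsInner w ∧
      (T.OutL p z w ↔ T.OutL p z a) :=
    ⟨(Set.toFinite {w | w ∈ p ∧ T.IsInner w ∧ (T.OutL p z w ↔ T.OutL p z a)}).toFinset,
      fun w => by rw [Set.Finite.mem_toFinset]; rfl⟩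
  obtain ⟨v, hvS, hbest⟩ := exists_beats hX hp hz hzl S ⟨a, (hS a).2 ⟨ha, hai, Iff.rfl⟩⟩
    (fun w hw => ⟨((hS w).1 hw).1, ((hS w).1 hw).2.1⟩)
    (fun v hv w hw => ((hS v).1 hv).2.2.trans ((hS w).1 hw).2.2.symm)
  obtain ⟨hv, hvi, hva⟩ := (hS v).1 hvS
  refine ⟨v, hv, hvi, fun w hw hwi hwv => ?_, fun hne => ?_⟩
  · by_cases hwS : w ∈ S
    · exact hbest w hwS hwv
    -- For `w` on the other side, the arc turns the same way at both ends of `[v, w]`, and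
    -- compatibility alone gives the agreement.
    have h1 : ¬ (T.OutL p z w ↔ T.OutL p z a) := fun h => hwS ((hS w).2 ⟨hw, hwi, h⟩)
    have h2 := hp.opp_iff hz hzl hv hw hvi hwi hwv.symm
    have h3 := hp.outL_iff_not hv hw hwi hwv.symm
    have h4 := hp.outL_iff_not hw hv hvi hwv
    have h5 := fun h h' => hg.1 v w ⟨hwv.symm, hvi, hwi, hv, hw, h, h'⟩
    have h6 := fun h h' => hg.2 v w ⟨hwv.symm, hvi, hwi, hv, hw, h, h'⟩
    grind
  · have := hp.opp_iff hz hzl hv ha hvi hai hne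
    grind

end Good

/-! ### Construction of arcs with prescribed turns, and where arcs diverge -/

section Arcs

variable {T : PlaneTree V}

lemma path_of_adj {u v : V} (h : T.graph.Adj u v) : T.path u v = {u, v} := by
  rw [path_eq_insert h.ne, dir_of_adj h, path_self]

lemma not_btw_of_adj {u v w : V} (h : T.graph.Adj u v) : ¬ T.Btw u w v := by
  rintro ⟨h1, h2, h3⟩
  rw [path_of_adj h] at h3
  rcases h3 with rfl | rfl
  · exact h1 rfl
  · exact h2 rfl

lemma Btw.trans_left {a b c d : V} (h : T.Btw a b d) (h' : T.Btw a d c) : T.Btw b d c :=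
  btw_iff.2 ⟨h.2.1.symm, h'.2.1, by rw [h.dir_right]; exact h'.dir_ne⟩

lemma Btw.trans_mid {a b c d : V} (h : T.Btw a b d) (h' : T.Btw a d c) : T.Btw a b c :=
  h.trans_right (h.trans_left h')

/-- Starting along an edge and turning left exactly at the vertices in `P`, one arrives at a
leaf. -/
lemma exists_ray [Finite V] {v n : V} (hn : T.graph.Adj v n) (P : V → Prop) :
    ∃ z, T.IsLeaf z ∧ z ≠ v ∧ T.dir v z = n ∧ ∀ w, T.Btw v w z →
      (P w → T.rot w (T.dir w z) = T.dir w v) ∧ (¬ P w → T.rot w (T.dir w v) = T.dir w z) := by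
  classical
  let S : Set V := {z | z ≠ v ∧ T.dir v z = n ∧ ∀ w, T.Btw v w z →
      (P w → T.rot w (T.dir w z) = T.dir w v) ∧ (¬ P w → T.rot w (T.dir w v) = T.dir w z)}
  have hS : S.Nonempty := ⟨n, hn.ne', dir_of_adj hn, fun w hw => absurd hw (not_btw_of_adj hn)⟩
  -- Take a longest path with the prescribed turns; if it ended at an interior vertex, one more edge
  -- could be added.
  obtain ⟨z, hz, hmax⟩ := (Set.toFinite S).exists_maximalFor (fun z => (T.path v z).ncard) _ hS
  by_cases hzl : T.IsLeaf z
  · exact ⟨z, hzl, hz⟩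
  exfalso
  obtain ⟨hzv, hd, hturn⟩ := hz
  have hadj := adj_dir (T := T) hzv
  obtain ⟨m, hm, hmne, hP, hnP⟩ : ∃ m, T.graph.Adj z m ∧ m ≠ T.dir z v ∧
      (P z → T.rot z m = T.dir z v) ∧ (¬ P z → T.rot z (T.dir z v) = m) := by
    by_cases h : P z
    · exact ⟨(T.rot z).symm (T.dir z v), rot_symm_adj hadj, rot_symm_ne hzl hadj,
        fun _ => Equiv.apply_symm_apply _ _, fun h' => absurd h h'⟩
    · exact ⟨T.rot z (T.dir z v), rot_adj hadj, rot_ne hzl hadj, fun h' => absurd h' h,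
        fun _ => rfl⟩
  have hmv : m ≠ v := by
    rintro rfl
    exact hmne (dir_of_adj hm).symm
  have hb : T.Btw v z m := btw_iff.2 ⟨hzv, hm.ne, by rw [dir_of_adj hm]; exact hmne.symm⟩
  have hmS : m ∈ S := by
    refine ⟨hmv, by rw [← hb.dir_left]; exact hd, fun w hw => ?_⟩
    by_cases hwz : w = z
    · subst hwz
      rw [dir_of_adj hm]
      exact ⟨hP, hnP⟩
    have hw2 := hw.2.2
    rw [path_split hb.2.2, path_of_adj hm] at hw2
    have hw3 : T.Btw v w z := by
      rcases hw2 with h | h | h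
      · exact ⟨hw.1, hwz, h⟩
      · exact absurd h hwz
      · exact absurd h hw.2.1
    rw [← (hw3.trans_left hb).dir_left]
    exact hturn w hw3
  have hlt : (T.path v z).ncard < (T.path v m).ncard := by
    refine Set.ncard_lt_ncard ⟨path_subset_left hb.2.2, fun h => ?_⟩ (path_finite _ _)
    exact hb.2.1 (path_inter hb.2.2 (h (right_mem v m)) (right_mem _ _)).symm
  exact absurd (hmax hmS hlt.le) (not_le.2 hlt)

lemma eq_of_adj_leaf {z a b : V} (hz : T.IsLeaf z) (ha : T.graph.Adj z a) (hb : T.graph.Adj z b) :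
    a = b := by
  by_contra h
  exact inner_of_adj_adj ha hb h hz

/-- The arc through a given corner with prescribed turns. -/
lemma exists_arc [Finite V] {v n : V} (hv : T.IsInner v) (hn : T.graph.Adj v n) (P : V → Prop) :
    ∃ p, T.IsArc p ∧ v ∈ p ∧ n ∈ p ∧ T.rot v n ∈ p ∧
      ∀ w ∈ p, T.IsInner w → w ≠ v → (P w ↔ T.OutL p v w) := by
  obtain ⟨z₁, hz₁, hne₁, hd₁, ht₁⟩ := exists_ray hn P
  obtain ⟨z₂, hz₂, hne₂, hd₂, ht₂⟩ := exists_ray (rot_adj hn) P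
  have hb : T.Btw z₁ v z₂ := btw_iff.2 ⟨hne₁.symm, hne₂.symm, by
    rw [hd₁, hd₂]; exact (rot_ne hv hn).symm⟩
  have hsplit : ∀ w ∈ T.path z₁ z₂, w = v ∨ T.IsLeaf w ∨ T.Btw v w z₁ ∨ T.Btw v w z₂ := by
    intro w hw
    rw [path_split hb.2.2, path_comm z₁] at hw
    rcases hw with h | h
    · rcases btw_or_eq_of_mem h with rfl | rfl | h
      · exact Or.inl rfl
      · exact Or.inr (Or.inl hz₁)
      · exact Or.inr (Or.inr (Or.inl h))
    · rcases btw_or_eq_of_mem h with rfl | rfl | h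
      · exact Or.inl rfl
      · exact Or.inr (Or.inl hz₂)
      · exact Or.inr (Or.inr (Or.inr h))
  have hcons : T.ConsecutiveEdges (T.path z₁ z₂) := by
    intro a b c ha hbp hc hba hbc hac
    have key : ∀ x y, T.Btw x b y → x ∈ T.path z₁ z₂ → y ∈ T.path z₁ z₂ →
        (T.rot b (T.dir b x) = T.dir b y ∨ T.rot b (T.dir b y) = T.dir b x) →
        (T.rot b a = c ∨ T.rot b c = a) := by
      intro x y hxy hx hy h
      have h1 := (isPathSet_path z₁ z₂).adj_mem hx hy hxy.2.2 hxy.1 hxy.2.1 ha hba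
      have h2 := (isPathSet_path z₁ z₂).adj_mem hx hy hxy.2.2 hxy.1 hxy.2.1 hc hbc
      grind
    have hl := left_mem (T := T) z₁ z₂
    have hr := right_mem (T := T) z₁ z₂
    rcases hsplit b hbp with rfl | h | h | h
    · exact key z₁ z₂ hb hl hr (Or.inl (by rw [hd₁, hd₂]))
    · exact absurd (eq_of_adj_leaf h hba hbc) hac
    · refine key v z₁ h hb.2.2 hl ?_
      have := ht₁ b h
      by_cases hP : P b
      · exact Or.inr (this.1 hP)
      · exact Or.inl (this.2 hP)
    · refine key v z₂ h hb.2.2 hr ?_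
      have := ht₂ b h
      by_cases hP : P b
      · exact Or.inr (this.1 hP)
      · exact Or.inl (this.2 hP)
  have harc : T.IsArc (T.path z₁ z₂) := ⟨z₁, z₂, hb.ne, hz₁, hz₂, rfl, hcons⟩
  refine ⟨_, harc, hb.2.2, ?_, ?_, fun w hw hwi hwv => ?_⟩
  · rw [← hd₁]; exact harc.strip.isPathSet.dir_mem hb.2.2 (left_mem _ _)
  · rw [← hd₂]; exact harc.strip.isPathSet.dir_mem hb.2.2 (right_mem _ _)
  rcases hsplit w hw with h | h | h | h
  · exact absurd h hwv
  · exact absurd h hwi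
  · have := ht₁ w h
    rw [harc.strip.outL_iff hb.2.2 (left_mem _ _) h]
    refine ⟨this.1, fun h1 => ?_⟩
    by_contra hP
    have h2 := this.2 hP
    rw [← h2] at h1
    exact rot_rot_ne h.inner (adj_dir h.1) h1
  · have := ht₂ w h
    rw [harc.strip.outL_iff hb.2.2 (right_mem _ _) h]
    refine ⟨this.1, fun h1 => ?_⟩
    by_contra hP
    have h2 := this.2 hP
    rw [← h2] at h1
    exact rot_rot_ne h.inner (adj_dir h.1) h1

/-- Where a path `r` leaves an arc `q`, the two turn in opposite directions. -/
lemma IsArc.diverge_gate {q r : Set V} (hq : T.IsArc q) (hr : T.Strip r) {v z : V} (hvq : v ∈ q)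
    (hvr : v ∈ r) (hzr : z ∈ r) (hzq : z ∉ q) (hd : T.dir v z ∈ q) :
    T.Btw v (T.gate q z) z ∧ T.gate q z ∈ q ∧ T.gate q z ∈ r ∧ T.dir (T.gate q z) z ∉ q ∧
      (T.OutL r v (T.gate q z) ↔ T.OutR q v (T.gate q z)) ∧
      (T.OutR r v (T.gate q z) ↔ T.OutL q v (T.gate q z)) := by
  have hps := hq.strip.isPathSet
  have hg := gate_mem hps z
  have hgd := gate_dir_notMem hps hzq
  have hgz : T.gate q z ≠ z := fun h => hzq (h ▸ hg)
  have hgv : T.gate q z ≠ v := fun h => hgd (h ▸ hd)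
  have hb : T.Btw v (T.gate q z) z := ⟨hgv, hgz, path_comm z v ▸ gate_mem_path hps z hvq⟩
  have hgr := hr.btw_mem hvr hzr hb
  refine ⟨hb, hg, hgr, hgd, ?_⟩
  have h1 := hq.outL_iff_not hvq hg hb.inner hgv.symm
  have h2 := hr.outL_iff hvr hzr hb
  have h3 := hr.outR_iff hvr hzr hb
  have h4 := (hr.line hvr hzr hb).2.2.2.2.2.2
  have h5 : T.OutL r v (T.gate q z) → ¬ T.OutL q v (T.gate q z) := by
    intro h h'
    rw [OutL, ← h2.1 h, Equiv.symm_apply_apply] at h'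
    exact hgd h'
  have h6 : T.OutR r v (T.gate q z) → ¬ T.OutR q v (T.gate q z) := by
    intro h h'
    rw [OutR, h3.1 h] at h'
    exact hgd h'
  grind

lemma IsArc.diverge {q r : Set V} (hq : T.IsArc q) (hr : T.Strip r) {v z : V} (hvq : v ∈ q)
    (hvr : v ∈ r) (hzr : z ∈ r) (hzq : z ∉ q) (hd : T.dir v z ∈ q) :
    ∃ g, T.Btw v g z ∧ g ∈ q ∧ g ∈ r ∧ T.dir g z ∉ q ∧
      (T.OutL r v g ↔ T.OutR q v g) ∧ (T.OutR r v g ↔ T.OutL q v g) :=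
  ⟨_, hq.diverge_gate hr hvq hvr hzr hzq hd⟩

/-- An arc is determined by a corner and its turns. -/
lemma IsArc.eq_of_turns {p q : Set V} (hp : T.IsArc p) (hq : T.IsArc q) {v n : V}
    (hv : T.IsInner v) (hn : T.graph.Adj v n) (hvp : v ∈ p) (hvq : v ∈ q) (hnp : n ∈ p)
    (hnq : n ∈ q) (hrp : T.rot v n ∈ p) (hrq : T.rot v n ∈ q)
    (h : ∀ w ∈ p, w ∈ q → T.IsInner w → w ≠ v → (T.OutL p v w ↔ T.OutL q v w)) : p = q := by
  have key : ∀ {p q : Set V}, T.IsArc p → T.IsArc q → v ∈ p → v ∈ q → n ∈ p → n ∈ q →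
      T.rot v n ∈ p → T.rot v n ∈ q →
      (∀ w ∈ p, w ∈ q → T.IsInner w → w ≠ v → (T.OutL p v w ↔ T.OutL q v w)) → p ⊆ q := by
    intro p q hp hq hvp hvq hnp hnq hrp hrq h z hz
    by_contra hzq
    have hzv : v ≠ z := fun h => hzq (h ▸ hvq)
    have hd : T.dir v z ∈ q := by
      obtain ⟨x, y, hxy, hx, hy, rfl, hc⟩ := hp
      have hvx : v ≠ x := fun h => hv (h ▸ hx)
      have h1 := adj_mem_path hvp ((isPathSet_path x y).dir_mem hvp hz) (adj_dir hzv)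
      have h2 := adj_mem_path hvp hnp hn
      have h3 := adj_mem_path hvp hrp (rot_adj hn)
      have h4 := rot_ne hv hn
      grind
    obtain ⟨g, hb, hgq, hgp, hgd, h1, h2⟩ := hq.diverge hp.strip hvq hvp hz hzq hd
    have h3 := h g hgp hgq hb.inner hb.1
    have h4 := hq.outL_iff_not hvq hgq hb.inner hb.1.symm
    have h5 := hp.outL_iff_not hvp hgp hb.inner hb.1.symm
    grind
  exact (key hp hq hvp hvq hnp hnq hrp hrq h).antisymm
    (key hq hp hvq hvp hnq hnp hrq hrp fun w h1 h2 h3 h4 => (h w h2 h1 h3 h4).symm)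

end Arcs

/-! ### Facets as the compatible arcs of a biclosed set -/

section Facets

variable {T : PlaneTree V}

/-- Closure of a set of segments under concatenation. -/
inductive Gen (T : PlaneTree V) (A : V → V → Prop) : V → V → Prop
  | base {a b : V} : A a b → Gen T A a b
  | concat {a b c : V} : T.IsSeg a c → T.Btw a b c → Gen T A a b → Gen T A b c → Gen T A a c

/-- Sets of segments closed under passing to initial parts after which the segment turns left. -/
def Tors (T : PlaneTree V) (X : V → V → Prop) : Prop :=
  ∀ a b c, T.IsSeg a c → T.Btw a b c → X a c → T.OutL (T.path a c) a b → X a b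

variable {A : V → V → Prop}

lemma Gen.symm (hA : ∀ a b, A a b → A b a) {a b : V} (h : T.Gen A a b) : T.Gen A b a := by
  induction h with
  | base h => exact .base (hA _ _ h)
  | concat hs hb _ _ ih1 ih2 => exact .concat hs.symm hb.symm ih2 ih1

/-- For a concatenation at `m`, an initial part ending before `m` is an initial part of the first
factor, and one ending after `m` is the first factor followed by an initial part of the second. -/
lemma Gen.tors
    (hq : ∀ a b c, A a c → T.Btw a b c → T.OutL (T.path a c) a b → A a b) :
    T.Tors (T.Gen A) := by
  intro a b c _ hb h hL
  induction h generalizing b with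
  | base h => exact .base (hq _ _ _ h hb hL)
  | @concat a m c hac hm h1 h2 ih1 ih2 =>
    have hst := hac.strip
    have hl := left_mem (T := T) a c
    have hr := right_mem (T := T) a c
    by_cases hbm : b = m
    · subst hbm; exact h1
    have hb2 := hb.2.2
    rw [path_split hm.2.2] at hb2
    rcases hb2 with h | h
    · have hb' : T.Btw a b m := ⟨hb.1, hbm, h⟩
      refine ih1 b (hac.sub_left hm) hb' ?_
      rwa [(hst.sub hl hm.2.2).outL_sub hst (left_mem _ _) (right_mem _ _) hl hm.2.2 hb']
    · have hb' : T.Btw m b c := ⟨hbm, hb.2.1, h⟩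
      have hab : T.Btw a m b := (hb'.symm.trans_left hm.symm).symm
      refine .concat (hac.sub_left hb) hab h1 (ih2 b (hac.sub_right hm) hb' ?_)
      rw [(hst.sub hm.2.2 hr).outL_sub hst (left_mem _ _) (right_mem _ _) hm.2.2 hr hb']
      have h3 := hst.line hl (hst.btw_mem hl hr hb) hab
      exact h3.2.2.1.2 hL

/-- At each intermediate vertex the segment turns left as seen from exactly one of its ends, and the
part from that end is in `X`; so coclosedness comes for free. -/
lemma Tors.biclosed {X : V → V → Prop} (hT : T.Tors X) (hsymm : ∀ a b, X a b → X b a)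
    (hc : ∀ a b c, T.IsSeg a c → T.Btw a b c → X a b → X b c → X a c) : T.Biclosed X where
  symm h := hsymm _ _ h
  closed := hc _ _ _
  coclosed {a b c} hs hb h := by
    have hl := hs.strip.line (left_mem _ _) (right_mem _ _) hb
    by_cases h1 : T.OutL (T.path a c) a b
    · exact Or.inl (hT _ _ _ hs hb h h1)
    · right
      refine hsymm _ _ (hT _ _ _ hs.symm hb.symm (hsymm _ _ h) ?_)
      rw [path_comm]
      grind

lemma Gen.biclosed (hA : ∀ a b, A a b → A b a)
    (hq : ∀ a b c, A a c → T.Btw a b c → T.OutL (T.path a c) a b → A a b) :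
    T.Biclosed (T.Gen A) :=
  (Gen.tors hq).biclosed (fun _ _ => Gen.symm hA) fun _ _ _ => Gen.concat

/-- If a path `s` turns left at neither end of a generated segment, then the same is true for one
of the generators. -/
lemma Gen.exists_base {s : Set V} (hs : T.Strip s) {a b : V} (h : T.Gen A a b) (ha : a ∈ s)
    (hb : b ∈ s) (h1 : ¬ T.OutL s a b) (h2 : ¬ T.OutL s b a) :
    ∃ x y, A x y ∧ x ∈ T.path a b ∧ y ∈ T.path a b ∧ ¬ T.OutL s x y ∧ ¬ T.OutL s y x := by
  induction h with
  | base h => exact ⟨_, _, h, left_mem _ _, right_mem _ _, h1, h2⟩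
  | @concat a m c hac hm _ _ ih1 ih2 =>
    have hms := hs.btw_mem ha hb hm
    have hl := hs.line ha hb hm
    -- A left turn at `m` seen from one end is a right turn seen from the other, so exactly one
    -- factor inherits the hypothesis.
    by_cases hL : T.OutL s a m
    · obtain ⟨x, y, h3, h4, h5, h6⟩ := ih2 hms hb (by grind) (by grind)
      exact ⟨x, y, h3, path_subset_right hm.2.2 h4, path_subset_right hm.2.2 h5, h6⟩
    · obtain ⟨x, y, h3, h4, h5, h6⟩ := ih1 ha hms (by grind) (by grind)
      exact ⟨x, y, h3, path_subset_left hm.2.2 h4, path_subset_left hm.2.2 h5, h6⟩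

/-- The arcs other than boundary arcs compatible with `X`. -/
def facetOf (T : PlaneTree V) (X : V → V → Prop) : Set (Set V) :=
  {p | T.IsArc p ∧ T.Bent p ∧ T.Good X p}

/-- Sets of pairwise noncrossing arcs that are not boundary arcs. -/
def IsSimplex (T : PlaneTree V) (F : Set (Set V)) : Prop :=
  (∀ p ∈ F, T.IsArc p ∧ T.Bent p) ∧ ∀ p ∈ F, ∀ q ∈ F, ¬ T.Crosses p q

variable {X : V → V → Prop}

lemma mirror_facetOf : T.mirror.facetOf (fun a b => ¬ X a b) = T.facetOf X := by
  ext p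
  exact and_congr (mirror_isArc p) (and_congr mirror_bent mirror_good)

lemma mirror_isSimplex {F : Set (Set V)} : T.mirror.IsSimplex F ↔ T.IsSimplex F := by
  unfold IsSimplex
  simp only [mirror_isArc, mirror_bent, mirror_crosses]

lemma facetOf_isSimplex : T.IsSimplex (T.facetOf X) :=
  ⟨fun _ hp => ⟨hp.1, hp.2.1⟩, fun _ hp _ hq => hp.2.2.not_crosses hq.2.2⟩

/-- Let `p` be the arc with turns prescribed by `X` from `a` that follows `[a, b]` and turns right
at `a`. If it reaches `b`, it turns right there because `[a, b]` is not in `X`, and crosses `q`.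
Otherwise it leaves `q` at some `g`. If `q` turns left at `g`, then `p` crosses it along `[a, g]`;
if `q` turns right, then `[a, g]` is in `X`, hence `[g, b]` is not, and the shorter segment `[g, b]`
takes over. -/
lemma exists_crossing_of_LL [Finite V] (hX : T.Biclosed X) {q : Set V} (hq : T.IsArc q)
    {a b : V} (h : T.LL q a b) (hab : ¬ X a b) : ∃ p ∈ T.facetOf X, T.Crosses p q := by
  induction hk : (T.path a b).ncard using Nat.strong_induction_on generalizing a b with
  | _ k ih =>
  have hadj := adj_dir (T := T) h.ne
  obtain ⟨p, hp, hap, hep, hrp, hag⟩ := exists_arc h.inner_left hadj (X a)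
  have hgood := Agrees.good hX hp hap h.inner_left hag
  have hfin : ∀ x y, T.RR p x y → T.LL q x y → ∃ p ∈ T.facetOf X, T.Crosses p q := by
    intro x y h1 h2
    have hc : T.Crosses p q := ⟨x, y, Or.inr ⟨h1, h2⟩⟩
    exact ⟨p, ⟨hp, hc.bent, hgood⟩, hc⟩
  by_cases hb : b ∈ p
  · have h1 := hag b hb h.inner_right h.ne.symm
    have h2 := hp.outL_iff_not hap hb h.inner_right h.ne
    exact hfin a b ⟨h.ne, h.inner_left, h.inner_right, hap, hb, by grind, hrp⟩ h
  obtain ⟨g, hbt, hgp, hgq, -, h1, h2⟩ :=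
    hp.diverge hq.strip hap h.mem_left h.mem_right hb hep
  have hl := hq.strip.line h.mem_left h.mem_right hbt
  have hgi := hbt.inner
  by_cases hL : T.OutL q a g
  · refine hfin a g ⟨hbt.1.symm, h.inner_left, hgi, hap, hgp, h1.1 hL, ?_⟩
      ⟨hbt.1.symm, h.inner_left, hgi, h.mem_left, hgq, hL, hl.1.2 h.out_left⟩
    rw [OutR, hbt.dir_left]
    exact hrp
  · have h3 := (hag g hgp hgi hbt.1).2 (h2.1 (by grind))
    have h4 : ¬ X g b := fun h' => hab (hX.closed
      (hq.isSeg h.mem_left h.mem_right h.ne h.inner_left h.inner_right) hbt h3 h')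
    refine ih _ ?_ ⟨hbt.2.1, hgi, h.inner_right, hgq, h.mem_right, hl.2.2.1.2 h.out_right,
      by grind⟩ h4 rfl
    rw [← hk]
    refine Set.ncard_lt_ncard ⟨path_subset_right hbt.2.2, fun h' => ?_⟩ (path_finite _ _)
    exact hbt.1 (path_inter hbt.2.2 (left_mem _ _) (h' (left_mem _ _))).symm

lemma exists_crossing [Finite V] (hX : T.Biclosed X) {q : Set V} (hq : T.IsArc q)
    (h : ¬ T.Good X q) : ∃ p ∈ T.facetOf X, T.Crosses p q := by
  unfold Good at h
  rw [not_and_or] at h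
  push Not at h
  rcases h with ⟨a, b, h1, h2⟩ | ⟨a, b, h1, h2⟩
  · exact exists_crossing_of_LL hX hq h1 h2
  · obtain ⟨p, hp, hc⟩ := exists_crossing_of_LL hX.mirror ((mirror_isArc q).2 hq)
      (mirror_LL.2 h1) (not_not.2 h2)
    rw [mirror_facetOf] at hp
    exact ⟨p, hp, mirror_crosses.1 hc⟩

lemma facetOf_maximal [Finite V] (hX : T.Biclosed X) : Maximal T.IsSimplex (T.facetOf X) := by
  refine ⟨facetOf_isSimplex, fun N hN hle q hq => ⟨(hN.1 q hq).1, (hN.1 q hq).2, ?_⟩⟩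
  by_contra hcon
  obtain ⟨p, hp, hc⟩ := exists_crossing hX (hN.1 q hq).1 hcon
  exact hN.2 p (hle hp) q hq hc

/-- Let `X` be generated by the segments at both ends of which some arc of `N` turns left. If `q`
turned right at both ends of a generated segment, it would do so for one of the generators, and then
cross the arc that provides this generator. -/
lemma IsSimplex.exists_tors {N : Set (Set V)} (hN : T.IsSimplex N) :
    ∃ X, T.Biclosed X ∧ T.Tors X ∧ N ⊆ T.facetOf X := by
  let A : V → V → Prop := fun a b => ∃ p ∈ N, T.LL p a b
  have hsymm : ∀ a b, A a b → A b a := fun a b ⟨p, hp, h⟩ => ⟨p, hp, h.symm⟩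
  have hquot : ∀ a b c, A a c → T.Btw a b c → T.OutL (T.path a c) a b → A a b := by
    rintro a b c ⟨p, hp, h⟩ hb hL
    have hps := (hN.1 p hp).1.strip
    have hl := hps.line h.mem_left h.mem_right hb
    refine ⟨p, hp, hb.1.symm, h.inner_left, hb.inner, h.mem_left,
      hps.btw_mem h.mem_left h.mem_right hb, ?_, hl.1.2 h.out_left⟩
    rwa [← (hps.sub h.mem_left h.mem_right).outL_sub hps (left_mem _ _) (right_mem _ _)
      h.mem_left h.mem_right hb]
  refine ⟨T.Gen A, Gen.biclosed hsymm hquot, Gen.tors hquot, fun q hq =>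
    ⟨(hN.1 q hq).1, (hN.1 q hq).2, fun a b h => .base ⟨q, hq, h⟩, fun a b h hg => ?_⟩⟩
  have harc := (hN.1 q hq).1
  obtain ⟨x, y, ⟨p, hp, hA⟩, hx, hy, h1, h2⟩ := hg.exists_base harc.strip h.mem_left h.mem_right
    (fun h' => (harc.outL_iff_not h.mem_left h.mem_right h.inner_right h.ne).1 h' h.out_right)
    (fun h' => (harc.outL_iff_not h.mem_right h.mem_left h.inner_left h.ne.symm).1 h' h.out_left)
  have hsub := harc.strip.path_subset h.mem_left h.mem_right
  refine hN.2 p hp q hq ⟨x, y, Or.inl ⟨hA, hA.ne, hA.inner_left, hA.inner_right, hsub hx, hsub hy,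
    ?_, ?_⟩⟩
  · exact not_not.1 fun h' => h1 ((harc.outL_iff_not (hsub hx) (hsub hy) hA.inner_right hA.ne).2 h')
  · exact not_not.1 fun h' =>
      h2 ((harc.outL_iff_not (hsub hy) (hsub hx) hA.inner_left hA.ne.symm).2 h')

lemma exists_facetOf [Finite V] {F : Set (Set V)} (hF : Maximal T.IsSimplex F) :
    ∃ X, T.Biclosed X ∧ T.Tors X ∧ F = T.facetOf X := by
  obtain ⟨X, hX, hT, hle⟩ := hF.1.exists_tors
  exact ⟨X, hX, hT, hle.antisymm (hF.2 facetOf_isSimplex hle)⟩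

end Facets

/-! ### The two sides of an arc and its regions -/

section Sides

variable {T : PlaneTree V}

/-- The path from `x` to `y` is an arc. -/
structure ArcPath (T : PlaneTree V) (x y : V) : Prop where
  ne : x ≠ y
  left : T.IsLeaf x
  right : T.IsLeaf y
  consecutive : T.ConsecutiveEdges (T.path x y)

lemma isArc_iff {p : Set V} : T.IsArc p ↔ ∃ x y, T.ArcPath x y ∧ p = T.path x y := by
  constructor
  · rintro ⟨u, v, h1, h2, h3, rfl, h4⟩
    exact ⟨u, v, ⟨h1, h2, h3, h4⟩, rfl⟩
  · rintro ⟨u, v, h, rfl⟩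
    exact ⟨u, v, h.ne, h.left, h.right, rfl, h.consecutive⟩

namespace ArcPath

variable {x y : V}

lemma symm (h : T.ArcPath x y) : T.ArcPath y x :=
  ⟨h.ne.symm, h.right, h.left, path_comm x y ▸ h.consecutive⟩

lemma isArc (h : T.ArcPath x y) : T.IsArc (T.path x y) := isArc_iff.2 ⟨x, y, h, rfl⟩

lemma strip (h : T.ArcPath x y) : T.Strip (T.path x y) := h.isArc.strip

lemma btw (h : T.ArcPath x y) {w : V} (hw : w ∈ T.path x y) (hwi : T.IsInner w) :
    T.Btw x w y :=
  ⟨fun e => hwi (e ▸ h.left), fun e => hwi (e ▸ h.right), hw⟩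

lemma outL_iff (h : T.ArcPath x y) {w : V} (hw : T.Btw x w y) :
    T.OutL (T.path x y) x w ↔ T.rot w (T.dir w y) = T.dir w x :=
  h.strip.outL_iff (left_mem _ _) (right_mem _ _) hw

lemma outR_iff (h : T.ArcPath x y) {w : V} (hw : T.Btw x w y) :
    T.OutR (T.path x y) x w ↔ T.rot w (T.dir w x) = T.dir w y :=
  h.strip.outR_iff (left_mem _ _) (right_mem _ _) hw

lemma turn (h : T.ArcPath x y) {w : V} (hw : T.Btw x w y) :
    T.rot w (T.dir w x) = T.dir w y ∨ T.rot w (T.dir w y) = T.dir w x :=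
  h.strip.turn (left_mem _ _) (right_mem _ _) hw

lemma adj_mem (h : T.ArcPath x y) {w n : V} (hw : T.Btw x w y) (hn : T.graph.Adj w n)
    (hnp : n ∈ T.path x y) : n = T.dir w x ∨ n = T.dir w y :=
  h.strip.isPathSet.adj_mem (left_mem _ _) (right_mem _ _) hw.2.2 hw.1 hw.2.1 hnp hn

end ArcPath

open Classical in
/-- The face on the left of the dart `d` lies to the left of the arc from `x` to `y`. -/
def LeftSide (T : PlaneTree V) (x y : V) (d : T.graph.Dart) : Prop :=
  if d.fst ∈ T.path x y ∧ d.snd ∈ T.path x y then T.dir d.fst y = d.snd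
  else T.OutR (T.path x y) x (T.gate (T.path x y) d.fst)

lemma leftSide_of_mem {x y : V} {d : T.graph.Dart} (h1 : d.fst ∈ T.path x y)
    (h2 : d.snd ∈ T.path x y) : T.LeftSide x y d ↔ T.dir d.fst y = d.snd := by
  rw [LeftSide, if_pos ⟨h1, h2⟩]

lemma leftSide_of_not {x y : V} {d : T.graph.Dart}
    (h : ¬ (d.fst ∈ T.path x y ∧ d.snd ∈ T.path x y)) :
    T.LeftSide x y d ↔ T.OutR (T.path x y) x (T.gate (T.path x y) d.fst) := by
  rw [LeftSide, if_neg h]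

lemma leftSide_symm_of_not {x y : V} {d : T.graph.Dart}
    (h : ¬ (d.fst ∈ T.path x y ∧ d.snd ∈ T.path x y)) :
    T.LeftSide x y d.symm ↔ T.LeftSide x y d := by
  rw [leftSide_of_not h, leftSide_of_not (fun h' => h h'.symm),
    gate_eq_of_adj (isPathSet_path x y) d.adj h]
  rfl

/-- Away from the arc consecutive darts have the same gate. At a vertex of the arc, the turn of the
arc there tells on which side the remaining edges lie. -/
lemma leftSide_step {x y : V} (h : T.ArcPath x y) {d d' : T.graph.Dart} (hd : T.faceStep d d') :
    T.LeftSide x y d ↔ T.LeftSide x y d' := by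
  obtain ⟨⟨a, b⟩, hab⟩ := d
  obtain ⟨⟨b', c⟩, hbc⟩ := d'
  obtain ⟨hbi, h1, h2⟩ := hd
  change T.IsInner b at hbi
  change b' = b at h1
  change c = (T.rot b).symm a at h2
  subst h1
  change T.graph.Adj a b' at hab
  change T.graph.Adj b' c at hbc
  have hac : T.rot b' c = a := by rw [h2, Equiv.apply_symm_apply]
  have hps := isPathSet_path (T := T) x y
  by_cases hb : b' ∈ T.path x y
  · have hbt := h.btw hb hbi
    have hi := adj_dir (T := T) hbt.1
    have ho := adj_dir (T := T) hbt.2.1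
    have hio := hbt.dir_ne
    have hR := h.outR_iff hbt
    have ht := h.turn hbt
    have hinj := (T.rot b').injective
    have hca := rot_ne hbi hbc
    have hac' := rot_rot_ne hbi hbc
    by_cases ha : a ∈ T.path x y
    · rw [leftSide_of_mem (d := ⟨(a, b'), hab⟩) ha hb]
      rcases h.adj_mem hbt hab.symm ha with e | e
      · have k1 : T.dir a y = b' := dir_back hab.symm (Or.inr (by rw [e]; exact hio.symm))
        by_cases hc : c ∈ T.path x y
        · rw [leftSide_of_mem (d := ⟨(b', c), hbc⟩) hb hc]
          rcases h.adj_mem hbt hbc hc with e' | e'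
          · exact absurd (hac.trans (e.trans e'.symm)) hca
          · exact iff_of_true k1 e'.symm
        · rw [leftSide_of_not (d := ⟨(b', c), hbc⟩) (fun h' => hc h'.2)]
          change _ ↔ T.OutR (T.path x y) x (T.gate (T.path x y) b')
          rw [gate_of_mem hps hb, hR]
          refine iff_of_true k1 (ht.resolve_right fun h' => hc ?_)
          rw [hinj (hac.trans (e.trans h'.symm))]
          exact hps.dir_mem hb (right_mem _ _)
      · have k1 : ¬ T.dir a y = b' := by
          intro h'
          subst e
          have h3 := dir_mem (T := T) (u := T.dir b' y) (v := y)
          rw [h'] at h3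
          exact notMem_path_dir hbt.2.1 h3
        by_cases hc : c ∈ T.path x y
        · rw [leftSide_of_mem (d := ⟨(b', c), hbc⟩) hb hc]
          refine iff_of_false k1 fun h' => ?_
          change T.dir b' y = c at h'
          rw [← h', ← e] at hac
          exact rot_ne hbi hab.symm hac
        · rw [leftSide_of_not (d := ⟨(b', c), hbc⟩) (fun h' => hc h'.2)]
          change _ ↔ T.OutR (T.path x y) x (T.gate (T.path x y) b')
          rw [gate_of_mem hps hb, hR]
          refine iff_of_false k1 fun h' => hc ?_
          rw [hinj (hac.trans (e.trans h'.symm))]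
          exact hps.dir_mem hb (left_mem _ _)
    · rw [leftSide_of_not (d := ⟨(a, b'), hab⟩) (fun h' => ha h'.1)]
      change T.OutR (T.path x y) x (T.gate (T.path x y) a) ↔ _
      rw [gate_eq_of_adj hps hab (fun h' => ha h'.1), gate_of_mem hps hb]
      by_cases hc : c ∈ T.path x y
      · rw [leftSide_of_mem (d := ⟨(b', c), hbc⟩) hb hc, hR]
        change _ ↔ T.dir b' y = c
        have m1 := hps.dir_mem hb (left_mem x y)
        have m2 := hps.dir_mem hb (right_mem x y)
        have := h.adj_mem hbt hbc hc
        grind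
      · rw [leftSide_of_not (d := ⟨(b', c), hbc⟩) (fun h' => hc h'.2)]
        change _ ↔ T.OutR (T.path x y) x (T.gate (T.path x y) b')
        rw [gate_of_mem hps hb]
  · rw [leftSide_of_not (d := ⟨(a, b'), hab⟩) (fun h' => hb h'.2),
      leftSide_of_not (d := ⟨(b', c), hbc⟩) (fun h' => hb h'.1)]
    change T.OutR (T.path x y) x (T.gate (T.path x y) a) ↔
      T.OutR (T.path x y) x (T.gate (T.path x y) b')
    rw [gate_eq_of_adj hps hab (fun h' => hb h'.2)]

/-- The face lies to the left of the arc from `x` to `y`. -/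
def FaceLeft (T : PlaneTree V) {x y : V} (h : T.ArcPath x y) : T.Face → Prop :=
  Quot.lift (T.LeftSide x y) fun _ _ hd => propext (leftSide_step h hd)

lemma faceLeft_leftFace {x y : V} (h : T.ArcPath x y) (d : T.graph.Dart) :
    T.FaceLeft h (T.leftFace d) = T.LeftSide x y d := rfl

lemma faceLeft_of_reg {x y : V} (h : T.ArcPath x y) {F G : T.Face}
    (hG : G ∈ T.reg (T.path x y) F) : T.FaceLeft h F ↔ T.FaceLeft h G := by
  induction hG with
  | refl => rfl
  | tail _ hs ih =>
    obtain ⟨d, hd, rfl, rfl⟩ := hs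
    rw [ih, faceLeft_leftFace, faceLeft_leftFace, leftSide_symm_of_not hd]

lemma AdjacentOff.symm {p : Set V} {F G : T.Face} (h : T.AdjacentOff p F G) :
    T.AdjacentOff p G F := by
  obtain ⟨d, hd, h1, h2⟩ := h
  exact ⟨d.symm, fun h' => hd h'.symm, h2, by rw [h1]; rfl⟩

/-- The face on the left of the edge from `x` to `y`. -/
def lf {x y : V} (h : T.graph.Adj x y) : T.Face := T.leftFace ⟨(x, y), h⟩

lemma lf_step {a b : V} (hb : T.IsInner b) (h : T.graph.Adj a b) :
    lf h = lf (rot_symm_adj h.symm) :=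
  Quot.sound ⟨hb, rfl, rfl⟩

lemma reg_symm {p : Set V} {F G : T.Face} (h : G ∈ T.reg p F) : F ∈ T.reg p G := by
  induction h with
  | refl => exact Relation.ReflTransGen.refl
  | tail _ hs ih => exact Relation.ReflTransGen.head hs.symm ih

lemma reg_trans {p : Set V} {F G H : T.Face} (h1 : G ∈ T.reg p F) (h2 : H ∈ T.reg p G) :
    H ∈ T.reg p F := Relation.ReflTransGen.trans h1 h2

lemma reg_cross {p : Set V} {a b : V} (h : T.graph.Adj a b) (hp : ¬ (a ∈ p ∧ b ∈ p)) :
    lf h.symm ∈ T.reg p (lf h) :=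
  Relation.ReflTransGen.single ⟨⟨(a, b), h⟩, hp, rfl, rfl⟩

/-- Going around a vertex up to the first edge in `Q`. -/
lemma exists_rotate [Finite V] {p : Set V} {v n t : V} (hv : T.IsInner v) (hn : T.graph.Adj v n)
    (ht : T.graph.Adj v t) (Q : V → Prop) (hQt : Q t)
    (hoff : ∀ m, T.graph.Adj v m → ¬ Q m → ¬ (v ∈ p ∧ m ∈ p)) :
    ∃ (m : V) (hm : T.graph.Adj v m), Q m ∧ lf hm ∈ T.reg p (lf hn) ∧
      (m = n ∨ (¬ Q n ∧ ¬ Q (T.rot v m))) := by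
  classical
  -- Rotate clockwise from `n`; since the rotation is transitive on the neighbours, some first power
  -- meets `Q`.
  have hadj : ∀ k : ℕ, T.graph.Adj v (((T.rot v).symm : V → V)^[k] n) := by
    intro k
    induction k with
    | zero => exact hn
    | succ k ih => rw [Function.iterate_succ_apply']; exact rot_symm_adj ih
  have hex : ∃ k : ℕ, Q (((T.rot v).symm : V → V)^[k] n) := by
    obtain ⟨k, hk⟩ := (Equiv.Perm.sameCycle_inv.2 (T.rot_cycle v n t hn ht)).exists_nat_pow_eq
    refine ⟨k, ?_⟩
    rw [← Equiv.Perm.coe_pow]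
    change Q (((T.rot v)⁻¹ ^ k) n)
    rwa [hk]
  have hmin : ∀ j < Nat.find hex, ¬ Q (((T.rot v).symm : V → V)^[j] n) :=
    fun j hj => Nat.find_min hex hj
  refine ⟨_, hadj (Nat.find hex), Nat.find_spec hex, ?_, ?_⟩
  · have key : ∀ k ≤ Nat.find hex, lf (hadj k) ∈ T.reg p (lf hn) := by
      intro k
      induction k with
      | zero => exact fun _ => Relation.ReflTransGen.refl
      | succ k ih =>
        intro hk
        refine reg_trans (ih (by omega)) ?_
        have h1 := reg_cross (hadj k) (hoff _ (hadj k) (hmin k (by omega)))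
        rw [lf_step hv] at h1
        convert h1 using 2
        rw [Function.iterate_succ_apply']
    exact key _ le_rfl
  · rcases Nat.eq_zero_or_pos (Nat.find hex) with h0 | h0
    · left; rw [h0]; rfl
    · right
      refine ⟨hmin 0 h0, ?_⟩
      obtain ⟨k, hk⟩ := Nat.exists_eq_succ_of_ne_zero h0.ne'
      rw [hk, Function.iterate_succ_apply', Equiv.apply_symm_apply]
      exact hmin k (by omega)

/-- Every region of an arc contains a face along the arc. -/
lemma exists_reg_of_inner [Finite V] {x y : V} (h : T.ArcPath x y) {v n : V} (hv : T.IsInner v)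
    (hn : T.graph.Adj v n) : ∃ (a b : V) (hab : T.graph.Adj a b), a ∈ T.path x y ∧
      b ∈ T.path x y ∧ lf hab ∈ T.reg (T.path x y) (lf hn) := by
  have hps := isPathSet_path (T := T) x y
  induction hk : (T.path v (T.gate (T.path x y) v)).ncard using Nat.strong_induction_on
    generalizing v n with
  | _ k ih =>
  by_cases hvp : v ∈ T.path x y
  · have hvx := (h.btw hvp hv).1
    obtain ⟨m, hm, hmp, hr, -⟩ := exists_rotate (p := T.path x y) hv hn (adj_dir hvx)
      (· ∈ T.path x y) (hps.dir_mem hvp (left_mem _ _)) fun m _ h' h'' => h' h''.2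
    exact ⟨v, m, hm, hvp, hmp, hr⟩
  -- Off the arc all edges at `v` may be crossed: rotate to the edge pointing to the arc and cross
  -- it, which brings the vertex closer.
  · have hg := gate_mem hps v
    have hvg : v ≠ T.gate (T.path x y) v := fun e => hvp (e ▸ hg)
    have hadj := adj_dir (T := T) hvg
    obtain ⟨m, hm, hmd, hr, -⟩ := exists_rotate (p := T.path x y) hv hn hadj
      (· = T.dir v (T.gate (T.path x y) v)) rfl fun m _ _ h'' => hvp h''.1
    have hge := gate_eq_of_adj hps hm (fun h' => hvp h'.1)
    have hmi : T.IsInner m := by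
      by_cases hmp : m ∈ T.path x y
      · have : ∃ t ∈ T.path x y, m ≠ t := by
          by_cases hmx : m = x
          · exact ⟨y, right_mem _ _, fun e => h.ne (hmx.symm.trans e)⟩
          · exact ⟨x, left_mem _ _, hmx⟩
        obtain ⟨t, ht, hmt⟩ := this
        exact inner_of_adj_adj hm.symm (adj_dir hmt)
          fun e => hvp (e ▸ hps.dir_mem hmp ht)
      · have hmg : m ≠ T.gate (T.path x y) v := fun e => hmp (e ▸ hg)
        refine inner_of_adj_adj hm.symm (adj_dir hmg) fun e => ?_
        have h1 := dir_mem (T := T) (u := m) (v := T.gate (T.path x y) v)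
        rw [← e] at h1
        subst hmd
        exact notMem_path_dir hvg h1
    obtain ⟨a, b, hab, ha, hb, hr'⟩ := ih _ (by
      rw [← hk, ← hge]
      refine Set.ncard_lt_ncard ?_ (path_finite _ _)
      rw [path_eq_insert hvg, hmd]
      exact Set.ssubset_insert (notMem_path_dir hvg)) hmi hm.symm rfl
    exact ⟨a, b, hab, ha, hb,
      reg_trans hr (reg_trans (reg_cross hm fun h' => hvp h'.1) hr')⟩

/-- Only darts that start at a leaf remain; such an edge, if not on the arc, can be crossed to reach
a dart starting at an interior vertex. Two adjacent leaves off the arc are impossible, since they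
would be the whole tree. -/
lemma exists_reg [Finite V] {x y : V} (h : T.ArcPath x y) (F : T.Face) :
    ∃ (a b : V) (hab : T.graph.Adj a b), a ∈ T.path x y ∧
      b ∈ T.path x y ∧ lf hab ∈ T.reg (T.path x y) F := by
  have hps := isPathSet_path (T := T) x y
  induction F using Quot.ind with
  | mk d =>
  obtain ⟨⟨u, v⟩, huv⟩ := d
  change T.graph.Adj u v at huv
  change ∃ (a b : V) (hab : T.graph.Adj a b), a ∈ T.path x y ∧
      b ∈ T.path x y ∧ lf hab ∈ T.reg (T.path x y) (lf huv)
  by_cases hu : T.IsInner u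
  · exact exists_reg_of_inner h hu huv
  by_cases hp : u ∈ T.path x y ∧ v ∈ T.path x y
  · exact ⟨u, v, huv, hp.1, hp.2, Relation.ReflTransGen.refl⟩
  have hvi : T.IsInner v := by
    have hu' : T.IsLeaf u := not_not.1 hu
    have hup : u ∉ T.path x y := by
      intro hup
      refine hp ⟨hup, ?_⟩
      have : ∃ t ∈ T.path x y, u ≠ t := by
        by_cases hmx : u = x
        · exact ⟨y, right_mem _ _, fun e => h.ne (hmx.symm.trans e)⟩
        · exact ⟨x, left_mem _ _, hmx⟩
      obtain ⟨t, ht, hut⟩ := this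
      rw [eq_of_adj_leaf hu' huv (adj_dir hut)]
      exact hps.dir_mem hup ht
    by_contra hv
    have hv' : T.IsLeaf v := not_not.1 hv
    have hux : u ≠ x := fun e => hup (e ▸ left_mem _ _)
    have huy : u ≠ y := fun e => hup (e ▸ right_mem _ _)
    have h1 := eq_of_adj_leaf hu' huv (adj_dir hux)
    have h2 := eq_of_adj_leaf hu' huv (adj_dir huy)
    have h3 : ∀ z, u ≠ z → v = T.dir u z → v = z := by
      intro z hz hvz
      by_contra hne
      have h4 := eq_of_adj_leaf hv' huv.symm (adj_dir hne)
      have h5 := dir_mem (T := T) (u := v) (v := z)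
      rw [← h4, hvz] at h5
      exact notMem_path_dir hz h5
    exact h.ne ((h3 x hux h1).symm.trans (h3 y huy h2))
  obtain ⟨a, b, hab, ha, hb, hr⟩ := exists_reg_of_inner h hvi huv.symm
  exact ⟨a, b, hab, ha, hb, reg_trans (reg_cross huv hp) hr⟩

/-- All faces on the left along an arc belong to the same region. -/
lemma reg_forward [Finite V] {x y v : V} (h : T.ArcPath x y) (hv : v ∈ T.path x y)
    (hvy : v ≠ y) :
    lf (adj_dir hvy) ∈ T.reg (T.path x y) (lf (T := T) (adj_dir h.ne)) := by
  have hps := isPathSet_path (T := T) x y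
  induction hk : (T.path v x).ncard using Nat.strong_induction_on generalizing v with
  | _ k ih =>
  by_cases hvx : v = x
  · subst hvx; exact Relation.ReflTransGen.refl
  have hb : T.Btw x v y := ⟨hvx, hvy, hv⟩
  have hi := adj_dir (T := T) hvx
  have hip := hps.dir_mem hv (left_mem x y)
  have hback : T.dir (T.dir v x) y = v := dir_back hi (Or.inr hb.dir_ne.symm)
  have hiy : T.dir v x ≠ y := by
    intro e
    have := dir_of_adj (e ▸ hi)
    exact hb.dir_ne (e.trans this.symm)
  have h1 := ih _ (by
    rw [← hk, path_eq_insert hvx]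
    exact Set.ncard_lt_ncard (Set.ssubset_insert (notMem_path_dir hvx))
      ((path_finite _ _).insert _)) hip hiy rfl
  have h2 : lf (adj_dir (T := T) hiy) = lf hi.symm := by
    unfold lf
    congr 3
  rw [h2, lf_step hb.inner] at h1
  obtain ⟨m, hm, hmp, hr, hor⟩ := exists_rotate (p := T.path x y) hb.inner
    (rot_symm_adj (T := T) (v := v) (n := T.dir v x) hi) (adj_dir hvy) (· ∈ T.path x y)
    (hps.dir_mem hv (right_mem _ _)) fun m _ h' h'' => h' h''.2
  -- Rotation cannot stop at the incoming edge: the outgoing edge is its immediate neighbour on one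
  -- side or the other and would have been met first.
  have hmy : m = T.dir v y := by
    rcases h.adj_mem hb hm hmp with e | e
    · exfalso
      rcases hor with h' | ⟨h', h''⟩
      · exact rot_symm_ne hb.inner hi (h'.symm.trans e)
      · rcases h.turn hb with ht | ht
        · rw [e, ht] at h''
          exact h'' (hps.dir_mem hv (right_mem _ _))
        · rw [← ht, Equiv.symm_apply_apply] at h'
          exact h' (hps.dir_mem hv (right_mem _ _))
    · exact e
  subst hmy
  exact reg_trans h1 hr

lemma lf_eq {a b b' : V} (h : T.graph.Adj a b) (h' : T.graph.Adj a b') (e : b = b') :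
    lf h = lf h' := by subst e; rfl

/-- Every region of an arc contains all faces on one of its sides along the arc. -/
lemma exists_orientation [Finite V] {p : Set V} (hp : T.IsArc p) (F : T.Face) :
    ∃ x y, T.ArcPath x y ∧ p = T.path x y ∧
      ∀ v ∈ p, ∀ hvy : v ≠ y, lf (adj_dir hvy) ∈ T.reg p F := by
  have key : ∀ x y, T.ArcPath x y → p = T.path x y → ∀ a (hay : a ≠ y), a ∈ p →
      lf (adj_dir hay) ∈ T.reg p F → ∀ v ∈ p, ∀ hvy : v ≠ y, lf (adj_dir hvy) ∈ T.reg p F := by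
    rintro x y h rfl a hay ha hF v hv hvy
    exact reg_trans hF (reg_trans (reg_symm (reg_forward h ha hay)) (reg_forward h hv hvy))
  obtain ⟨x, y, h, rfl⟩ := isArc_iff.1 hp
  obtain ⟨a, b, hab, ha, hb, hr⟩ := exists_reg h F
  rcases adj_mem_path ha hb hab with ⟨hax, e⟩ | ⟨hay, e⟩
  · refine ⟨y, x, h.symm, path_comm _ _, key y x h.symm (path_comm _ _) a hax ha ?_⟩
    rwa [lf_eq (adj_dir hax) hab e.symm]
  · refine ⟨x, y, h, rfl, key x y h rfl a hay ha ?_⟩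
    rwa [lf_eq (adj_dir hay) hab e.symm]

end Sides

/-! ### Crossing of arcs in terms of turns -/

section Regions

variable {T : PlaneTree V}

/-- A region of `p` contains the faces all along one side of `p`, in particular those beside the
edges by which `p` leaves `q` at `a` and at `b`. Since `q` turns the same way at both ends of `[a,
b]`, these edges are on different sides of `q`. -/
lemma not_reg_subset [Finite V] {p q : Set V} (hp : T.IsArc p) (hq : T.IsArc q) {a b : V}
    (hab : a ≠ b) (hai : T.IsInner a) (hbi : T.IsInner b) (hap : a ∈ p) (hbp : b ∈ p)
    (haq : a ∈ q) (hbq : b ∈ q) (ha : ∀ x ∈ p, T.Btw x a b → T.dir a x ∉ q)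
    (hb : ∀ x ∈ p, T.Btw x b a → T.dir b x ∉ q) (hopp : T.OutL q a b ↔ T.OutL q b a)
    (F G : T.Face) : ¬ T.reg p F ⊆ T.reg q G := by
  intro hsub
  obtain ⟨x, y, h, rfl, hF⟩ := exists_orientation hp F
  obtain ⟨x', y', h', rfl⟩ := isArc_iff.1 hq
  have hps := isPathSet_path (T := T) x' y'
  have key : ∀ a b, T.IsInner a → T.IsInner b → a ∈ T.path x y → b ∈ T.path x y →
      a ∈ T.path x' y' → b ∈ T.path x' y' →
      (∀ z ∈ T.path x y, T.Btw z a b → T.dir a z ∉ T.path x' y') →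
      (∀ z ∈ T.path x y, T.Btw z b a → T.dir b z ∉ T.path x' y') →
      (T.OutL (T.path x' y') a b ↔ T.OutL (T.path x' y') b a) → ¬ T.Btw x a b := by
    intro a b hai hbi hap hbp haq hbq ha hb hopp hbt
    have hab := hbt.2.1
    have hay := h.btw hap hai
    have hby := h.btw hbp hbi
    have hbt' : T.Btw y b a := btw_iff.2 ⟨hby.2.1, hab.symm, by
      rw [hbt.dir_right]; exact hby.dir_ne.symm⟩
    have hu := adj_dir (T := T) hay.1
    have hup := h.strip.isPathSet.dir_mem hap (left_mem x y)
    have hback : T.dir (T.dir a x) y = a := dir_back hu (Or.inr hay.dir_ne.symm)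
    have huy : T.dir a x ≠ y := by
      intro e
      have := dir_of_adj (e ▸ hu)
      exact hay.dir_ne (e.trans this.symm)
    have h1 := faceLeft_of_reg h' (hsub (hF _ hup huy))
    have h2 := faceLeft_of_reg h' (hsub (hF _ hbp hby.2.1))
    have hun := ha x (left_mem _ _) hbt
    have hvn := hb y (right_mem _ _) hbt'
    rw [lf_eq (adj_dir huy) hu.symm hback] at h1
    have h3 := h1.symm.trans h2
    unfold lf at h3
    rw [faceLeft_leftFace, faceLeft_leftFace, leftSide_of_not (fun h => hun h.1),
      leftSide_of_not (fun h => hvn h.2)] at h3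
    change T.OutR (T.path x' y') x' (T.gate (T.path x' y') (T.dir a x)) ↔
      T.OutR (T.path x' y') x' (T.gate (T.path x' y') b) at h3
    rw [gate_of_mem hps hbq, ← gate_eq_of_adj hps hu (fun h => hun h.2), gate_of_mem hps haq] at h3
    have h4 := hq.opp_iff (left_mem x' y') h'.left haq hbq hai hbi hab
    have h5 := hq.outL_iff_not (left_mem x' y') haq hai (h'.btw haq hai).1.symm
    have h6 := hq.outL_iff_not (left_mem x' y') hbq hbi (h'.btw hbq hbi).1.symm
    grind
  have hay := h.btw hap hai
  have hby := h.btw hbp hbi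
  rcases h.strip.isPathSet.btw_trichotomy (left_mem x y) hap hbp hay.1.symm hby.1.symm hab with
    hc | hc | hc
  · exact key a b hai hbi hap hbp haq hbq ha hb hopp hc
  · exact hc.inner h.left
  · exact key b a hbi hai hbp hap hbq haq hb ha hopp.symm hc

lemma LL.exit {p q : Set V} {a b x : V} (hp : T.IsArc p) (h : T.LL p a b) (hq : ¬ T.OutL q b a)
    (hx : x ∈ p) (hb : T.Btw x a b) : T.dir a x ∉ q := by
  intro hd
  have h1 := (hp.strip.outL_iff h.mem_right hx hb.symm).1 h.out_left
  refine hq ?_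
  rwa [OutL, ← h1, Equiv.symm_apply_apply]

lemma RR.exit {p q : Set V} {a b x : V} (hp : T.IsArc p) (h : T.RR p a b) (hq : ¬ T.OutR q b a)
    (hx : x ∈ p) (hb : T.Btw x a b) : T.dir a x ∉ q := by
  intro hd
  have h1 := (hp.strip.outR_iff h.mem_right hx hb.symm).1 h.out_left
  refine hq ?_
  rwa [OutR, h1]

lemma LL.not_outR {p : Set V} {a b : V} (hp : T.IsArc p) (h : T.LL p a b) : ¬ T.OutR p a b :=
  (hp.outL_iff_not h.mem_left h.mem_right h.inner_right h.ne).1 h.out_right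

lemma RR.not_outL {p : Set V} {a b : V} (hp : T.IsArc p) (h : T.RR p a b) : ¬ T.OutL p a b :=
  fun h' => (hp.outL_iff_not h.mem_left h.mem_right h.inner_right h.ne).1 h' h.out_right

lemma Crosses.not_reg_subset [Finite V] {p q : Set V} (hp : T.IsArc p) (hq : T.IsArc q)
    (h : T.Crosses p q) (F G : T.Face) : ¬ T.reg p F ⊆ T.reg q G := by
  obtain ⟨a, b, ⟨h1, h2⟩ | ⟨h1, h2⟩⟩ := h
  · exact PlaneTree.not_reg_subset hp hq h1.ne h1.inner_left h1.inner_right h1.mem_left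
      h1.mem_right h2.mem_left h2.mem_right (fun x hx => h1.exit hp (h2.symm.not_outL hq) hx)
      (fun x hx => h1.symm.exit hp (h2.not_outL hq) hx)
      (iff_of_false (h2.not_outL hq) (h2.symm.not_outL hq)) F G
  · exact PlaneTree.not_reg_subset hp hq h1.ne h1.inner_left h1.inner_right h1.mem_left
      h1.mem_right h2.mem_left h2.mem_right (fun x hx => h1.exit hp (h2.symm.not_outR hq) hx)
      (fun x hx => h1.symm.exit hp (h2.not_outR hq) hx)
      (iff_of_true h2.out_right h2.out_left) F G

/-- If all edges of `p` off the arc `q` lie on the side of `q` opposite to `F`, then the region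
of `q` is contained in that of `p`. -/
lemma reg_subset {p : Set V} {x y : V} (h : T.ArcPath x y) {F : T.Face}
    (hF : ∀ d : T.graph.Dart, d.fst ∈ p → d.snd ∈ p →
      ¬ (d.fst ∈ T.path x y ∧ d.snd ∈ T.path x y) → ¬ (T.LeftSide x y d ↔ T.FaceLeft h F)) :
    T.reg (T.path x y) F ⊆ T.reg p F := by
  intro G hG
  induction hG with
  | refl => exact Relation.ReflTransGen.refl
  | tail h1 hs ih =>
    refine Relation.ReflTransGen.tail ih ?_
    have h2 := faceLeft_of_reg h h1
    obtain ⟨d, hd, rfl, rfl⟩ := hs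
    exact ⟨d, fun h' => hF d h'.1 h'.2 hd h2.symm, rfl, rfl⟩

lemma leftSide_off {p : Set V} {x y : V} {d : T.graph.Dart} (hp1 : d.fst ∈ p)
    (hp2 : d.snd ∈ p) (hd : ¬ (d.fst ∈ T.path x y ∧ d.snd ∈ T.path x y)) :
    ∃ t ∈ p, t ∉ T.path x y ∧
      (T.LeftSide x y d ↔ T.OutR (T.path x y) x (T.gate (T.path x y) t)) := by
  rw [leftSide_of_not hd]
  by_cases h1 : d.fst ∈ T.path x y
  · refine ⟨d.snd, hp2, fun h2 => hd ⟨h1, h2⟩, ?_⟩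
    rw [gate_eq_of_adj (isPathSet_path x y) d.adj hd]
  · exact ⟨d.fst, hp1, h1, Iff.rfl⟩

/-- If `p` left `q` on both sides of `q`, then `p` and `q` would turn oppositely at both ends of the
common part between the two gates. So for arcs without such a part, all of `p` off `q` is on one
side, and the region of `q` on the other side, containing a face beside a common edge, lies in a
region of `p`. -/
lemma arcsCross_iff [Finite V] {p q : Set V} (hp : T.IsArc p) (hq : T.IsArc q) :
    T.ArcsCross p q ↔ T.Crosses p q := by
  constructor
  · rintro ⟨s, hs, hsp, hsq, hFG⟩
    by_contra hnc
    obtain ⟨a, b, hab, rfl⟩ := isSegment_iff.1 hs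
    have hap := hsp (left_mem a b)
    have haq := hsq (left_mem a b)
    have hdq := hsq (dir_mem (u := a) (v := b))
    have hadj := adj_dir (T := T) hab.ne
    obtain ⟨x, y, h, rfl, hdy⟩ : ∃ x y, T.ArcPath x y ∧ q = T.path x y ∧
        T.dir a b = T.dir a y := by
      obtain ⟨x, y, h, rfl⟩ := isArc_iff.1 hq
      rcases adj_mem_path haq hdq hadj with ⟨-, e⟩ | ⟨-, e⟩
      · exact ⟨y, x, h.symm, path_comm _ _, e⟩
      · exact ⟨x, y, h, rfl, e⟩
    have hps := isPathSet_path (T := T) x y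
    have key : ∀ t ∈ p, t ∉ T.path x y → ∀ t' ∈ p, t' ∉ T.path x y →
        (T.OutR (T.path x y) x (T.gate (T.path x y) t) ↔
          T.OutR (T.path x y) x (T.gate (T.path x y) t')) := by
      intro t ht htq t' ht' htq'
      by_contra hne
      have hgg : T.gate (T.path x y) t ≠ T.gate (T.path x y) t' := by
        intro e; rw [e] at hne; exact hne Iff.rfl
      have hg := gate_mem hps t
      have hg' := gate_mem hps t'
      have hgp := hp.strip.path_subset ht hap (gate_mem_path hps t haq)
      have hgp' := hp.strip.path_subset ht' hap (gate_mem_path hps t' haq)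
      have hd : T.dir (T.gate (T.path x y) t') t ∈ T.path x y := by
        rw [← dir_eq_of_mem (path_comm _ _ ▸ gate_mem_path hps t hg') hgg]
        exact hps.dir_mem hg' hg
      have hd' : T.dir (T.gate (T.path x y) t) t' ∈ T.path x y := by
        rw [← dir_eq_of_mem (path_comm _ _ ▸ gate_mem_path hps t' hg) hgg.symm]
        exact hps.dir_mem hg hg'
      obtain ⟨b1, -, -, -, k1, k2⟩ := hq.diverge_gate hp.strip hg' hgp' ht htq hd
      obtain ⟨b1', -, -, -, k1', k2'⟩ := hq.diverge_gate hp.strip hg hgp ht' htq' hd'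
      generalize T.gate (T.path x y) t = g at *
      generalize T.gate (T.path x y) t' = g' at *
      have h4 := hq.opp_iff (left_mem x y) h.left hg hg' b1.inner b1'.inner hgg
      have h5 := hq.outL_iff_not (left_mem x y) hg b1.inner (h.btw hg b1.inner).1.symm
      have h6 := hq.outL_iff_not (left_mem x y) hg' b1'.inner (h.btw hg' b1'.inner).1.symm
      have h7 := hq.outL_iff_not hg' hg b1.inner hgg.symm
      have h8 := hq.outL_iff_not hg hg' b1'.inner hgg
      apply hnc
      by_cases hL : T.OutL (T.path x y) g g'
      · have hL' : T.OutL (T.path x y) g' g := by grind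
        exact ⟨g, g', Or.inr ⟨⟨hgg, b1.inner, b1'.inner, hgp, hgp', k2'.2 hL, k2.2 hL'⟩,
          ⟨hgg, b1.inner, b1'.inner, hg, hg', hL, hL'⟩⟩⟩
      · have hL' : T.OutR (T.path x y) g' g := by grind
        have hL : T.OutR (T.path x y) g g' := by grind
        exact ⟨g, g', Or.inl ⟨⟨hgg, b1.inner, b1'.inner, hgp, hgp', k1'.2 hL, k1.2 hL'⟩,
          ⟨hgg, b1.inner, b1'.inner, hg, hg', hL, hL'⟩⟩⟩
    have hleft : T.FaceLeft h (lf hadj) :=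
      (leftSide_of_mem (d := ⟨(a, T.dir a b), hadj⟩) haq hdq).2 hdy.symm
    have hright : ¬ T.FaceLeft h (lf hadj.symm) := by
      intro h'
      have h1 := (leftSide_of_mem (d := ⟨(T.dir a b, a), hadj.symm⟩) hdq haq).1 h'
      change T.dir (T.dir a b) y = a at h1
      have hay : a ≠ y := fun e => hab.left (e ▸ h.right)
      have h2 := dir_mem (T := T) (u := T.dir a b) (v := y)
      rw [h1, hdy] at h2
      exact notMem_path_dir hay h2
    by_cases hex : ∃ t ∈ p, t ∉ T.path x y ∧ T.OutR (T.path x y) x (T.gate (T.path x y) t)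
    · obtain ⟨t, ht, htq, hR⟩ := hex
      refine (hFG (lf hadj.symm) (lf hadj.symm)).2 (reg_subset h fun d h1 h2 h3 => ?_)
      obtain ⟨t', ht', htq', hiff⟩ := leftSide_off h1 h2 h3
      have := key t ht htq t' ht' htq'
      grind
    · refine (hFG (lf hadj) (lf hadj)).2 (reg_subset h fun d h1 h2 h3 => ?_)
      obtain ⟨t', ht', htq', hiff⟩ := leftSide_off h1 h2 h3
      push Not at hex
      have := hex t' ht' htq'
      grind
  · intro h
    obtain ⟨a, b, hab⟩ := id h
    have hmem : a ≠ b ∧ T.IsInner a ∧ T.IsInner b ∧ a ∈ p ∧ b ∈ p ∧ a ∈ q ∧ b ∈ q := by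
      rcases hab with ⟨h1, h2⟩ | ⟨h1, h2⟩
      · exact ⟨h1.1, h1.2, h1.3, h1.4, h1.5, h2.4, h2.5⟩
      · exact ⟨h1.1, h1.2, h1.3, h1.4, h1.5, h2.4, h2.5⟩
    obtain ⟨hne, hai, hbi, hap, hbp, haq, hbq⟩ := hmem
    exact ⟨T.path a b, isSegment_iff.2 ⟨a, b, hp.isSeg hap hbp hne hai hbi, rfl⟩,
      hp.strip.path_subset hap hbp, hq.strip.path_subset haq hbq,
      fun F G => ⟨h.not_reg_subset hp hq F G, h.symm.not_reg_subset hq hp G F⟩⟩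

end Regions

/-! ### Boundary arcs are the arcs that are not bent -/

section Boundary

variable {T : PlaneTree V}

lemma dir_leaf {x y z : V} (hx : T.IsLeaf x) (hy : x ≠ y) (hz : x ≠ z) : T.dir x y = T.dir x z :=
  eq_of_adj_leaf hx (adj_dir hy) (adj_dir hz)

/-- An arc with both ends on the face on its left at the beginning always turns left. -/
lemma outL_of_face [Finite V] {x y : V} (h : T.ArcPath x y)
    (hF : T.FaceContains (lf (T := T) (adj_dir h.ne)) y) {w : V} (hw : w ∈ T.path x y)
    (hwi : T.IsInner w) : T.OutL (T.path x y) x w := by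
  -- Compare with the arc from `x` that turns left throughout. If it missed `y`, then `y` would hang
  -- off it at a left turn, hence on its right, while the given face is on its left.
  obtain ⟨z, hzl, hzx, hzd, hturn⟩ := exists_ray (adj_dir (T := T) h.ne) fun _ => True
  have hz : T.ArcPath x z := by
    refine ⟨hzx.symm, h.left, hzl, fun a b c ha hb hc hba hbc hac => ?_⟩
    have hbi := inner_of_adj_adj hba hbc hac
    have hbt : T.Btw x b z := ⟨fun e => hbi (e ▸ h.left), fun e => hbi (e ▸ hzl), hb⟩
    have h1 := (isPathSet_path x z).adj_mem (left_mem _ _) (right_mem _ _) hb hbt.1 hbt.2.1 ha hba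
    have h2 := (isPathSet_path x z).adj_mem (left_mem _ _) (right_mem _ _) hb hbt.1 hbt.2.1 hc hbc
    have h3 := (hturn b hbt).1 trivial
    grind
  have hL : ∀ w, T.Btw x w z → T.OutL (T.path x z) x w := fun w hw =>
    (hz.outL_iff hw).2 ((hturn w hw).1 trivial)
  by_cases hyz : y = z
  · subst hyz
    exact hL w (h.btw hw hwi)
  exfalso
  have hyq : y ∉ T.path x z := by
    intro hy
    rcases btw_or_eq_of_mem hy with e | e | hb
    · exact h.ne e.symm
    · exact hyz e
    · exact hb.inner h.right
  have hps := isPathSet_path (T := T) x z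
  obtain ⟨hb, hgq, -, -, -⟩ := hz.isArc.diverge_gate h.strip (left_mem _ _) (left_mem _ _)
    (right_mem _ _) hyq (by rw [← hzd]; exact dir_mem)
  have hgL := hL _ (hz.btw hgq hb.inner)
  have hg := (hz.isArc.outL_iff_not (left_mem _ _) hgq hb.inner hb.1.symm).1 hgL
  have hleft : ∀ {x' y' : V} (h' : T.ArcPath x' y'), x' = x →
      T.FaceLeft h' (lf (T := T) (adj_dir h.ne)) := by
    rintro x' y' h' rfl
    refine (leftSide_of_mem (d := ⟨(x', T.dir x' y), adj_dir h.ne⟩) (left_mem _ _) ?_).2 ?_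
    · change T.dir x' y ∈ T.path x' y'
      rw [dir_leaf h.left h.ne h'.ne]
      exact dir_mem
    · exact dir_leaf h.left h'.ne h.ne
  obtain ⟨d, hd, hor⟩ := hF
  have h1 : T.LeftSide x z d := by
    rw [← faceLeft_leftFace hz, hd]
    exact hleft hz rfl
  have h2 : T.LeftSide x y d := by
    rw [← faceLeft_leftFace h, hd]
    exact hleft h rfl
  have hoff : ¬ (d.fst ∈ T.path x z ∧ d.snd ∈ T.path x z) := by
    rintro ⟨k1, k2⟩
    rcases hor with e | e
    · exact hyq (e ▸ k1)
    · exact hyq (e ▸ k2)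
  rw [leftSide_of_not hoff] at h1
  rcases hor with e | e
  · rw [e] at h1
    exact hg h1
  · rw [gate_eq_of_adj hps d.adj hoff, e] at h1
    exact hg h1

/-- Not being bent means, by `IsArc.opp_iff`, that all turns seen from one end of the arc have the
same direction; then the face at the inner side of the first edge continues along the whole arc. -/
lemma isBoundaryArc_iff [Finite V] {p : Set V} :
    T.IsBoundaryArc p ↔ T.IsArc p ∧ ¬ T.Bent p := by
  constructor
  · rintro ⟨hp, F, hF⟩
    refine ⟨hp, ?_⟩
    have key : ∀ x y (h : T.ArcPath x y), p = T.path x y →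
        F = lf (T := T) (adj_dir h.ne) → ¬ T.Bent p := by
      rintro x y h rfl rfl ⟨a, b, hab⟩
      have hopp : ∀ a b, a ≠ b → T.IsInner a → T.IsInner b → a ∈ T.path x y → b ∈ T.path x y →
          ¬ (T.OutL (T.path x y) a b ↔ T.OutL (T.path x y) b a) := by
        intro a b hab hai hbi ha hb
        rw [hp.opp_iff (left_mem _ _) h.left ha hb hai hbi hab, not_not]
        have := hF y (right_mem _ _)
        exact iff_of_true (outL_of_face h this ha hai) (outL_of_face h this hb hbi)
      rcases hab with hab | hab
      · exact hopp a b hab.1 hab.2 hab.3 hab.4 hab.5 (iff_of_true hab.6 hab.7)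
      · exact hopp a b hab.1 hab.2 hab.3 hab.4 hab.5
          (iff_of_false (hab.not_outL hp) (hab.symm.not_outL hp))
    obtain ⟨x, y, h, rfl⟩ := isArc_iff.1 hp
    have hsnd : ∀ {x y : V} (h : T.ArcPath x y) (d : T.graph.Dart), d.fst = x ∨ d.snd = x →
        d.fst ∈ T.path x y ∧ d.snd ∈ T.path x y := by
      rintro x y h ⟨⟨u, v⟩, huv⟩ (rfl | rfl)
      · refine ⟨left_mem _ _, ?_⟩
        rw [eq_of_adj_leaf h.left huv (adj_dir h.ne)]
        exact dir_mem
      · refine ⟨?_, left_mem _ _⟩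
        rw [eq_of_adj_leaf h.left huv.symm (adj_dir h.ne)]
        exact dir_mem
    obtain ⟨d, hd, hor⟩ := hF x (left_mem _ _)
    obtain ⟨d', hd', hor'⟩ := hF y (right_mem _ _)
    have hmem := hsnd h d hor
    have hmem' := hsnd h.symm d' hor'
    rw [path_comm] at hmem'
    by_cases hL : T.FaceLeft h F
    · refine key x y h rfl ?_
      rw [← hd] at hL ⊢
      have h1 := (leftSide_of_mem hmem.1 hmem.2).1 hL
      obtain ⟨⟨u, v⟩, huv⟩ := d
      rcases hor with rfl | rfl
      · exact lf_eq _ _ h1.symm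
      · exfalso
        change T.dir u y = v at h1
        have h2 := eq_of_adj_leaf h.left huv.symm (adj_dir h.ne)
        change u = T.dir v y at h2
        have h3 := dir_mem (T := T) (u := u) (v := y)
        rw [h1, h2] at h3
        exact notMem_path_dir h.ne h3
    · refine key y x h.symm (path_comm _ _) ?_
      rw [← hd'] at hL ⊢
      have h1 := fun h' => hL ((leftSide_of_mem hmem'.1 hmem'.2).2 h')
      obtain ⟨⟨u, v⟩, huv⟩ := d'
      rcases hor' with rfl | rfl
      · exact lf_eq _ _ (eq_of_adj_leaf h.right huv (adj_dir h.ne.symm))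
      · exfalso
        exact h1 (dir_of_adj huv)
  · rintro ⟨hp, hbent⟩
    refine ⟨hp, ?_⟩
    have key : ∀ x y, T.ArcPath x y → p = T.path x y →
        (∀ w ∈ p, T.IsInner w → T.OutL p x w) → ∃ F : T.Face, ∀ v ∈ p, T.FaceContains F v := by
      rintro x y h rfl hL
      have hface : ∀ v ∈ T.path x y, ∀ hv : v ≠ y,
          lf (adj_dir hv) = lf (T := T) (adj_dir h.ne) := by
        intro v hvp hv
        induction hk : (T.path v x).ncard using Nat.strong_induction_on generalizing v with
        | _ k ih =>
        by_cases hvx : v = x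
        · subst hvx; rfl
        have hb : T.Btw x v y := ⟨hvx, hv, hvp⟩
        have hi := adj_dir (T := T) hvx
        have hback : T.dir (T.dir v x) y = v := dir_back hi (Or.inr hb.dir_ne.symm)
        have hiy : T.dir v x ≠ y := by
          intro e
          have := dir_of_adj (e ▸ hi)
          exact hb.dir_ne (e.trans this.symm)
        rw [← ih _ (by
          rw [← hk, path_eq_insert hvx]
          exact Set.ncard_lt_ncard (Set.ssubset_insert (notMem_path_dir hvx))
            ((path_finite _ _).insert _)) _ ((isPathSet_path x y).dir_mem hvp (left_mem _ _))
            hiy rfl, lf_eq (adj_dir hiy) hi.symm hback, lf_step hb.inner]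
        refine lf_eq _ _ ?_
        rw [← (h.outL_iff hb).1 (hL v hvp hb.inner), Equiv.symm_apply_apply]
      refine ⟨lf (T := T) (adj_dir h.ne), fun v hv => ?_⟩
      by_cases hvy : v = y
      · subst hvy
        have hadj := adj_dir (T := T) h.ne.symm
        have hne : T.dir v x ≠ v := hadj.ne'
        refine ⟨⟨(T.dir v x, v), hadj.symm⟩, ?_, Or.inr rfl⟩
        rw [← hface _ ((isPathSet_path x v).dir_mem (right_mem _ _) (left_mem _ _)) hne]
        exact lf_eq _ _ (dir_of_adj hadj.symm).symm
      · exact ⟨⟨(v, T.dir v y), adj_dir hvy⟩, hface v hv hvy, Or.inl rfl⟩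
    obtain ⟨x, y, h, rfl⟩ := isArc_iff.1 hp
    by_cases hall : ∀ w ∈ T.path x y, T.IsInner w → T.OutL (T.path x y) x w
    · exact key x y h rfl hall
    · push Not at hall
      obtain ⟨w, hw, hwi, hL⟩ := hall
      refine key y x h.symm (path_comm _ _) fun w' hw' hwi' => ?_
      have hl := hp.strip.line (left_mem _ _) (right_mem _ _) (h.btw hw' hwi')
      by_contra hcon
      have hL' : T.OutL (T.path x y) x w' := by grind
      have hne : w ≠ w' := by rintro rfl; exact hL hL'
      have hopp := (hp.opp_iff (left_mem _ _) h.left hw hw' hwi hwi' hne).2 (by grind)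
      apply hbent
      by_cases hc : T.OutL (T.path x y) w w'
      · exact ⟨w, w', Or.inl ⟨hne, hwi, hwi', hw, hw', hc, hopp.1 hc⟩⟩
      · have k1 := hp.outL_iff_not hw hw' hwi' hne
        have k2 := hp.outL_iff_not hw' hw hwi hne.symm
        exact ⟨w, w', Or.inr ⟨hne, hwi, hwi', hw, hw', by grind, by grind⟩⟩

end Boundary

/-! ### Marked corners in terms of the biclosed set -/

section Marks

variable {T : PlaneTree V} {X : V → V → Prop}

lemma isReducedSimplex_iff [Finite V] {F : Set (Set V)} :
    T.IsReducedSimplex F ↔ T.IsSimplex F := by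
  have h1 : ∀ p, (T.IsArc p ∧ ¬ T.IsBoundaryArc p) ↔ (T.IsArc p ∧ T.Bent p) := by
    intro p
    rw [isBoundaryArc_iff]
    grind
  unfold IsReducedSimplex IsSimplex
  simp only [h1]
  refine and_congr_right fun h => forall₄_congr fun p hp q hq => ?_
  rw [arcsCross_iff (h p hp).1 (h q hq).1]

lemma isFacet_iff [Finite V] {F : Set (Set V)} : T.IsFacet F ↔ Maximal T.IsSimplex F := by
  unfold IsFacet
  rw [show T.IsReducedSimplex = T.IsSimplex from funext fun F => propext isReducedSimplex_iff]

lemma mirror_isFacet [Finite V] {F : Set (Set V)} : T.mirror.IsFacet F ↔ T.IsFacet F := by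
  rw [isFacet_iff, isFacet_iff,
    show T.mirror.IsSimplex = T.IsSimplex from funext fun F => propext mirror_isSimplex]

lemma mem_withBoundary [Finite V] {p : Set V} :
    p ∈ T.withBoundary (T.facetOf X) ↔ T.IsArc p ∧ T.Good X p := by
  unfold withBoundary facetOf
  simp only [Set.mem_union, Set.mem_ofPred_eq, isBoundaryArc_iff]
  have := good_of_not_bent (T := T) (p := p) (X := X)
  grind

/-- An arc with turns prescribed by `X` leaves any other compatible arc through the same corner
on the same side. -/
lemma Agrees.not_leftSide {p : Set V} {x y v n : V} (hp : T.IsArc p)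
    (h : T.ArcPath x y) (hg : T.Good X (T.path x y)) (hvi : T.IsInner v) (hn : T.graph.Adj v n)
    (hvp : v ∈ p) (hnp : n ∈ p) (hrp : T.rot v n ∈ p) (hvq : v ∈ T.path x y)
    (hny : n = T.dir v y) (hrx : T.rot v n = T.dir v x) (hag : T.Agrees X p v)
    {d : T.graph.Dart} (h1 : d.fst ∈ p) (h2 : d.snd ∈ p)
    (h3 : ¬ (d.fst ∈ T.path x y ∧ d.snd ∈ T.path x y)) : ¬ T.LeftSide x y d := by
  obtain ⟨t, ht, htq, hiff⟩ := leftSide_off h1 h2 h3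
  rw [hiff]
  have hps := isPathSet_path (T := T) x y
  have hvt : v ≠ t := fun e => htq (e ▸ hvq)
  have hnq : n ∈ T.path x y := by rw [hny]; exact hps.dir_mem hvq (right_mem _ _)
  have hrq : T.rot v n ∈ T.path x y := by rw [hrx]; exact hps.dir_mem hvq (left_mem _ _)
  have hdq : T.dir v t ∈ T.path x y := by
    obtain ⟨x', y', h', rfl⟩ := isArc_iff.1 hp
    have hb := h'.btw hvp hvi
    have k1 := h'.adj_mem hb (adj_dir hvt) (h'.strip.isPathSet.dir_mem hvp ht)
    have k2 := h'.adj_mem hb hn hnp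
    have k3 := h'.adj_mem hb (rot_adj hn) hrp
    have k4 := rot_ne hvi hn
    grind
  obtain ⟨hb, hgq, hgp, -, k1, k2⟩ := h.isArc.diverge_gate hp.strip hvq hvp ht htq hdq
  generalize T.gate (T.path x y) t = g at *
  have hgi := hb.inner
  have e1 := hag g hgp hgi hb.1
  have e2 := h.isArc.outL_iff_not hvq hgq hgi hb.1.symm
  have e3 := hp.outL_iff_not hvp hgp hgi hb.1.symm
  have hvb := h.btw hvq hvi
  have hgb := h.btw hgq hgi
  intro hR
  rcases h.strip.isPathSet.btw_trichotomy (left_mem x y) hvq hgq hvb.1.symm hgb.1.symm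
    hb.1.symm with hc | hc | hc
  · -- `g` is beyond `v`
    have hl := h.strip.line (left_mem _ _) hgq hc
    have hvR : T.OutR (T.path x y) g v := by
      have hd : T.dir v g = n := by
        have := h.adj_mem hvb (adj_dir hb.1.symm) (hps.dir_mem hvq hgq)
        rw [hny]
        exact this.resolve_left fun e => hc.dir_ne e.symm
      rw [OutR, hd]
      exact hrq
    exact (hg.2 v g ⟨hb.1.symm, hvi, hgi, hvq, hgq, hl.2.2.2.1.2 hR, hvR⟩) (e1.2 (k1.2
      (hl.2.2.2.1.2 hR)))
  · exact hc.inner h.left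
  · have hl := h.strip.line (left_mem _ _) hvq hc
    have hvL : T.OutL (T.path x y) g v := by
      have hd : T.dir v g = T.rot v n := by
        rw [hrx]; exact hc.dir_right
      rw [OutL, hd, Equiv.symm_apply_apply]
      exact hnq
    have hL : T.OutL (T.path x y) v g := by grind
    have := hg.1 v g ⟨hb.1.symm, hvi, hgi, hvq, hgq, hL, hvL⟩
    grind

lemma exists_arcPath_corner {q : Set V} {v n : V} (hq : T.IsArc q) (hvi : T.IsInner v)
    (hn : T.graph.Adj v n) (hvq : v ∈ q) (hnq : n ∈ q) (hrq : T.rot v n ∈ q) :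
    ∃ x y, T.ArcPath x y ∧ q = T.path x y ∧ n = T.dir v y ∧ T.rot v n = T.dir v x := by
  obtain ⟨x, y, h, rfl⟩ := isArc_iff.1 hq
  have hb := h.btw hvq hvi
  have k2 := h.adj_mem hb hn hnq
  have k3 := h.adj_mem hb (rot_adj hn) hrq
  have k4 := rot_ne hvi hn
  rcases k2 with e | e
  · exact ⟨y, x, h.symm, path_comm _ _, e, k3.resolve_left fun e' => k4 (e'.trans e.symm)⟩
  · exact ⟨x, y, h, rfl, e, k3.resolve_right fun e' => k4 (e'.trans e.symm)⟩

/-- The arc through the corner whose turns are prescribed by `X` leaves every other compatible arc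
there only on the side away from the corner, so its region is the largest. Any other arc with that
property has a region containing all faces along one side of the prescribed arc, which forces the
two to coincide. -/
lemma isMarked_iff [Finite V] (hX : T.Biclosed X) {p : Set V} {c : T.Corner} :
    T.IsMarked (T.facetOf X) p c ↔
      T.IsArc p ∧ T.ContainsCorner p c ∧ T.Agrees X p c.vertex := by
  obtain ⟨v, n, hvi, hn⟩ := c
  constructor
  · rintro ⟨hpm, hc, hmax⟩
    obtain ⟨hp, hg⟩ := mem_withBoundary.1 hpm
    obtain ⟨hvp, hnp, hrp⟩ := id hc
    refine ⟨hp, hc, ?_⟩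
    obtain ⟨q, hq, hvq, hnq, hrq, hag⟩ := exists_arc hvi hn (X v)
    have hqg := Agrees.good hX hq hvq hvi hag
    have hsub := hmax q (mem_withBoundary.2 ⟨hq, hqg⟩) ⟨hvq, hnq, hrq⟩
    change T.reg q (lf hn) ⊆ T.reg p (lf hn) at hsub
    obtain ⟨x, y, h, rfl, hny, hrx⟩ := exists_arcPath_corner hp hvi hn hvp hnp hrp
    suffices hqp : q ⊆ T.path x y by
      have : q = T.path x y := by
        obtain ⟨x', y', h', rfl⟩ := isArc_iff.1 hq
        have k : ∀ z, T.IsLeaf z → z ∈ T.path x y → z = x ∨ z = y := by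
          intro z hz hzp
          rcases btw_or_eq_of_mem hzp with e | e | e
          · exact Or.inl e
          · exact Or.inr e
          · exact absurd hz e.inner
        rw [path_eq_iff]
        have k1 := k x' h'.left (hqp (left_mem _ _))
        have k2 := k y' h'.right (hqp (right_mem _ _))
        have k3 := h'.ne
        grind
      rw [← this]
      exact hag
    by_contra hns
    obtain ⟨t, htq, htp⟩ := Set.not_subset.1 hns
    have htv : t ≠ v := fun e => htp (e ▸ hvp)
    have hadj := adj_dir (T := T) htv
    have hdq := hq.strip.isPathSet.dir_mem htq hvq
    have hfaces : ∀ {a b : V} (hab : T.graph.Adj a b), a ∈ q → b ∈ q →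
        ¬ (a ∈ T.path x y ∧ b ∈ T.path x y) → lf hab ∉ T.reg q (lf hn) := by
      intro a b hab ha hb hoff hr
      have h1 := faceLeft_of_reg h (hsub hr)
      have h2 : T.FaceLeft h (lf hn) := (leftSide_of_mem (d := ⟨(v, n), hn⟩) hvp hnp).2 hny.symm
      exact Agrees.not_leftSide hq h hg hvi hn hvq hnq hrq hvp hny hrx hag
        (d := ⟨(a, b), hab⟩) ha hb hoff (h1.1 h2)
    obtain ⟨x', y', h', rfl, hF⟩ := exists_orientation hq (lf hn)
    rcases adj_mem_path htq hdq hadj with ⟨htx, e⟩ | ⟨hty, e⟩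
    · have hdy : T.dir t v ≠ y' := by
        intro e'
        by_cases hty : t = y'
        · exact hadj.ne (hty.trans e'.symm)
        · have h3 : T.dir t y' = y' := dir_of_adj (e' ▸ hadj)
          exact dir_ne_of_mem htx htq (e.symm.trans (e'.trans h3.symm))
      refine hfaces hadj.symm hdq htq (fun h'' => htp h''.2) ?_
      have h4 := hF _ hdq hdy
      rwa [lf_eq (adj_dir hdy) hadj.symm] at h4
      refine dir_back hadj ?_
      by_cases hty : t = y'
      · exact Or.inl hty
      · right
        rw [e]
        exact (dir_ne_of_mem htx htq).symm
    · refine hfaces hadj htq hdq (fun h'' => htp h''.1) ?_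
      have h4 := hF _ htq hty
      rwa [lf_eq (adj_dir hty) hadj e.symm] at h4
  · rintro ⟨hp, hc, hag⟩
    obtain ⟨hvp, hnp, hrp⟩ := id hc
    refine ⟨mem_withBoundary.2 ⟨hp, Agrees.good hX hp hvp hvi hag⟩, hc, ?_⟩
    rintro q hqm ⟨hvq, hnq, hrq⟩
    obtain ⟨hq, hqg⟩ := mem_withBoundary.1 hqm
    change T.reg q (lf hn) ⊆ T.reg p (lf hn)
    change v ∈ q at hvq
    change n ∈ q at hnq
    change T.rot v n ∈ q at hrq
    obtain ⟨x, y, h, rfl, hny, hrx⟩ := exists_arcPath_corner hq hvi hn hvq hnq hrq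
    refine reg_subset h fun d h1 h2 h3 hiff => ?_
    refine Agrees.not_leftSide hp h hqg hvi hn hvp hnp hrp hvq hny hrx hag h1 h2 h3 (hiff.2 ?_)
    exact (leftSide_of_mem (d := ⟨(v, n), hn⟩) hvq hnq).2 hny.symm

end Marks

/-! ### Flips and removal of a segment from the biclosed set -/

section Flips

variable {T : PlaneTree V} {X Y : V → V → Prop} {p q r : Set V} {a b c v w n : V}

/-- The arc `p` is marked at `a` and `b` and turns left at both ends of the segment between
them. -/
structure LowerMark (T : PlaneTree V) (X : V → V → Prop) (p : Set V) (a b : V) : Prop where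
  isArc : T.IsArc p
  agrees_left : T.Agrees X p a
  agrees_right : T.Agrees X p b
  turns : T.LL p a b

/-- The arc `p` is marked at `a` and `b` and turns right at both ends of the segment between
them. -/
structure UpperMark (T : PlaneTree V) (X : V → V → Prop) (p : Set V) (a b : V) : Prop where
  isArc : T.IsArc p
  agrees_left : T.Agrees X p a
  agrees_right : T.Agrees X p b
  turns : T.RR p a b

lemma LowerMark.symm (h : T.LowerMark X p a b) : T.LowerMark X p b a :=
  ⟨h.1, h.3, h.2, h.4.symm⟩

lemma UpperMark.symm (h : T.UpperMark X p a b) : T.UpperMark X p b a :=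
  ⟨h.1, h.3, h.2, h.4.symm⟩

lemma mirror_lowerMark :
    T.mirror.LowerMark (fun a b => ¬ X a b) p a b ↔ T.UpperMark X p a b := by
  constructor
  · intro h
    have h1 := (mirror_isArc p).1 h.1
    have h4 := mirror_LL.1 h.4
    exact ⟨h1, (mirror_agrees h1 h4.mem_left).1 h.2, (mirror_agrees h1 h4.mem_right).1 h.3, h4⟩
  · intro h
    exact ⟨(mirror_isArc p).2 h.1, (mirror_agrees h.1 h.4.mem_left).2 h.2,
      (mirror_agrees h.1 h.4.mem_right).2 h.3, mirror_LL.2 h.4⟩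

lemma LowerMark.mem (h : T.LowerMark X p a b) : X a b :=
  (h.agrees_left b h.turns.mem_right h.turns.inner_right h.turns.ne.symm).2 h.turns.out_right

lemma UpperMark.notMem (h : T.UpperMark X p a b) : ¬ X a b := fun h' =>
  h.turns.not_outL h.isArc
    ((h.agrees_left b h.turns.mem_right h.turns.inner_right h.turns.ne.symm).1 h')

lemma LowerMark.isSeg (h : T.LowerMark X p a b) : T.IsSeg a b :=
  h.isArc.isSeg h.turns.mem_left h.turns.mem_right h.turns.ne h.turns.inner_left
    h.turns.inner_right

/-- A marked arc is determined by the segment between its marks. -/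
lemma LowerMark.eq_of_good (h : T.LowerMark X p a b) (hr : T.IsArc r)
    (hg : T.Good X r) (hab : T.LL r a b) : r = p := by
  obtain ⟨hp, hga, hgb, hLL⟩ := h
  have hai := hab.inner_left
  have hbi := hab.inner_right
  have hadj := adj_dir (T := T) hab.ne
  refine (hp.eq_of_turns hr (n := (T.rot a).symm (T.dir a b)) hai (rot_symm_adj hadj)
    hLL.mem_left hab.mem_left hLL.out_left hab.out_left
    (by rw [Equiv.apply_symm_apply]
        exact hp.strip.isPathSet.dir_mem hLL.mem_left hLL.mem_right)
    (by rw [Equiv.apply_symm_apply]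
        exact hr.strip.isPathSet.dir_mem hab.mem_left hab.mem_right)
    fun w hwp hwr hwi hwa => ?_).symm
  by_cases hwb : w = b
  · subst hwb
    exact iff_of_true hLL.out_right hab.out_right
  have a1 := hga w hwp hwi hwa
  have a2 := hgb w hwp hwi hwb
  have g1 := fun h h' => hg.1 a w ⟨Ne.symm hwa, hai, hwi, hab.mem_left, hwr, h, h'⟩
  have g2 := fun h h' => hg.2 a w ⟨Ne.symm hwa, hai, hwi, hab.mem_left, hwr, h, h'⟩
  have g3 := fun h h' => hg.1 b w ⟨Ne.symm hwb, hbi, hwi, hab.mem_right, hwr, h, h'⟩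
  have g4 := fun h h' => hg.2 b w ⟨Ne.symm hwb, hbi, hwi, hab.mem_right, hwr, h, h'⟩
  have n1 := hp.outL_iff_not hLL.mem_left hwp hwi (Ne.symm hwa)
  have n2 := hr.outL_iff_not hab.mem_left hwr hwi (Ne.symm hwa)
  have o1 := hab.out_left
  have o2 := hab.out_right
  rcases hp.strip.isPathSet.btw_trichotomy hLL.mem_left hwp hLL.mem_right (Ne.symm hwa) hab.ne hwb
    with hc | hc | hc
  · have hs := hp.isSeg hLL.mem_left hLL.mem_right hab.ne hai hbi
    rw [← hs.strip.outL_sub hp.strip (left_mem _ _) (right_mem _ _) hLL.mem_left hLL.mem_right hc,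
      ← hs.strip.outL_sub hr.strip (left_mem _ _) (right_mem _ _) hab.mem_left hab.mem_right hc]
  · have l1 := hr.strip.line hwr hab.mem_right hc
    have l2 := hp.strip.line hwp hLL.mem_right hc
    grind
  · have l1 := hr.strip.line hab.mem_left hwr hc
    have l2 := hp.strip.line hLL.mem_left hwp hc
    grind

lemma UpperMark.eq_of_good (h : T.UpperMark X p a b) (hr : T.IsArc r)
    (hg : T.Good X r) (hab : T.RR r a b) : r = p :=
  (mirror_lowerMark.2 h).eq_of_good ((mirror_isArc r).2 hr) (mirror_good.2 hg)
    (mirror_LL.2 hab)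

/-- Removing the segment between `a` and `b`. -/
def remove (X : V → V → Prop) (a b u v : V) : Prop :=
  X u v ∧ ¬ (u = a ∧ v = b) ∧ ¬ (u = b ∧ v = a)

/-- If `[a, c]` turns right at `b`, then `[b, c]` is the part seen from `c` up to a left turn, and
`Tors` applies. Otherwise `[a, c]` follows `p` past `b`. If `c` is on `p`, the marks at `a` and `b`
prescribe the same turn there. If `[a, c]` leaves `p` at `g`, the turns at `g` are opposite: a left
turn of `[a, c]` would put `[a, g]` into `X` against the mark at `a`, and a right turn puts `[b, g]`
and `[g, c]` into `X`. -/
lemma LowerMark.iff_beyond (h : T.LowerMark X p a b) (hX : T.Biclosed X) (hT : T.Tors X)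
    (hs : T.IsSeg a c) (hb : T.Btw a b c) : X a c ↔ X b c := by
  have hab := h.mem
  obtain ⟨hp, hga, hgb, hLL⟩ := h
  refine ⟨fun hac => ?_, fun hbc => hX.closed hs hb hab hbc⟩
  have hst := hs.strip
  have hl := left_mem (T := T) a c
  have hr := right_mem (T := T) a c
  have l1 := hst.line hl hr hb
  by_cases hL : T.OutL (T.path a c) a b
  · have hd : T.dir b c ∈ p := by
      have h1 := hLL.out_right
      rwa [OutL, ← (hst.outL_iff hl hr hb).1 hL, Equiv.symm_apply_apply] at h1
    by_cases hcp : c ∈ p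
    · have l2 := hp.strip.line hLL.mem_left hcp hb
      have a1 := hga c hcp hs.right hs.ne.symm
      have a2 := hgb c hcp hs.right hb.2.1.symm
      grind
    · obtain ⟨g, hbt, hgp, hgs, -, h1, h2⟩ := hp.diverge hst hLL.mem_right hb.2.2 hr hcp hd
      have hbt' : T.Btw a b g := (hbt.symm.trans_left hb.symm).symm
      have hbt'' : T.Btw a g c := (hbt.symm.trans_mid hb.symm).symm
      have l2 := hp.strip.line hLL.mem_left hgp hbt'
      have l3 := hst.line hl hgs hbt'
      have l4 := hst.line hl hr hbt''
      have a1 := hga g hgp hbt.inner hbt''.1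
      have a2 := hgb g hgp hbt.inner hbt.1
      have t1 := hT a g c hs hbt'' hac
      have t2 := hT c g a hs.symm hbt''.symm (hX.symm hac)
      rw [path_comm c a] at t2
      have c1 := hX.closed (hs.sub_right hb) hbt
      have c2 := hX.iff (a := c) (b := g)
      have n1 := hp.outL_iff_not hLL.mem_right hgp hbt.inner hbt.1.symm
      grind
  · refine hX.symm (hT c b a hs.symm hb.symm (hX.symm hac) ?_)
    rw [path_comm]
    grind

/-- The arc turns left at `w` as seen from exactly one of the two marks. -/
lemma LowerMark.xor_between (h : T.LowerMark X p a b) (hw : T.Btw a w b) : X a w ↔ ¬ X b w := by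
  obtain ⟨hp, hga, hgb, hLL⟩ := h
  have hwp := hp.strip.btw_mem hLL.mem_left hLL.mem_right hw
  have l1 := hp.strip.line hLL.mem_left hLL.mem_right hw
  have l2 := hp.strip.line hLL.mem_right hLL.mem_left hw.symm
  have a1 := hga w hwp hw.inner hw.1
  have a2 := hgb w hwp hw.inner hw.2.1
  grind

/-- Closedness could only fail by producing `[a, b]` itself, which `xor_between` excludes.
Coclosedness could only fail for a segment with `[a, b]` as one part, and then `iff_beyond` supplies
the other part. -/
lemma LowerMark.remove_biclosed (h : T.LowerMark X p a b) (hX : T.Biclosed X) (hT : T.Tors X) :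
    T.Biclosed (remove X a b) where
  symm h' := ⟨hX.symm h'.1, fun h'' => h'.2.2 ⟨h''.2, h''.1⟩, fun h'' => h'.2.1 ⟨h''.2, h''.1⟩⟩
  closed {u m w} hs hm h1 h2 := by
    refine ⟨hX.closed hs hm h1.1 h2.1, ?_, ?_⟩
    · rintro ⟨rfl, rfl⟩
      exact (h.xor_between hm).1 h1.1 (hX.symm h2.1)
    · rintro ⟨rfl, rfl⟩
      exact (h.symm.xor_between hm).1 h1.1 (hX.symm h2.1)
  coclosed {u m w} hs hm h1 := by
    have c1 := hX.coclosed hs hm h1.1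
    have k1 := fun (e1 : u = a) (e2 : m = b) =>
      (h.iff_beyond hX hT (c := w) (e1 ▸ hs) (e1 ▸ e2 ▸ hm)).1 (e1 ▸ h1.1)
    have k2 := fun (e1 : u = b) (e2 : m = a) =>
      (h.symm.iff_beyond hX hT (c := w) (e1 ▸ hs) (e1 ▸ e2 ▸ hm)).1 (e1 ▸ h1.1)
    have k3 := fun (e1 : w = a) (e2 : m = b) =>
      (h.iff_beyond hX hT (c := u) (e1 ▸ hs.symm) (e1 ▸ e2 ▸ hm.symm)).1 (e1 ▸ hX.symm h1.1)
    have k4 := fun (e1 : w = b) (e2 : m = a) =>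
      (h.symm.iff_beyond hX hT (c := u) (e1 ▸ hs.symm) (e1 ▸ e2 ▸ hm.symm)).1 (e1 ▸ hX.symm h1.1)
    have n1 := hs.ne
    have n2 := hm.1
    have n3 := hm.2.1
    have i1 := hX.iff (a := u) (b := m)
    have i2 := hX.iff (a := m) (b := w)
    unfold remove
    grind

/-- The flip of a marked arc. -/
lemma LowerMark.exists_flip [Finite V] (h : T.LowerMark X p a b) (hX : T.Biclosed X)
    (hT : T.Tors X) : ∃ q Y, T.Biclosed Y ∧ T.UpperMark Y q a b ∧
      q ∉ T.facetOf X ∧ p ∉ T.facetOf Y ∧ q ∈ T.facetOf Y ∧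
      T.facetOf X = insert p (T.facetOf Y \ {q}) := by
  have hY := h.remove_biclosed hX hT
  have hXab := h.mem
  have hseg := h.isSeg
  have hbey := fun {c} => h.iff_beyond (c := c) hX hT
  have hbey' := fun {c} => h.symm.iff_beyond (c := c) hX hT
  obtain ⟨hp, hga, hgb, hLL⟩ := id h
  have hai := hLL.inner_left
  have hbi := hLL.inner_right
  -- The new arc passes through the other corner at `a` beside the first edge of `[a, b]`, so it
  -- turns right at `a`.
  obtain ⟨q, hq, haq, hdq, hrq, hag⟩ := exists_arc hai (adj_dir hLL.ne) (remove X a b a)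
  have hYab : ¬ remove X a b a b := fun h' => h'.2.1 ⟨rfl, rfl⟩
  have hYX : ∀ {w}, w ≠ b → (remove X a b a w ↔ X a w) := by
    intro w hw
    have := hLL.ne
    unfold remove
    grind
  have hYX' : ∀ {w}, w ≠ a → (remove X a b b w ↔ X b w) := by
    intro w hw
    have := hLL.ne
    unfold remove
    grind
  -- Strictly between `a` and `b` the sets before and after removal agree, so `q` follows `p` up to
  -- `b`.
  have hbq : b ∈ q := by
    by_contra hbq
    obtain ⟨g, hbt, hgq, hgs, -, h1, h2⟩ :=
      hq.diverge hseg.strip haq (left_mem a b) (right_mem a b) hbq hdq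
    have a1 := hag g hgq hbt.inner hbt.1
    rw [hYX hbt.2.1] at a1
    have hgp := hp.strip.btw_mem hLL.mem_left hLL.mem_right hbt
    have a2 := hga g hgp hbt.inner hbt.1
    have a3 := hseg.strip.outL_sub hp.strip (left_mem a b) (right_mem a b) hLL.mem_left
      hLL.mem_right hbt
    have a4 := hq.outL_iff_not haq hgq hbt.inner hbt.1.symm
    grind
  have hRR : T.RR q a b := by
    have a1 := hag b hbq hbi hLL.ne.symm
    have a2 := hq.outL_iff_not haq hbq hbi hLL.ne
    exact ⟨hLL.ne, hai, hbi, haq, hbq, by grind, hrq⟩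
  have hagb : T.Agrees (remove X a b) q b := by
    intro w hwq hwi hwb
    by_cases hwa : w = a
    · subst hwa
      exact iff_of_false (fun h' => hYab (hY.symm h')) (hRR.symm.not_outL hq)
    rw [hYX' hwa]
    have a1 := hag w hwq hwi hwa
    rw [hYX hwb] at a1
    rcases hq.strip.isPathSet.btw_trichotomy haq hwq hbq (Ne.symm hwa) hLL.ne hwb with hc | hc | hc
    · have hwp := hp.strip.btw_mem hLL.mem_left hLL.mem_right hc
      rw [hgb w hwp hwi hwb,
        ← hseg.strip.outL_sub hp.strip (right_mem a b) (left_mem a b) hLL.mem_right hLL.mem_left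
          hc.symm,
        ← hseg.strip.outL_sub hq.strip (right_mem a b) (left_mem a b) hbq haq hc.symm]
    · have l1 := hq.strip.line hwq hbq hc
      have := hbey' (hq.isSeg hbq hwq (Ne.symm hwb) hbi hwi) hc.symm
      grind
    · have l1 := hq.strip.line haq hwq hc
      have := hbey (hq.isSeg haq hwq (Ne.symm hwa) hai hwi) hc
      grind
  have hU : T.UpperMark (remove X a b) q a b := ⟨hq, fun w h1 h2 h3 => hag w h1 h2 h3, hagb, hRR⟩
  have hqY : q ∈ T.facetOf (remove X a b) :=
    ⟨hq, ⟨a, b, Or.inr hRR⟩, hU.agrees_left.good hY hq haq hai⟩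
  have hqX : q ∉ T.facetOf X := fun h' => h'.2.2.2 _ _ hRR hXab
  refine ⟨q, remove X a b, hY, hU, hqX, fun h' => hYab (h'.2.2.1 _ _ hLL), hqY, ?_⟩
  -- The two sets differ only in `[a, b]`. An arc compatible with exactly one of them turns left, or
  -- right, at both ends of `[a, b]`, and is therefore `p`, or `q`.
  ext r
  constructor
  · rintro ⟨hr, hbent, hg⟩
    by_cases hrp : r = p
    · exact Or.inl hrp
    refine Or.inr ⟨⟨hr, hbent, fun u v huv => ⟨hg.1 u v huv, ?_, ?_⟩,
      fun u v huv h' => hg.2 u v huv h'.1⟩, fun e => hqX (e ▸ ⟨hr, hbent, hg⟩)⟩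
    · rintro ⟨rfl, rfl⟩
      exact hrp (h.eq_of_good hr hg huv)
    · rintro ⟨rfl, rfl⟩
      exact hrp (h.eq_of_good hr hg huv.symm)
  · rintro (rfl | ⟨⟨hr, hbent, hg⟩, hrq'⟩)
    · exact ⟨hp, ⟨a, b, Or.inl hLL⟩, hga.good hX hp hLL.mem_left hai⟩
    · refine ⟨hr, hbent, fun u v huv => (hg.1 u v huv).1, fun u v huv h' =>
        hg.2 u v huv ⟨h', ?_, ?_⟩⟩
      · rintro ⟨rfl, rfl⟩
        exact hrq' (hU.eq_of_good hr hg huv)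
      · rintro ⟨rfl, rfl⟩
        exact hrq' (hU.eq_of_good hr hg huv.symm)

end Flips

/-! ### Labels of flips are segments between two marks -/

section Labels

variable {T : PlaneTree V} {X Y : V → V → Prop} {p q r s : Set V} {a b c v w n : V}

lemma IsArc.exists_corner (hp : T.IsArc p) (hv : v ∈ p) (hvi : T.IsInner v) :
    ∃ n, T.graph.Adj v n ∧ n ∈ p ∧ T.rot v n ∈ p := by
  obtain ⟨x, y, h, rfl⟩ := isArc_iff.1 hp
  have hb := h.btw hv hvi
  have h1 := h.strip.isPathSet.dir_mem hv (left_mem x y)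
  have h2 := h.strip.isPathSet.dir_mem hv (right_mem x y)
  rcases h.strip.turn (left_mem _ _) (right_mem _ _) hb with e | e
  · exact ⟨_, adj_dir hb.1, h1, e ▸ h2⟩
  · exact ⟨_, adj_dir hb.2.1, h2, e ▸ h1⟩

/-- The marks of an arc depend only on the facet. -/
lemma agrees_congr [Finite V] (hX : T.Biclosed X) (hY : T.Biclosed Y)
    (h : T.facetOf X = T.facetOf Y) (hp : T.IsArc p) (hv : v ∈ p) (hvi : T.IsInner v) :
    T.Agrees X p v ↔ T.Agrees Y p v := by
  obtain ⟨n, hn, h1, h2⟩ := hp.exists_corner hv hvi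
  have k1 := isMarked_iff hX (p := p) (c := ⟨v, n, hvi, hn⟩)
  rw [h, isMarked_iff hY] at k1
  have k2 : T.ContainsCorner p ⟨v, n, hvi, hn⟩ := ⟨hv, h1, h2⟩
  simpa [hp, k2] using k1.symm

lemma lowerMark_congr [Finite V] (hX : T.Biclosed X) (hY : T.Biclosed Y)
    (h : T.facetOf X = T.facetOf Y) (hm : T.LowerMark X p a b) : T.LowerMark Y p a b :=
  ⟨hm.1, (agrees_congr hX hY h hm.1 hm.4.mem_left hm.4.inner_left).1 hm.2,
    (agrees_congr hX hY h hm.1 hm.4.mem_right hm.4.inner_right).1 hm.3, hm.4⟩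

lemma exists_flip_marks [Finite V] {F G : T.Facet} (hX : T.Biclosed X) (hY : T.Biclosed Y)
    (hF : F.1 = T.facetOf X) (hG : G.1 = T.facetOf Y) (hp : T.LowerMark X p a b)
    (hq : T.UpperMark Y q a b) :
    ∃ c d c' d' : T.Corner, c.vertex ≠ d.vertex ∧
      T.ImmClockwise c c' ∧ T.ImmClockwise d d' ∧
      T.IsMarked G.1 q c ∧ T.IsMarked G.1 q d ∧
      T.IsMarked F.1 p c' ∧ T.IsMarked F.1 p d' ∧ T.path a b = T.path c.vertex d.vertex := by
  obtain ⟨hp, pa, pb, hLL⟩ := hp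
  obtain ⟨hq, qa, qb, hRR⟩ := hq
  have h1 := adj_dir (T := T) hLL.ne
  have h2 := adj_dir (T := T) hLL.ne.symm
  refine ⟨⟨a, _, hLL.inner_left, h1⟩, ⟨b, _, hLL.inner_right, h2⟩,
    ⟨a, _, hLL.inner_left, rot_symm_adj h1⟩, ⟨b, _, hLL.inner_right, rot_symm_adj h2⟩,
    hLL.ne, ⟨rfl, rfl⟩, ⟨rfl, rfl⟩, ?_, ?_, ?_, ?_, rfl⟩
  · rw [hG, isMarked_iff hY]
    exact ⟨hq, ⟨hRR.mem_left, hq.strip.isPathSet.dir_mem hRR.mem_left hRR.mem_right,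
      hRR.out_left⟩, qa⟩
  · rw [hG, isMarked_iff hY]
    exact ⟨hq, ⟨hRR.mem_right, hq.strip.isPathSet.dir_mem hRR.mem_right hRR.mem_left,
      hRR.out_right⟩, qb⟩
  · rw [hF, isMarked_iff hX]
    refine ⟨hp, ⟨hLL.mem_left, hLL.out_left, ?_⟩, pa⟩
    change T.rot a ((T.rot a).symm _) ∈ p
    rw [Equiv.apply_symm_apply]
    exact hp.strip.isPathSet.dir_mem hLL.mem_left hLL.mem_right
  · rw [hF, isMarked_iff hX]
    refine ⟨hp, ⟨hLL.mem_right, hLL.out_right, ?_⟩, pb⟩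
    change T.rot b ((T.rot b).symm _) ∈ p
    rw [Equiv.apply_symm_apply]
    exact hp.strip.isPathSet.dir_mem hLL.mem_right hLL.mem_left

/-- Adjacent corners at a vertex share exactly one edge. Both arcs contain the path to the other
vertex, so this edge is its first one, and the remaining edges of the corners give the turns. -/
lemma turns_of_flip (hp : T.IsArc p) (hq : T.IsArc q) {c d c' d' : T.Corner}
    (hcd : c.vertex ≠ d.vertex) (hc : T.ImmClockwise c c') (hd : T.ImmClockwise d d')
    (h1 : T.ContainsCorner p c) (h2 : T.ContainsCorner p d) (h3 : T.ContainsCorner q c')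
    (h4 : T.ContainsCorner q d') :
    T.RR p c.vertex d.vertex ∧ T.LL q c.vertex d.vertex := by
  obtain ⟨a, n, hai, hn⟩ := c
  obtain ⟨b, m, hbi, hm⟩ := d
  obtain ⟨a', n', hai', hn'⟩ := c'
  obtain ⟨b', m', hbi', hm'⟩ := d'
  obtain ⟨hc1, hc2⟩ := hc
  obtain ⟨hd1, hd2⟩ := hd
  dsimp only at hc1 hc2 hd1 hd2
  subst hc2 hd2
  subst hc1 hd1
  obtain ⟨hap, hnp, hrnp⟩ := h1
  obtain ⟨hbp, hmp, hrmp⟩ := h2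
  obtain ⟨haq, hnq, hrnq⟩ := h3
  obtain ⟨hbq, hmq, hrmq⟩ := h4
  dsimp only at *
  rw [Equiv.apply_symm_apply] at hrnq hrmq
  have key : ∀ a b n, T.IsInner a → a ≠ b → T.graph.Adj a n → a ∈ p → b ∈ p → a ∈ q → b ∈ q →
      n ∈ p → T.rot a n ∈ p → n ∈ q → (T.rot a).symm n ∈ q → T.dir a b = n := by
    intro a b n hai hab hn hap hbp haq hbq h1 h2 h3 h4
    have hdp := hp.strip.isPathSet.dir_mem hap hbp
    have hdq := hq.strip.isPathSet.dir_mem haq hbq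
    have hadj := adj_dir (T := T) hab
    obtain ⟨x, y, h, rfl⟩ := isArc_iff.1 hp
    obtain ⟨x', y', h', rfl⟩ := isArc_iff.1 hq
    have hb := h.btw hap hai
    have hb' := h'.btw haq hai
    have e1 := h.adj_mem hb hn h1
    have e2 := h.adj_mem hb (rot_adj hn) h2
    have e3 := h'.adj_mem hb' hn h3
    have e4 := h'.adj_mem hb' (rot_symm_adj hn) h4
    have e5 := h.adj_mem hb hadj hdp
    have e6 := h'.adj_mem hb' hadj hdq
    have n1 := rot_ne hai hn
    have n2 := rot_symm_ne hai hn
    have n3 := rot_symm_ne_rot hai hn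
    grind
  have e1 := key _ _ n hai hcd hn hap hbp haq hbq hnp hrnp hrnq hnq
  have e2 := key _ _ m hbi hcd.symm hm hbp hap hbq haq hmp hrmp hrmq hmq
  refine ⟨⟨hcd, hai, hbi, hap, hbp, ?_, ?_⟩, ⟨hcd, hai, hbi, haq, hbq, ?_, ?_⟩⟩
  · rw [OutR, e2]; exact hrmp
  · rw [OutR, e1]; exact hrnp
  · rw [OutL, e2]; exact hmq
  · rw [OutL, e1]; exact hnq

lemma mem_lowerLabels [Finite V] {F : T.Facet} (hX : T.Biclosed X) (hF : F.1 = T.facetOf X) :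
    s ∈ T.lowerLabels F ↔ ∃ p a b, T.LowerMark X p a b ∧ s = T.path a b := by
  constructor
  · rintro ⟨G, p, q, -, -, -, c, d, c', d', hcd, hc, hd, h1, h2, h3, h4, rfl⟩
    obtain ⟨Y, hY, -, hG⟩ := exists_facetOf (isFacet_iff.1 G.2)
    rw [hG, isMarked_iff hY] at h1 h2
    rw [hF, isMarked_iff hX] at h3 h4
    have hLL := (turns_of_flip h1.1 h3.1 hcd hc hd h1.2.1 h2.2.1 h3.2.1 h4.2.1).2
    exact ⟨q, _, _, ⟨h3.1, hc.1 ▸ h3.2.2, hd.1 ▸ h4.2.2, hLL⟩, rfl⟩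
  · rintro ⟨p, a, b, h, rfl⟩
    -- Several biclosed sets give the same facet. Removing a segment needs one with the property
    -- `Tors`; the marks do not depend on the choice.
    obtain ⟨X', hX', hT, hF'⟩ := exists_facetOf (isFacet_iff.1 F.2)
    have h' := lowerMark_congr hX hX' (hF.symm.trans hF') h
    obtain ⟨q, Y, hY, hU, k1, k2, k3, k4⟩ := h'.exists_flip hX' hT
    refine ⟨⟨T.facetOf Y, isFacet_iff.2 (facetOf_maximal hY)⟩, q, p, k3, k2, hF'.trans k4, ?_⟩
    exact exists_flip_marks hX' hY hF' rfl h' hU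

lemma mem_upperLabels [Finite V] {F : T.Facet} (hX : T.Biclosed X) (hF : F.1 = T.facetOf X) :
    s ∈ T.upperLabels F ↔ ∃ p a b, T.UpperMark X p a b ∧ s = T.path a b := by
  constructor
  · rintro ⟨G, p, q, -, -, -, c, d, c', d', hcd, hc, hd, h1, h2, h3, h4, rfl⟩
    obtain ⟨Y, hY, -, hG⟩ := exists_facetOf (isFacet_iff.1 G.2)
    rw [hF, isMarked_iff hX] at h1 h2
    rw [hG, isMarked_iff hY] at h3 h4
    have hRR := (turns_of_flip h1.1 h3.1 hcd hc hd h1.2.1 h2.2.1 h3.2.1 h4.2.1).1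
    exact ⟨p, _, _, ⟨h1.1, h1.2.2, h2.2.2, hRR⟩, rfl⟩
  · rintro ⟨p, a, b, h, rfl⟩
    -- An upper mark is a lower mark of the reflected tree, so the flip is constructed there, with a
    -- set chosen for the reflected facet, and carried back.
    obtain ⟨X', hX', hT, hF'⟩ := exists_facetOf (isFacet_iff.1 (mirror_isFacet.2 F.2))
    have hm := lowerMark_congr hX.mirror hX' (mirror_facetOf.trans (hF.symm.trans hF'))
      (mirror_lowerMark.2 h)
    obtain ⟨q, Y, hY, hU, k1, k2, k3, k4⟩ := hm.exists_flip hX' hT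
    have hU' : T.LowerMark (fun a b => ¬ Y a b) q a b := mirror_lowerMark (T := T.mirror).2 hU
    have hY' : T.Biclosed fun a b => ¬ Y a b := hY.mirror
    have hYF : T.facetOf (fun a b => ¬ Y a b) = T.mirror.facetOf Y :=
      mirror_facetOf (T := T.mirror)
    rw [← hYF] at k2 k3 k4
    rw [← hF'] at k1 k4
    refine ⟨⟨_, isFacet_iff.2 (facetOf_maximal hY')⟩, p, q, ?_, k1, ?_, ?_⟩
    · rw [k4]; exact Set.mem_insert _ _
    · change T.facetOf _ = _
      rw [k4]
      ext r
      simp only [Set.mem_insert_iff, Set.mem_sdiff, Set.mem_singleton_iff]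
      grind
    · exact exists_flip_marks hY' hX rfl hF hU' h

end Labels

/-! ### Vertices separated by an arc, and the ends of labels -/

section Sides

variable {T : PlaneTree V} {X : V → V → Prop} {p q r s : Set V} {a b c u v w x z : V}

lemma gate_inner (hp : T.IsArc p) (hz : T.IsInner z) : T.IsInner (T.gate p z) := by
  have hps := hp.strip.isPathSet
  by_cases h : z ∈ p
  · rwa [gate_of_mem hps h]
  have hg := gate_mem hps z
  have hd := gate_dir_notMem hps h
  have hgz : T.gate p z ≠ z := fun e => h (e ▸ hg)
  obtain ⟨w, hw, hne⟩ : ∃ w ∈ p, T.gate p z ≠ w := by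
    obtain ⟨x, y, h', rfl⟩ := isArc_iff.1 hp
    by_cases e : T.gate (T.path x y) z = x
    · exact ⟨y, right_mem _ _, fun e' => h'.ne (e.symm.trans e')⟩
    · exact ⟨x, left_mem _ _, e⟩
  refine inner_of_adj_adj (adj_dir hgz) (adj_dir hne) fun e => hd ?_
  rw [e]
  exact hps.dir_mem hg hw

/-- The vertices `u` and `v` are on different sides of the arc `p`. -/
def Sep (T : PlaneTree V) (p : Set V) (u v : V) : Prop :=
  T.gate p u ≠ T.gate p v ∧
    (T.OutL p (T.gate p u) (T.gate p v) ↔ T.OutL p (T.gate p v) (T.gate p u))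

lemma Sep.symm (h : T.Sep p u v) : T.Sep p v u := ⟨h.1.symm, h.2.symm⟩

/-- The side of a vertex is recorded by the turn of the arc at its gate, seen from a fixed end of
the arc. So nonseparation is an equivalence relation with at most two classes. -/
lemma sep_iff (hp : T.IsArc p) (hx : x ∈ p) (hxl : T.IsLeaf x) (hu : T.IsInner u)
    (hv : T.IsInner v) :
    T.Sep p u v ↔ ¬ (T.OutL p x (T.gate p u) ↔ T.OutL p x (T.gate p v)) := by
  have hps := hp.strip.isPathSet
  unfold Sep
  by_cases h : T.gate p u = T.gate p v
  · rw [h]; grind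
  rw [← hp.opp_iff hx hxl (gate_mem hps u) (gate_mem hps v) (gate_inner hp hu) (gate_inner hp hv) h]
  grind

lemma sep_trans (hp : T.IsArc p) (hu : T.IsInner u) (hv : T.IsInner v) (hw : T.IsInner w)
    (h : ¬ T.Sep p u v) : T.Sep p u w ↔ T.Sep p v w := by
  obtain ⟨x, hx, hxl⟩ := hp.exists_leaf
  rw [sep_iff hp hx hxl hu hv] at h
  rw [sep_iff hp hx hxl hu hw, sep_iff hp hx hxl hv hw]
  grind

lemma sep_trans' (hp : T.IsArc p) (hu : T.IsInner u) (hv : T.IsInner v) (hw : T.IsInner w)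
    (h : T.Sep p u v) : T.Sep p u w ↔ ¬ T.Sep p v w := by
  obtain ⟨x, hx, hxl⟩ := hp.exists_leaf
  rw [sep_iff hp hx hxl hu hv] at h
  rw [sep_iff hp hx hxl hu hw, sep_iff hp hx hxl hv hw]
  grind

lemma not_sep_self : ¬ T.Sep p u u := fun h => h.1 rfl

lemma sep_iff_of_mem (hp : T.Strip p) (hu : u ∈ p) (hv : v ∈ p) :
    T.Sep p u v ↔ u ≠ v ∧ (T.OutL p u v ↔ T.OutL p v u) := by
  unfold Sep
  rw [gate_of_mem hp.isPathSet hu, gate_of_mem hp.isPathSet hv]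

lemma LL.sep (h : T.LL p a b) (hp : T.Strip p) : T.Sep p a b :=
  (sep_iff_of_mem hp h.mem_left h.mem_right).2 ⟨h.ne, iff_of_true h.out_right h.out_left⟩

lemma mirror_sep (hp : T.IsArc p) (hu : T.IsInner u) (hv : T.IsInner v) :
    T.mirror.Sep p u v ↔ T.Sep p u v := by
  have hps := hp.strip.isPathSet
  change (T.gate p u ≠ T.gate p v ∧
    (T.OutR p (T.gate p u) (T.gate p v) ↔ T.OutR p (T.gate p v) (T.gate p u))) ↔ _
  refine and_congr_right fun h => ?_
  have h1 := hp.outL_iff_not (gate_mem hps u) (gate_mem hps v) (gate_inner hp hv) h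
  have h2 := hp.outL_iff_not (gate_mem hps v) (gate_mem hps u) (gate_inner hp hu) h.symm
  grind

lemma RR.sep (h : T.RR p a b) (hp : T.IsArc p) : T.Sep p a b :=
  (mirror_sep hp h.inner_left h.inner_right).1
    ((mirror_LL.2 h).sep ((mirror_isArc p).2 hp).strip)

lemma gate_order (hq : T.Strip q) (h : T.gate q a ≠ T.gate q b) :
    (T.gate q a = a ∨ T.Btw a (T.gate q a) (T.gate q b)) ∧
    (T.gate q b = b ∨ T.Btw (T.gate q a) (T.gate q b) b) := by
  have hps := hq.isPathSet
  have h1 := gate_mem_path hps a (gate_mem hps b)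
  have h2 := gate_mem_path hps b (gate_mem hps a)
  rw [path_comm] at h2
  rcases btw_or_eq_of_mem h1 with e | e | e <;> rcases btw_or_eq_of_mem h2 with e' | e' | e' <;>
    first
    | exact absurd e h
    | exact absurd e'.symm h
    | exact ⟨Or.inl e, Or.inl e'⟩
    | exact ⟨Or.inl e, Or.inr e'⟩
    | exact ⟨Or.inr e, Or.inl e'⟩
    | exact ⟨Or.inr e, Or.inr e'⟩

lemma Strip.not_outL_of_exit (hp : T.Strip p) (ha : a ∈ p) (hc : c ∈ p) (h : T.Btw a b c)
    (hq : T.dir b c ∉ q) : (T.OutL p a b → ¬ T.OutL q a b) ∧ (T.OutR p a b → ¬ T.OutR q a b) := by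
  constructor
  · intro h1 h2
    rw [OutL, ← (hp.outL_iff ha hc h).1 h1, Equiv.symm_apply_apply] at h2
    exact hq h2
  · intro h1 h2
    rw [OutR, (hp.outR_iff ha hc h).1 h1] at h2
    exact hq h2

lemma gate_eq_or_dir_notMem (hp : T.IsPathSet p) (z : V) :
    T.gate p z = z ∨ T.dir (T.gate p z) z ∉ p := by
  by_cases h : z ∈ p
  · exact Or.inl (gate_of_mem hp h)
  · exact Or.inr (gate_dir_notMem hp h)

/-- Suppose `q` separates, and let `g` and `k` be the gates of `a` and `b`, both on `[a, b]`; `q`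
turns the same way at both ends of `[g, k]`. Where `[a, b]` leaves `q` the turns are opposite, so
the marks of `p` tell how the turns of `q` depend on `[a, g]` and `[b, k]` being in `X`. If `g = a`
and `k = b`, then `q` turns left at both and must be `p`; in the other cases biclosedness
contradicts compatibility of `q` along `[g, k]`. -/
lemma LowerMark.not_sep (h : T.LowerMark X p a b) (hX : T.Biclosed X) (hq : T.IsArc q)
    (hg : T.Good X q) (hne : q ≠ p) : ¬ T.Sep q a b := by
  intro hsep
  have hab := h.mem
  obtain ⟨hp, hga, hgb, hLL⟩ := id h
  have hps := hq.strip.isPathSet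
  obtain ⟨hgh, hturn⟩ := hsep
  have hgi := gate_inner hq hLL.inner_left
  have hhi := gate_inner hq hLL.inner_right
  have hgq := gate_mem hps a
  have hhq := gate_mem hps b
  obtain ⟨o1, o2⟩ := gate_order hq.strip hgh
  have hda := gate_eq_or_dir_notMem hps a
  have hdb := gate_eq_or_dir_notMem hps b
  generalize T.gate q a = g at *
  generalize T.gate q b = k at *
  have hg1 : g = a ∨ T.Btw a g b := by
    rcases o1 with e | e
    · exact Or.inl e
    · rcases o2 with rfl | e'
      · exact Or.inr e
      · exact Or.inr (e.trans_right e')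
  have hk1 : k = b ∨ T.Btw a k b := by
    rcases o2 with e | e
    · exact Or.inl e
    · rcases o1 with rfl | e'
      · exact Or.inr e
      · exact Or.inr (e.symm.trans_right e'.symm).symm
  have hgp : g ∈ p := by
    rcases hg1 with rfl | e
    · exact hLL.mem_left
    · exact hp.strip.btw_mem hLL.mem_left hLL.mem_right e
  have hkp : k ∈ p := by
    rcases hk1 with rfl | e
    · exact hLL.mem_right
    · exact hp.strip.btw_mem hLL.mem_left hLL.mem_right e
  have n1 := hq.outL_iff_not hgq hhq hhi hgh
  have n2 := hq.outL_iff_not hhq hgq hgi hgh.symm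
  have g1 := fun h1 h2 => hg.1 g k ⟨hgh, hgi, hhi, hgq, hhq, h1, h2⟩
  have g2 := fun h1 h2 => hg.2 g k ⟨hgh, hgi, hhi, hgq, hhq, h1, h2⟩
  have hXg := hX.iff (a := b) (b := g)
  have hXk := hX.iff (a := b) (b := k)
  have ka : g ≠ a → (T.OutL q k g ↔ X a g) ∧ (X b g ↔ ¬ X a g) := by
    intro hga'
    have hb := hg1.resolve_left hga'
    have e1 := hp.strip.not_outL_of_exit hLL.mem_right hLL.mem_left hb.symm
      (hda.resolve_left hga')
    have hd : T.dir g b = T.dir g k := by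
      rcases o2 with rfl | o2
      · rfl
      · exact o2.dir_left.symm
    have e2 : T.OutL q b g ↔ T.OutL q k g := by rw [OutL, OutL, hd]
    have e3 : T.OutR q b g ↔ T.OutR q k g := by rw [OutR, OutR, hd]
    have l1 := hp.strip.line hLL.mem_left hLL.mem_right hb
    have l2 := hp.strip.line hLL.mem_right hLL.mem_left hb.symm
    have a1 := hga g hgp hgi hga'
    have a2 := hgb g hgp hgi hb.2.1
    grind
  have kb : k ≠ b → (T.OutL q g k ↔ X b k) ∧ (X a k ↔ ¬ X b k) := by
    intro hkb
    have hb := hk1.resolve_left hkb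
    have e1 := hp.strip.not_outL_of_exit hLL.mem_left hLL.mem_right hb (hdb.resolve_left hkb)
    have hd : T.dir k a = T.dir k g := by
      rcases o1 with rfl | o1
      · rfl
      · exact o1.dir_right.symm
    have e2 : T.OutL q a k ↔ T.OutL q g k := by rw [OutL, OutL, hd]
    have e3 : T.OutR q a k ↔ T.OutR q g k := by rw [OutR, OutR, hd]
    have l1 := hp.strip.line hLL.mem_left hLL.mem_right hb
    have l2 := hp.strip.line hLL.mem_right hLL.mem_left hb.symm
    have a1 := hga k hkp hhi hb.1
    have a2 := hgb k hkp hhi hkb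
    grind
  by_cases hga' : g = a
  · subst hga'
    by_cases hkb : k = b
    · subst hkb
      by_cases hL : T.OutL q g k
      · exact hne (h.eq_of_good hq hg ⟨hgh, hgi, hhi, hgq, hhq, hL, hturn.1 hL⟩)
      · grind
    · grind
  · by_cases hkb : k = b
    · subst hkb
      grind
    · have hs := hq.isSeg (a := a) (b := k)
      have hb : T.Btw a g k := o1.resolve_left hga'
      have hs : T.IsSeg a k := hp.isSeg hLL.mem_left hkp hb.ne hLL.inner_left hhi
      have c1 := hX.closed hs hb
      have c2 := hX.coclosed hs hb
      grind

lemma UpperMark.not_sep (h : T.UpperMark X p a b) (hX : T.Biclosed X) (hq : T.IsArc q)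
    (hg : T.Good X q) (hne : q ≠ p) : ¬ T.Sep q a b := by
  rw [← mirror_sep hq h.turns.inner_left h.turns.inner_right]
  exact (mirror_lowerMark.2 h).not_sep hX.mirror ((mirror_isArc q).2 hq) (mirror_good.2 hg) hne

/-- The arc `p` is marked at `a` and `b`, which lie on different sides of `p`. -/
def Mark (T : PlaneTree V) (X : V → V → Prop) (p : Set V) (a b : V) : Prop :=
  T.LowerMark X p a b ∨ T.UpperMark X p a b

namespace Mark

lemma symm (h : T.Mark X p a b) : T.Mark X p b a := h.imp LowerMark.symm UpperMark.symm

lemma isArc (h : T.Mark X p a b) : T.IsArc p := h.elim (·.1) (·.1)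

lemma agrees_left (h : T.Mark X p a b) : T.Agrees X p a := h.elim (·.2) (·.2)

lemma agrees_right (h : T.Mark X p a b) : T.Agrees X p b := h.elim (·.3) (·.3)

lemma mem_left (h : T.Mark X p a b) : a ∈ p := h.elim (·.4.mem_left) (·.4.mem_left)

lemma mem_right (h : T.Mark X p a b) : b ∈ p := h.elim (·.4.mem_right) (·.4.mem_right)

lemma inner_left (h : T.Mark X p a b) : T.IsInner a := h.elim (·.4.inner_left) (·.4.inner_left)

lemma inner_right (h : T.Mark X p a b) : T.IsInner b := h.elim (·.4.inner_right) (·.4.inner_right)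

lemma ne (h : T.Mark X p a b) : a ≠ b := h.elim (·.4.ne) (·.4.ne)

lemma good (h : T.Mark X p a b) (hX : T.Biclosed X) : T.Good X p :=
  h.agrees_left.good hX h.isArc h.mem_left h.inner_left

lemma sep (h : T.Mark X p a b) : T.Sep p a b :=
  h.elim (fun h => h.4.sep h.1.strip) (fun h => h.4.sep h.1)

lemma not_sep (h : T.Mark X p a b) (hX : T.Biclosed X) (hq : T.IsArc q)
    (hg : T.Good X q) (hne : q ≠ p) : ¬ T.Sep q a b :=
  h.elim (fun h => h.not_sep hX hq hg hne) (fun h => h.not_sep hX hq hg hne)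

end Mark

/-- There is at most one mark on each side of an arc. -/
lemma Agrees.sep (hX : T.Biclosed X) (hp : T.IsArc p) (ha : a ∈ p) (hb : b ∈ p)
    (hai : T.IsInner a) (hbi : T.IsInner b) (h1 : T.Agrees X p a) (h2 : T.Agrees X p b)
    (hab : a ≠ b) : T.Mark X p a b := by
  have a1 := h1 b hb hbi hab.symm
  have a2 := h2 a ha hai hab
  have a3 := hX.iff (a := a) (b := b)
  have a4 := hp.outL_iff_not ha hb hbi hab
  have a5 := hp.outL_iff_not hb ha hai hab.symm
  by_cases h : X a b
  · exact Or.inl ⟨hp, h1, h2, hab, hai, hbi, ha, hb, by grind, by grind⟩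
  · exact Or.inr ⟨hp, h1, h2, hab, hai, hbi, ha, hb, by grind, by grind⟩

/-- Three marks would be pairwise separated by an arc that has only two sides. -/
lemma Mark.eq_or (h : T.Mark X p a b) (hX : T.Biclosed X) (h' : T.Agrees X p u) (hu : u ∈ p)
    (hui : T.IsInner u) : u = a ∨ u = b := by
  by_contra hcon
  push Not at hcon
  have h1 := (Agrees.sep hX h.isArc hu h.mem_left hui h.inner_left h' h.agrees_left hcon.1).sep
  have h2 := (Agrees.sep hX h.isArc hu h.mem_right hui h.inner_right h' h.agrees_right hcon.2).sep
  exact (sep_trans' h.isArc h.inner_left hui h.inner_right h1.symm).1 h.sep h2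

lemma Good.exists_agrees_side [Finite V] (hX : T.Biclosed X) (hp : T.IsArc p) (hg : T.Good X p)
    (hu : T.IsInner u) :
    ∃ v ∈ p, T.IsInner v ∧ T.Agrees X p v ∧ ¬ T.Sep p u v := by
  have hps := hp.strip.isPathSet
  obtain ⟨v, hv, hvi, hag, h⟩ := hg.exists_agrees hX hp (gate_mem hps u) (gate_inner hp hu)
  refine ⟨v, hv, hvi, hag, fun hs => ?_⟩
  unfold Sep at hs
  rw [gate_of_mem hps hv] at hs
  have := h hs.1.symm
  grind

lemma gate_eq_of_turns (hp : T.IsArc p) (hr : T.IsArc r) (hap : a ∈ p)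
    (har : a ∈ r) (hdp : T.dir a b ∈ p) (hdr : T.dir a b ∈ r)
    (h : ∀ w ∈ p, w ∈ r → T.IsInner w → w ≠ a → (T.OutL p a w ↔ T.OutL r a w)) :
    T.gate p b = T.gate r b := by
  have key : ∀ {p r : Set V}, T.IsArc p → T.IsArc r → a ∈ p → a ∈ r → T.dir a b ∈ p →
      T.dir a b ∈ r → (∀ w ∈ p, w ∈ r → T.IsInner w → w ≠ a → (T.OutL p a w ↔ T.OutL r a w)) →
      T.gate p b ∈ r := by
    intro p r hp hr hap har hdp hdr h
    by_contra hg
    have hps := hp.strip.isPathSet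
    have hgp := gate_mem hps b
    have hga : T.gate p b ≠ a := fun e => hg (e ▸ har)
    have hd : T.dir a (T.gate p b) = T.dir a b :=
      dir_eq_of_mem (path_comm b a ▸ gate_mem_path hps b hap) hga
    obtain ⟨g, hb, hgr, hgp', -, h1, h2⟩ := hr.diverge hp.strip har hap hgp hg (hd ▸ hdr)
    have h3 := h g hgp' hgr hb.inner hb.1
    have h4 := hr.outL_iff_not har hgr hb.inner hb.1.symm
    grind
  have h1 := key hp hr hap har hdp hdr h
  have h2 := key hr hp har hap hdr hdp fun w h1 h2 h3 h4 => (h w h2 h1 h3 h4).symm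
  exact path_inter (gate_mem_path hr.strip.isPathSet b h1) (gate_mem_path hp.strip.isPathSet b h2)
    (right_mem _ _)

/-- Of the arcs marked at the two corners adjacent to the direction from `a` to `b`, exactly one
separates `a` from `b`. -/
lemma sep_iff_not_sep (ha : T.IsInner a) (hbi : T.IsInner b) (hab : a ≠ b) (hp : T.IsArc p)
    (hr : T.IsArc r) (hpa : T.Agrees X p a) (hra : T.Agrees X r a) (hap : a ∈ p) (har : a ∈ r)
    (hp1 : T.dir a b ∈ p) (hp2 : T.rot a (T.dir a b) ∈ p) (hr1 : T.dir a b ∈ r)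
    (hr2 : (T.rot a).symm (T.dir a b) ∈ r) : T.Sep p a b ↔ ¬ T.Sep r a b := by
  -- Both arcs have their turns from `a` prescribed by `X`, so they run together to the common gate
  -- of `b`, with the same turn there but opposite turns at `a`.
  have hg := gate_eq_of_turns hp hr hap har hp1 hr1 fun w h1 h2 h3 h4 =>
    (hpa w h1 h3 h4).symm.trans (hra w h2 h3 h4)
  have hps := hp.strip.isPathSet
  have hrs := hr.strip.isPathSet
  have hga : T.gate p b ≠ a := by
    intro e
    rcases gate_eq_or_dir_notMem hps b with e' | e'
    · exact hab (e.symm.trans e')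
    · rw [e] at e'
      exact e' hp1
  have hd : T.dir a (T.gate p b) = T.dir a b :=
    dir_eq_of_mem (path_comm b a ▸ gate_mem_path hps b hap) hga
  have hgi := gate_inner hp hbi
  have h1 := hpa _ (gate_mem hps b) hgi hga
  have h2 := hra _ (hg ▸ gate_mem hrs b) hgi hga
  have h3 : T.OutR p (T.gate p b) a := by rw [OutR, hd]; exact hp2
  have h4 : T.OutL r (T.gate p b) a := by rw [OutL, hd]; exact hr2
  have h5 := hp.outL_iff_not (gate_mem hps b) hap ha hga
  unfold Sep
  rw [gate_of_mem hps hap, gate_of_mem hrs har, ← hg]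
  grind

end Sides

/-! ### Connectedness of the labels -/

section LabelTree

variable {T : PlaneTree V} {X : V → V → Prop} {p q r s : Set V} {a b c u v w x z : V}

lemma exists_agrees_sep [Finite V] (ha : T.IsInner a) (hb : T.IsInner b)
    (hab : a ≠ b) : ∃ p, T.IsArc p ∧ a ∈ p ∧ T.Agrees X p a ∧ T.Sep p a b := by
  have hadj := adj_dir (T := T) hab
  obtain ⟨p, hp, h1, h2, h3, h4⟩ := exists_arc ha hadj (X a)
  obtain ⟨r, hr, k1, k2, k3, k4⟩ := exists_arc ha (rot_symm_adj hadj) (X a)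
  rw [Equiv.apply_symm_apply] at k3
  have := sep_iff_not_sep ha hb hab hp hr h4 k4 h1 k1 h2 h3 k3 k2
  by_cases hs : T.Sep p a b
  · exact ⟨p, hp, h1, h4, hs⟩
  · exact ⟨r, hr, k1, k4, not_not.1 fun h => hs (this.2 h)⟩

/-- Any two interior vertices are joined by a sequence of labels. -/
lemma marks_connected [Finite V] (hX : T.Biclosed X) (hu : T.IsInner u) (hv : T.IsInner v) :
    Relation.ReflTransGen (fun a b => ∃ p, T.Mark X p a b) u v := by
  -- Induct on the number of compatible arcs separating `u` from `v`. Moving along the label of a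
  -- separating arc marked at `u` brings `u` to the other side of this arc, and of no other.
  induction hk : {q | T.IsArc q ∧ T.Good X q ∧ T.Sep q u v}.ncard using
    Nat.strong_induction_on generalizing u with
  | _ k ih =>
  by_cases huv : u = v
  · rw [huv]
  obtain ⟨p, hp, hup, hag, hs⟩ := exists_agrees_sep (X := X) hu hv huv
  have hg := hag.good hX hp hup hu
  obtain ⟨b, hbp, hbi, hb1, hb2⟩ := hg.exists_agrees_side hX hp hv
  have hub : u ≠ b := by
    rintro rfl
    exact hb2 hs.symm
  have hm := Agrees.sep hX hp hup hbp hu hbi hag hb1 hub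
  refine Relation.ReflTransGen.head ⟨p, hm⟩ (ih _ ?_ hbi rfl)
  rw [← hk]
  refine Set.ncard_lt_ncard ⟨?_, fun hsub => ?_⟩ (Set.toFinite _)
  · rintro q ⟨h1, h2, h3⟩
    refine ⟨h1, h2, ?_⟩
    by_cases hqp : q = p
    · subst hqp; exact hs
    · exact (sep_trans h1 hu hbi hv (hm.not_sep hX h1 h2 hqp)).2 h3
  · exact hb2 (hsub ⟨hp, hg, hs⟩).2.2.symm

end LabelTree

/-! ### Noncrossing coloured segments in terms of turns -/

section Curves

variable {T : PlaneTree V} {κ κ' : SegColor} {s t : Set V} {a b c e f h u v w : V}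

/-- What the curve of a coloured segment does at `f`, coming from `e`. -/
noncomputable def exit (T : PlaneTree V) (x : SegColor × Set V) (e f : V) : ℕ :=
  T.exitPos x (T.dir f e) f

/-- The position in which curves of a given colour end. -/
def endPos : SegColor → ℕ
  | SegColor.red => 1
  | SegColor.green => 2

lemma exit_spec (T : PlaneTree V) (κ : SegColor) (s : Set V) (e f : V) :
    (T.OutL s e f ∧ T.exit (κ, s) e f = 0) ∨
    (¬ T.OutL s e f ∧ T.OutR s e f ∧ T.exit (κ, s) e f = 3) ∨
    (¬ T.OutL s e f ∧ ¬ T.OutR s e f ∧ T.exit (κ, s) e f = endPos κ) := by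
  unfold exit exitPos OutL OutR
  by_cases h1 : (T.rot f).symm (T.dir f e) ∈ s
  · simp [h1]
  · by_cases h2 : T.rot f (T.dir f e) ∈ s
    · simp [h1, h2]
    · cases κ <;> simp [h1, h2, endPos]

lemma IsSegment.isEndpoint_iff (hs : T.IsSegment s) (he : e ∈ s) (hf : f ∈ s) (hef : e ≠ f) :
    T.IsEndpoint s f ↔ ¬ T.OutL s e f ∧ ¬ T.OutR s e f := by
  constructor
  · rintro ⟨w, rfl⟩
    exact not_out_left (hs.inner hf) he hef
  · intro h
    obtain ⟨a, b, hab, rfl⟩ := isSegment_iff.1 hs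
    rw [endpoint_iff]
    rcases btw_or_eq_of_mem hf with h1 | h1 | h1
    · exact Or.inl h1
    · exact Or.inr h1
    exfalso
    have hst := hab.strip
    have hfa := hst.isPathSet.dir_mem hf (left_mem a b)
    have hfb := hst.isPathSet.dir_mem hf (right_mem a b)
    have hd := hst.isPathSet.adj_mem (left_mem a b) (right_mem a b) h1.2.2 h1.1 h1.2.1
      (hst.isPathSet.dir_mem hf he) (adj_dir hef.symm)
    unfold OutL OutR at h
    rcases hst.turn (left_mem a b) (right_mem a b) h1 with k | k <;> rcases hd with d | d
    · exact h.2 (by rw [d, k]; exact hfb)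
    · exact h.1 (by rw [d, ← k, Equiv.symm_apply_apply]; exact hfa)
    · exact h.1 (by rw [d, ← k, Equiv.symm_apply_apply]; exact hfb)
    · exact h.2 (by rw [d, k]; exact hfa)

lemma IsSegment.eq_path (hs : T.IsSegment s) (he : T.IsEndpoint s e) (hf : T.IsEndpoint s f)
    (hef : e ≠ f) : s = T.path e f := by
  obtain ⟨a, b, hab, rfl⟩ := isSegment_iff.1 hs
  rw [endpoint_iff] at he hf
  rw [path_eq_iff]
  grind

lemma IsSegment.not_out_both (hs : T.IsSegment s) (he : e ∈ s) (hf : f ∈ s) (hef : e ≠ f) :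
    ¬ (T.OutL s e f ∧ T.OutR s e f) := by
  rintro ⟨h1, h2⟩
  have hend := hs.isEndpoint_iff he hf hef
  obtain ⟨a, b, hab, rfl⟩ := isSegment_iff.1 hs
  rw [endpoint_iff] at hend
  have hfi := hs.inner hf
  rcases btw_or_eq_of_mem hf with h' | h' | h'
  · exact (hend.1 (Or.inl h')).1 h1
  · exact (hend.1 (Or.inr h')).1 h1
  have hadj := adj_dir (T := T) hef.symm
  have hp := hab.strip.isPathSet
  have k1 := hp.adj_mem (left_mem a b) (right_mem a b) h'.2.2 h'.1 h'.2.1 h1 (rot_symm_adj hadj)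
  have k2 := hp.adj_mem (left_mem a b) (right_mem a b) h'.2.2 h'.1 h'.2.1 h2 (rot_adj hadj)
  have k3 := hp.adj_mem (left_mem a b) (right_mem a b) h'.2.2 h'.1 h'.2.1
    (hp.dir_mem hf he) hadj
  have n1 := rot_ne hfi hadj
  have n2 := rot_symm_ne hfi hadj
  have n3 := rot_symm_ne_rot hfi hadj
  grind

/-- The last common vertex of two segments in a given direction. -/
lemma exists_last [Finite V] (hs : T.IsSegment s) (hv : v ∈ s) (hv' : v ∈ t)
    (hw : w ∈ s) (hw' : w ∈ t) (hvw : v ≠ w) :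
    ∃ h, h ∈ s ∧ h ∈ t ∧ w ∈ T.path v h ∧ h ≠ v ∧ ¬ (T.OutL s v h ∧ T.OutL t v h) ∧
      ¬ (T.OutR s v h ∧ T.OutR t v h) := by
  let S : Set V := {h | h ∈ s ∧ h ∈ t ∧ w ∈ T.path v h}
  obtain ⟨h, ⟨h1, h2, h3⟩, hmax⟩ := (Set.toFinite S).exists_maximalFor
    (fun z => (T.path v z).ncard) _ ⟨w, hw, hw', right_mem _ _⟩
  have hne : h ≠ v := by
    rintro rfl
    rw [path_self] at h3
    exact hvw h3.symm
  have hhi := hs.inner h1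
  have hadj := adj_dir (T := T) hne
  have key : ∀ n, T.graph.Adj h n → n ≠ T.dir h v → ¬ (n ∈ s ∧ n ∈ t) := by
    rintro n hn hnv ⟨hns, hnt⟩
    have hb : T.Btw v h n := btw_iff.2 ⟨hne, hn.ne, by rw [dir_of_adj hn]; exact hnv.symm⟩
    have := hmax (j := n) ⟨hns, hnt, path_subset_left hb.2.2 h3⟩
    have hlt : (T.path v h).ncard < (T.path v n).ncard := by
      refine Set.ncard_lt_ncard ⟨path_subset_left hb.2.2, fun h' => ?_⟩ (path_finite _ _)
      exact hb.2.1 (path_inter hb.2.2 (h' (right_mem v n)) (right_mem _ _)).symm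
    exact absurd (this hlt.le) (not_le.2 hlt)
  exact ⟨h, h1, h2, h3, hne, key _ (rot_symm_adj hadj) (rot_symm_ne hhi hadj),
    key _ (rot_adj hadj) (rot_ne hhi hadj)⟩

lemma isEndCorner_dir (hs : T.IsEndpoint s f) (hd : T.dir f e ∈ s) (hfi : T.IsInner f)
    (hef : e ≠ f) : T.IsEndCorner (SegColor.green, s) ⟨f, T.dir f e, hfi, adj_dir hef.symm⟩ ∧
    T.IsEndCorner (SegColor.red, s)
      ⟨f, (T.rot f).symm (T.dir f e), hfi, rot_symm_adj (adj_dir hef.symm)⟩ := by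
  refine ⟨⟨hs, hd⟩, ⟨hs, ?_⟩⟩
  change T.rot f ((T.rot f).symm (T.dir f e)) ∈ s
  rwa [Equiv.apply_symm_apply]

lemma exists_common_corner (hs : T.IsEndpoint s f) (ht : T.IsEndpoint t f) (hds : T.dir f e ∈ s)
    (hdt : T.dir f e ∈ t) (hfi : T.IsInner f) (hef : e ≠ f) :
    ∃ c, T.IsEndCorner (κ, s) c ∧ T.IsEndCorner (κ, t) c := by
  have h1 := isEndCorner_dir hs hds hfi hef
  have h2 := isEndCorner_dir ht hdt hfi hef
  cases κ
  · exact ⟨_, h1.2, h2.2⟩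
  · exact ⟨_, h1.1, h2.1⟩

lemma IsDrawing.iff_along {x y : SegColor × Set V} {L : V → V → Prop} (hL : T.IsDrawing x y L)
    (hx : T.IsPathSet x.2) (hy : T.IsPathSet y.2) {a b : V} (ha : a ∈ x.2) (hb : b ∈ x.2)
    (ha' : a ∈ y.2) (hb' : b ∈ y.2) (hab : a ≠ b) : L a (T.dir a b) ↔ L (T.dir b a) b := by
  induction hk : (T.path a b).ncard using Nat.strong_induction_on generalizing a with
  | _ k ih =>
  have hadj := adj_dir (T := T) hab
  by_cases hm : T.dir a b = b
  · rw [hm, dir_of_adj (hm ▸ hadj).symm]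
  have hbm : T.Btw a (T.dir a b) b := ⟨hadj.ne', hm, dir_mem⟩
  have h1 := hx.dir_mem ha hb
  have h2 := hy.dir_mem ha' hb'
  rw [← hbm.dir_right, ← ih _ ?_ h1 h2 hm rfl]
  · refine hL.turn _ _ _ hadj (adj_dir hm) ?_ ha h1 (hx.dir_mem h1 hb) ha' h2 (hy.dir_mem h2 hb')
    have := hbm.dir_ne
    rwa [dir_of_adj hadj.symm] at this
  · rw [← hk]
    refine Set.ncard_lt_ncard ⟨path_subset_right dir_mem, fun h' => ?_⟩ (path_finite _ _)
    exact notMem_path_dir hab (h' (left_mem _ _))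

lemma mem_path_of_beyond (hvw : T.graph.Adj v w) (h1 : w ∈ T.path v b) (h2 : b ≠ v)
    (h3 : v ∈ T.path w c) (h4 : c ≠ w) : v ∈ T.path b c ∧ w ∈ T.path b c := by
  have key : ∀ {v w b c : V}, T.graph.Adj v w → w ∈ T.path v b → b ≠ v → v ∈ T.path w c →
      v ∈ T.path b c := by
    intro v w b c hvw h1 h2 h3
    by_cases hvc : v = c
    · rw [hvc]; exact right_mem _ _
    refine mem_path_of_dir_ne h2.symm hvc ?_
    rw [← dir_eq_of_mem h1 hvw.ne']
    exact dir_ne_of_mem hvw.ne h3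
  exact ⟨key hvw h1 h2 h3, path_comm c b ▸ key hvw.symm h3 h4 h1⟩

/-- Two coloured segments are noncrossing if and only if they do not end in the same corner, and
neither leaves a common part on the left of the other at both ends. -/
lemma noncrossing_iff [Finite V] (hs : T.IsSegment s) (ht : T.IsSegment t) :
    T.Noncrossing (κ, s) (κ', t) ↔
      (∀ c : T.Corner, ¬ (T.IsEndCorner (κ, s) c ∧ T.IsEndCorner (κ', t) c)) ∧
      ∀ e f, e ≠ f → e ∈ s → f ∈ s → e ∈ t → f ∈ t →
        ¬ (T.exit (κ, s) e f < T.exit (κ', t) e f ∧ T.exit (κ, s) f e < T.exit (κ', t) f e) ∧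
        ¬ (T.exit (κ', t) e f < T.exit (κ, s) e f ∧ T.exit (κ', t) f e < T.exit (κ, s) f e) := by
  refine and_congr_right fun hcor => ?_
  have hsp := hs.strip.isPathSet
  have htp := ht.strip.isPathSet
  constructor
  · rintro ⟨L, hL⟩ e f hef he hf he' hf'
    have h1 := hL.iff_along hsp htp he hf he' hf' hef
    have a1 := adj_dir (T := T) hef
    have a2 := adj_dir (T := T) hef.symm
    have m1 := hsp.dir_mem he hf
    have m2 := hsp.dir_mem hf he
    have m3 := htp.dir_mem he' hf'
    have m4 := htp.dir_mem hf' he'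
    have h2 := hL.swap _ _ a1 he m1 he' m3
    have h3 := hL.left _ _ a1.symm m1 he m3 he'
    have h4 := hL.left _ _ a2.symm m2 hf m4 hf'
    have h5 := hL.right _ _ a1.symm m1 he m3 he'
    have h6 := hL.right _ _ a2.symm m2 hf m4 hf'
    unfold exit
    exact ⟨fun ⟨k1, k2⟩ => h2.1 (h1.2 (h4 k1)) (h3 k2),
      fun ⟨k1, k2⟩ => h6 k1 (h1.1 (h2.2 (h5 k2)))⟩
  · intro hno
    -- While both segments continue along the same two edges, they exit in the same position.
    have hcont : ∀ {u v w}, T.graph.Adj u v → T.graph.Adj v w → u ≠ w → u ∈ s → v ∈ s → w ∈ s →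
        u ∈ t → v ∈ t → w ∈ t → T.exit (κ, s) u v = T.exit (κ', t) u v := by
      intro u v w huv hvw huw h1 h2 h3 h4 h5 h6
      have hb : T.Btw u v w := btw_iff.2 ⟨huv.ne', hvw.ne, by
        rw [dir_of_adj huv.symm, dir_of_adj hvw]; exact huw⟩
      have k1 := hs.strip.outL_iff h1 h3 hb
      have k2 := ht.strip.outL_iff h4 h6 hb
      have k3 := hs.strip.outR_iff h1 h3 hb
      have k4 := ht.strip.outR_iff h4 h6 hb
      have k5 := hs.strip.turn h1 h3 hb
      have k6 := exit_spec T κ s u v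
      have k7 := exit_spec T κ' t u v
      grind
    have hcont' : ∀ {u v b}, T.Btw u v b → u ∈ s → b ∈ s → u ∈ t → b ∈ t →
        T.exit (κ, s) u v = T.exit (κ', t) u v := by
      intro u v b hb h1 h2 h3 h4
      have m1 := hs.strip.btw_mem h1 h2 hb
      have m2 := ht.strip.btw_mem h3 h4 hb
      have := hcont (adj_dir hb.1).symm (adj_dir hb.2.1) hb.dir_ne (hsp.dir_mem m1 h1) m1
        (hsp.dir_mem m1 h2) (htp.dir_mem m2 h3) m2 (htp.dir_mem m2 h4)
      unfold exit at this ⊢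
      rwa [dir_of_adj (adj_dir hb.1)] at this
    -- At the last common vertex the exits differ: two equal turns would prolong the common part,
    -- and two ends of one colour would share a corner.
    have hend : ∀ {v w}, v ≠ w → v ∈ s → w ∈ s → v ∈ t → w ∈ t → ∃ h, h ∈ s ∧ h ∈ t ∧
        w ∈ T.path v h ∧ h ≠ v ∧ T.exit (κ, s) v h ≠ T.exit (κ', t) v h := by
      intro v w hvw h1 h2 h3 h4
      obtain ⟨h, k1, k2, k3, k4, k5, k6⟩ := exists_last hs h1 h3 h2 h4 hvw
      refine ⟨h, k1, k2, k3, k4, fun heq => ?_⟩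
      have e1 := exit_spec T κ s v h
      have e2 := exit_spec T κ' t v h
      have e3 := hs.isEndpoint_iff h1 k1 k4.symm
      have e4 := ht.isEndpoint_iff h3 k2 k4.symm
      have key : κ = κ' → T.IsEndpoint s h → T.IsEndpoint t h → False := by
        rintro rfl i1 i2
        obtain ⟨c, hc⟩ := exists_common_corner (κ := κ) i1 i2 (hsp.dir_mem k1 h1)
          (htp.dir_mem k2 h3) (hs.inner k1) k4.symm
        exact hcor c hc
      cases κ <;> cases κ' <;> simp only [endPos, reduceCtorEq, IsEmpty.forall_iff] at e1 e2 key
        <;> grind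
    -- Place the strand of `s` on the left exactly when, at some common vertex ahead, `s` exits to
    -- the left of `t`.
    refine ⟨fun v w => ∃ b, b ∈ s ∧ b ∈ t ∧ w ∈ T.path v b ∧ b ≠ v ∧
      T.exit (κ, s) v b < T.exit (κ', t) v b, ?_, ?_, ?_, ?_⟩
    · intro v w hvw h1 h2 h3 h4
      constructor
      · rintro ⟨b, b1, b2, b3, b4, b5⟩ ⟨b', c1, c2, c3, c4, c5⟩
        obtain ⟨d1, d2⟩ := mem_path_of_beyond hvw b3 b4 c3 c4
        have e1 := dir_eq_of_mem d1 b4.symm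
        have e2 := dir_eq_of_mem (path_comm b b' ▸ d2) c4.symm
        have hne : b ≠ b' := by
          rintro rfl
          rw [path_self] at d1
          exact b4 d1.symm
        unfold exit at b5 c5
        rw [e1] at b5
        rw [e2] at c5
        exact (hno b b' hne b1 c1 b2 c2).1 ⟨c5, b5⟩
      · intro hnL
        obtain ⟨b, b1, b2, b3, b4, b5⟩ := hend hvw.ne h1 h2 h3 h4
        obtain ⟨b', c1, c2, c3, c4, c5⟩ := hend hvw.ne' h2 h1 h4 h3
        refine ⟨b, b1, b2, b3, b4, ?_⟩
        have c6 : ¬ T.exit (κ, s) w b' < T.exit (κ', t) w b' :=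
          fun h => hnL ⟨b', c1, c2, c3, c4, h⟩
        obtain ⟨d1, d2⟩ := mem_path_of_beyond hvw b3 b4 c3 c4
        have e1 := dir_eq_of_mem d1 b4.symm
        have e2 := dir_eq_of_mem (path_comm b b' ▸ d2) c4.symm
        have hne : b ≠ b' := by
          rintro rfl
          rw [path_self] at d1
          exact b4 d1.symm
        have := (hno b b' hne b1 c1 b2 c2).2
        unfold exit at *
        rw [e1] at b5 ⊢
        rw [e2] at c5 c6
        omega
    · intro u v w huv hvw huw h1 h2 h3 h4 h5 h6
      have hvu := dir_of_adj huv.symm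
      constructor
      · rintro ⟨b, b1, b2, b3, b4, b5⟩
        have hbv : b ≠ v := by
          rintro rfl
          exact b5.ne (hcont huv hvw huw h1 h2 h3 h4 h5 h6)
        have hb : T.Btw u v b := ⟨huv.ne', hbv.symm, b3⟩
        have hw : w = T.dir v b := by
          have := hsp.adj_mem h1 b1 b3 huv.ne' hbv.symm h3 hvw
          rw [hvu] at this
          exact this.resolve_left huw.symm
        refine ⟨b, b1, b2, hw ▸ dir_mem, hbv, ?_⟩
        unfold exit at *
        rwa [hb.dir_right]
      · rintro ⟨b, b1, b2, b3, b4, b5⟩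
        have hb : T.Btw u v b := btw_iff.2 ⟨huv.ne', b4.symm, by
          rw [hvu, ← dir_eq_of_mem b3 hvw.ne', dir_of_adj hvw]
          exact huw⟩
        refine ⟨b, b1, b2, hb.2.2, hb.ne.symm, ?_⟩
        unfold exit at *
        rwa [← hb.dir_right]
    · intro v w hvw h1 h2 h3 h4 hlt
      refine ⟨w, h2, h4, right_mem _ _, hvw.ne', ?_⟩
      unfold exit
      rwa [dir_of_adj hvw.symm]
    · rintro v w hvw h1 h2 h3 h4 hlt ⟨b, b1, b2, b3, b4, b5⟩
      have hlt' : T.exit (κ', t) v w < T.exit (κ, s) v w := by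
        unfold exit
        rwa [dir_of_adj hvw.symm]
      by_cases hbw : b = w
      · subst hbw
        exact lt_asymm b5 hlt'
      · exact hlt'.ne' (hcont' ⟨hvw.ne', Ne.symm hbw, b3⟩ h1 b1 h3 b2)

lemma Noncrossing.symm [Finite V] (hs : T.IsSegment s) (ht : T.IsSegment t)
    (h : T.Noncrossing (κ, s) (κ', t)) : T.Noncrossing (κ', t) (κ, s) := by
  rw [noncrossing_iff hs ht] at h
  rw [noncrossing_iff ht hs]
  exact ⟨fun c hc => h.1 c hc.symm, fun e f k1 k2 k3 k4 k5 => (h.2 e f k1 k4 k5 k2 k3).symm⟩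

/-- At both ends of a common part, `s` ends or turns left, and `t` ends or turns right. -/
structure Overlap (T : PlaneTree V) (s t : Set V) (e f : V) : Prop where
  ne : e ≠ f
  left_mem_left : e ∈ s
  right_mem_left : f ∈ s
  left_mem_right : e ∈ t
  right_mem_right : f ∈ t
  not_outR_right : ¬ T.OutR s e f
  not_outR_left : ¬ T.OutR s f e
  not_outL_right : ¬ T.OutL t e f
  not_outL_left : ¬ T.OutL t f e

lemma mirror_overlap : T.mirror.Overlap s t e f ↔ T.Overlap t s e f :=
  ⟨fun h => ⟨h.1, h.4, h.5, h.2, h.3, h.8, h.9, h.6, h.7⟩,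
    fun h => ⟨h.1, h.4, h.5, h.2, h.3, h.8, h.9, h.6, h.7⟩⟩

lemma mirror_isSegment : T.mirror.IsSegment s ↔ T.IsSegment s := by
  rw [isSegment_iff, isSegment_iff]
  simp only [mirror_isSeg, mirror_path]

lemma endPos_cases (κ : SegColor) : endPos κ = 1 ∨ endPos κ = 2 := by cases κ <;> simp [endPos]

/-- For equal colours both curves end in the same position, between the two turns, so an overlap is
a strict order at both ends or involves a shared corner. Conversely, from a shared corner follow
both segments to their last common vertex: the one exiting further left there overlaps the other,
unless both end and are equal. -/
lemma noncrossing_same_iff [Finite V] (hs : T.IsSegment s) (ht : T.IsSegment t) (hne : s ≠ t) :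
    T.Noncrossing (κ, s) (κ, t) ↔ ∀ e f, ¬ T.Overlap s t e f ∧ ¬ T.Overlap t s e f := by
  rw [noncrossing_iff hs ht]
  have hsp := hs.strip.isPathSet
  have htp := ht.strip.isPathSet
  have hκ := endPos_cases κ
  constructor
  · rintro ⟨hcor, hno⟩
    have key : ∀ e f, e ≠ f → e ∈ s → f ∈ s → e ∈ t → f ∈ t → ¬ T.OutL s e f → ¬ T.OutR s e f →
        ¬ T.OutL t e f → ¬ T.OutR t e f → False := by
      intro e f hef h1 h2 h3 h4 k1 k2 k3 k4
      obtain ⟨c, hc⟩ := exists_common_corner (κ := κ) ((hs.isEndpoint_iff h1 h2 hef).2 ⟨k1, k2⟩)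
        ((ht.isEndpoint_iff h3 h4 hef).2 ⟨k3, k4⟩) (hsp.dir_mem h2 h1) (htp.dir_mem h4 h3)
        (hs.inner h2) hef
      exact hcor c hc
    intro e f
    have s1 := exit_spec T κ s e f
    have s2 := exit_spec T κ s f e
    have t1 := exit_spec T κ t e f
    have t2 := exit_spec T κ t f e
    constructor
    · rintro ⟨hef, h1, h2, h3, h4, k1, k2, k3, k4⟩
      have := hno e f hef h1 h2 h3 h4
      have := key e f hef h1 h2 h3 h4
      have := key f e hef.symm h2 h1 h4 h3
      grind
    · rintro ⟨hef, h3, h4, h1, h2, k3, k4, k1, k2⟩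
      have := hno e f hef h1 h2 h3 h4
      have := key e f hef h1 h2 h3 h4
      have := key f e hef.symm h2 h1 h4 h3
      grind
  · intro hno
    constructor
    · rintro ⟨v, n, hvi, hn⟩ ⟨⟨h1, k1⟩, ⟨h2, k2⟩⟩
      dsimp only at h1 h2 k1 k2
      have hv1 : v ∈ s := by obtain ⟨w, rfl⟩ := h1; exact left_mem _ _
      have hv2 : v ∈ t := by obtain ⟨w, rfl⟩ := h2; exact left_mem _ _
      obtain ⟨m, hm, hms, hmt⟩ : ∃ m, T.graph.Adj v m ∧ m ∈ s ∧ m ∈ t := by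
        cases κ
        · exact ⟨_, rot_adj hn, k1, k2⟩
        · exact ⟨_, hn, k1, k2⟩
      obtain ⟨h, b1, b2, b3, b4, b5, b6⟩ := exists_last hs hv1 hv2 hms hmt hm.ne
      have e1 := (hs.isEndpoint_iff b1 hv1 b4).1 h1
      have e2 := (ht.isEndpoint_iff b2 hv2 b4).1 h2
      have e3 := hs.isEndpoint_iff hv1 b1 b4.symm
      have e4 := ht.isEndpoint_iff hv2 b2 b4.symm
      have n1 := hs.not_out_both hv1 b1 b4.symm
      have n2 := ht.not_out_both hv2 b2 b4.symm
      have o1 := fun k1 k3 => (hno v h).1 ⟨b4.symm, hv1, b1, hv2, b2, k1, e1.2, k3, e2.1⟩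
      have o2 := fun k1 k3 => (hno v h).2 ⟨b4.symm, hv2, b2, hv1, b1, k1, e2.2, k3, e1.1⟩
      have : T.IsEndpoint s h ∧ T.IsEndpoint t h := by grind
      exact hne ((hs.eq_path h1 this.1 b4.symm).trans (ht.eq_path h2 this.2 b4.symm).symm)
    · intro e f hef h1 h2 h3 h4
      have s1 := exit_spec T κ s e f
      have s2 := exit_spec T κ s f e
      have t1 := exit_spec T κ t e f
      have t2 := exit_spec T κ t f e
      have n1 := hs.not_out_both h1 h2 hef
      have n2 := hs.not_out_both h2 h1 hef.symm
      have n3 := ht.not_out_both h3 h4 hef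
      have n4 := ht.not_out_both h4 h3 hef.symm
      have o1 := fun a b c d => (hno e f).1 ⟨hef, h1, h2, h3, h4, a, b, c, d⟩
      have o2 := fun a b c d => (hno e f).2 ⟨hef, h3, h4, h1, h2, a, b, c, d⟩
      grind

/-- The criterion for equal colours does not mention the colour, and reflection merely exchanges the
roles of the two segments in an overlap. -/
lemma noncrossing_mirror [Finite V] (hs : T.IsSegment s) (ht : T.IsSegment t) (hne : s ≠ t) :
    T.mirror.Noncrossing (κ, s) (κ, t) ↔ T.Noncrossing (κ', s) (κ', t) := by
  rw [noncrossing_same_iff hs ht hne,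
    noncrossing_same_iff (mirror_isSegment.2 hs) (mirror_isSegment.2 ht) hne]
  simp only [mirror_overlap]
  exact forall₂_congr fun _ _ => and_comm

/-- A red segment does not cross a green one from left to right. -/
lemma Noncrossing.not_overlap [Finite V] (hs : T.IsSegment s) (ht : T.IsSegment t)
    (h : T.Noncrossing (SegColor.red, s) (SegColor.green, t)) : ¬ T.Overlap s t e f := by
  -- At both ends the red segment exits in position 0 or 1 and the green one in position 2 or 3.
  rintro ⟨hef, h1, h2, h3, h4, k1, k2, k3, k4⟩
  have := ((noncrossing_iff hs ht).1 h).2 e f hef h1 h2 h3 h4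
  have s1 := exit_spec T SegColor.red s e f
  have s2 := exit_spec T SegColor.red s f e
  have t1 := exit_spec T SegColor.green t e f
  have t2 := exit_spec T SegColor.green t f e
  simp only [endPos] at s1 s2 t1 t2
  grind

end Curves

/-! ### Labels of a facet are noncrossing -/

section LabelCurves

variable {T : PlaneTree V} {X : V → V → Prop} {p q r s t : Set V} {a b c d e f u v w n : V}

lemma LowerMark.isSegment (h : T.LowerMark X p a b) : T.IsSegment (T.path a b) :=
  isSegment_iff.2 ⟨a, b, h.isSeg, rfl⟩

lemma UpperMark.isSegment (h : T.UpperMark X p a b) : T.IsSegment (T.path a b) :=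
  mirror_isSegment.1 (mirror_lowerMark.2 h).isSegment

lemma LowerMark.subset (h : T.LowerMark X p a b) : T.path a b ⊆ p :=
  h.isArc.strip.path_subset h.turns.mem_left h.turns.mem_right

lemma UpperMark.subset (h : T.UpperMark X p a b) : T.path a b ⊆ p :=
  h.isArc.strip.path_subset h.turns.mem_left h.turns.mem_right

lemma Agrees.eq_of_corner (h1 : T.Agrees X p v) (h2 : T.Agrees X q v) (hp : T.IsArc p)
    (hq : T.IsArc q) (hv : T.IsInner v) (hn : T.graph.Adj v n) (hvp : v ∈ p) (hvq : v ∈ q)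
    (hnp : n ∈ p) (hnq : n ∈ q) (hrp : T.rot v n ∈ p) (hrq : T.rot v n ∈ q) : p = q :=
  hp.eq_of_turns hq hv hn hvp hvq hnp hnq hrp hrq fun w k1 k2 k3 k4 =>
    (h1 w k1 k3 k4).symm.trans (h2 w k2 k3 k4)

/-- At the points where a lower label stops, the arc that carries it turns left and is marked.
Curves of labels can thus be compared through the turns of their arcs. -/
lemma LowerMark.out_of_end (h : T.LowerMark X p a b) (he : e ∈ T.path a b) (hf : f ∈ T.path a b)
    (hef : e ≠ f) (hL : ¬ T.OutL (T.path a b) e f) (hR : ¬ T.OutR (T.path a b) e f) :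
    T.OutL p e f ∧ T.Agrees X p f ∧ (f = a ∨ f = b) := by
  have hend := (h.isSegment.isEndpoint_iff he hf hef).2 ⟨hL, hR⟩
  rcases endpoint_iff.1 hend with rfl | rfl
  · refine ⟨?_, h.agrees_left, Or.inl rfl⟩
    rw [OutL, dir_eq_of_mem he hef]
    exact h.turns.out_left
  · refine ⟨?_, h.agrees_right, Or.inr rfl⟩
    rw [path_comm] at he
    rw [OutL, dir_eq_of_mem he hef]
    exact h.turns.out_right

lemma UpperMark.out_of_end (h : T.UpperMark X p a b) (he : e ∈ T.path a b) (hf : f ∈ T.path a b)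
    (hef : e ≠ f) (hL : ¬ T.OutL (T.path a b) e f) (hR : ¬ T.OutR (T.path a b) e f) :
    T.OutR p e f ∧ T.Agrees X p f ∧ (f = a ∨ f = b) := by
  obtain ⟨h1, h2, h3⟩ := (mirror_lowerMark.2 h).out_of_end he hf hef hR hL
  exact ⟨h1, (mirror_agrees h.isArc (h.subset hf)).1 h2, h3⟩

lemma Mark.eq_of_eq (h : T.Mark X p a b) (h' : T.Mark X p c d) (hX : T.Biclosed X) :
    T.path a b = T.path c d := by
  have h1 := h'.eq_or hX h.agrees_left h.mem_left h.inner_left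
  have h2 := h'.eq_or hX h.agrees_right h.mem_right h.inner_right
  have h3 := h.ne
  rw [path_eq_iff]
  grind

/-- On an overlap `p` turns left at both ends, so `[e, f]` is in `X`. Then `q` cannot turn right at
both ends, nor at one end when the other is a mark of `q`. So the second label ends at both `e` and
`f`, and `p` turns left at its ends, which forces `p = q`. -/
lemma LowerMark.eq_of_overlap (hX : T.Biclosed X) (h : T.LowerMark X p a b)
    (h' : T.LowerMark X q c d) (ho : T.Overlap (T.path a b) (T.path c d) e f) :
    T.path a b = T.path c d := by
  obtain ⟨hef, h1, h2, h3, h4, k1, k2, k3, k4⟩ := ho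
  have s1 := h.out_of_end h1 h2 hef
  have s2 := h.out_of_end h2 h1 hef.symm
  have t1 := h'.out_of_end h3 h4 hef
  have t2 := h'.out_of_end h4 h3 hef.symm
  have sL1 : T.OutL (T.path a b) e f → T.OutL p e f := fun k => h.subset k
  have sL2 : T.OutL (T.path a b) f e → T.OutL p f e := fun k => h.subset k
  have tR1 : T.OutR (T.path c d) e f → T.OutR q e f := fun k => h'.subset k
  have tR2 : T.OutR (T.path c d) f e → T.OutR q f e := fun k => h'.subset k
  have hei := h.isSegment.inner h1
  have hfi := h.isSegment.inner h2
  have hp := h.isArc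
  have hq := h'.isArc
  have hpg := h.agrees_left.good hX hp h.turns.mem_left h.turns.inner_left
  have hqg := h'.agrees_left.good hX hq h'.turns.mem_left h'.turns.inner_left
  have m3 := h'.subset h3
  have m4 := h'.subset h4
  have n3 := hq.outL_iff_not m3 m4 hfi hef
  have n4 := hq.outL_iff_not m4 m3 hei hef.symm
  have hLL : T.LL p e f := ⟨hef, hei, hfi, h.subset h1, h.subset h2, by grind, by grind⟩
  have hXef := hpg.1 e f hLL
  have g2 := fun k k' => hqg.2 e f ⟨hef, hei, hfi, m3, m4, k, k'⟩
  have hXs := hX.iff (a := e) (b := f)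
  have a1 := fun k : T.Agrees X q f => k e m3 hei hef
  have a2 := fun k : T.Agrees X q e => k f m4 hfi hef.symm
  have hends : (f = c ∨ f = d) ∧ (e = c ∨ e = d) := by grind
  have hLL' : T.LL p c d := by
    rcases hends with ⟨rfl | rfl, rfl | rfl⟩
    · exact absurd rfl hef
    · exact hLL.symm
    · exact hLL
    · exact absurd rfl hef
  have hpq := h'.eq_of_good hp hpg hLL'
  subst hpq
  exact Mark.eq_of_eq (Or.inl h) (Or.inl h') hX

lemma LowerMark.noncrossing [Finite V] (hX : T.Biclosed X) {κ : SegColor}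
    (h : T.LowerMark X p a b) (h' : T.LowerMark X q c d) (hne : T.path a b ≠ T.path c d) :
    T.Noncrossing (κ, T.path a b) (κ, T.path c d) :=
  (noncrossing_same_iff h.isSegment h'.isSegment hne).2 fun _ _ =>
    ⟨fun ho => hne (h.eq_of_overlap hX h' ho), fun ho => hne (h'.eq_of_overlap hX h ho).symm⟩

lemma UpperMark.noncrossing [Finite V] (hX : T.Biclosed X) {κ : SegColor}
    (h : T.UpperMark X p a b) (h' : T.UpperMark X q c d) (hne : T.path a b ≠ T.path c d) :
    T.Noncrossing (κ, T.path a b) (κ, T.path c d) :=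
  (noncrossing_mirror h.isSegment h'.isSegment hne).1
    ((mirror_lowerMark.2 h).noncrossing (κ := κ) hX.mirror (mirror_lowerMark.2 h') hne)

/-- A common corner would make `p` and `q` marked at the same corner, hence equal, but the one
segment between the marks of an arc has one colour. If the red label exits to the left at both ends,
`p` turns left and `q` right there, against compatibility. The opposite order is excluded by the
marks at the ends of labels and because an arc is determined by its label. -/
lemma LowerMark.noncrossing_upperMark [Finite V] (hX : T.Biclosed X) (h : T.LowerMark X p a b)
    (h' : T.UpperMark X q c d) :
    T.Noncrossing (SegColor.red, T.path a b) (SegColor.green, T.path c d) := by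
  have hp := h.isArc
  have hq := h'.isArc
  rw [noncrossing_iff h.isSegment h'.isSegment]
  have hpq : p ≠ q := by
    rintro rfl
    have h1 := Mark.eq_of_eq (Or.inl h) (Or.inr h') hX
    rw [path_eq_iff] at h1
    have h2 := h.mem
    have h3 := h'.notMem
    have h4 := hX.iff (a := c) (b := d)
    grind
  constructor
  · rintro ⟨v, n, hvi, hn⟩ ⟨⟨h1, k1⟩, ⟨h2, k2⟩⟩
    dsimp only at h1 h2 k1 k2
    have hne := hn.ne'
    have hrne := (rot_adj hn).ne'
    have hv1 : v ∈ T.path a b := by obtain ⟨w, hw⟩ := h1; rw [hw]; exact left_mem _ _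
    have hv2 : v ∈ T.path c d := by obtain ⟨w, hw⟩ := h2; rw [hw]; exact left_mem _ _
    have e1 := (h.isSegment.isEndpoint_iff k1 hv1 hrne).1 h1
    have e2 := (h'.isSegment.isEndpoint_iff k2 hv2 hne).1 h2
    obtain ⟨o1, o2, -⟩ := h.out_of_end k1 hv1 hrne e1.1 e1.2
    obtain ⟨o3, o4, -⟩ := h'.out_of_end k2 hv2 hne e2.1 e2.2
    rw [OutL, dir_of_adj (rot_adj hn), Equiv.symm_apply_apply] at o1
    rw [OutR, dir_of_adj hn] at o3
    exact hpq (o2.eq_of_corner o4 hp hq hvi hn (h.subset hv1) (h'.subset hv2) o1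
      (h'.subset k2) (h.subset k1) o3)
  · intro e f hef h1 h2 h3 h4
    have hei := h.isSegment.inner h1
    have hfi := h.isSegment.inner h2
    have s1 := h.out_of_end h1 h2 hef
    have s2 := h.out_of_end h2 h1 hef.symm
    have t1 := h'.out_of_end h3 h4 hef
    have t2 := h'.out_of_end h4 h3 hef.symm
    have sL1 : T.OutL (T.path a b) e f → T.OutL p e f := fun k => h.subset k
    have sL2 : T.OutL (T.path a b) f e → T.OutL p f e := fun k => h.subset k
    have tL1 : T.OutL (T.path c d) e f → T.OutL q e f := fun k => h'.subset k
    have tL2 : T.OutL (T.path c d) f e → T.OutL q f e := fun k => h'.subset k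
    have sR1 : T.OutR (T.path a b) e f → T.OutR p e f := fun k => h.subset k
    have sR2 : T.OutR (T.path a b) f e → T.OutR p f e := fun k => h.subset k
    have tR1 : T.OutR (T.path c d) e f → T.OutR q e f := fun k => h'.subset k
    have tR2 : T.OutR (T.path c d) f e → T.OutR q f e := fun k => h'.subset k
    have hpg := h.agrees_left.good hX hp h.turns.mem_left h.turns.inner_left
    have hqg := h'.agrees_left.good hX hq h'.turns.mem_left h'.turns.inner_left
    have m1 := h.subset h1
    have m2 := h.subset h2
    have m3 := h'.subset h3
    have m4 := h'.subset h4
    have n1 := hp.outL_iff_not m1 m2 hfi hef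
    have n2 := hp.outL_iff_not m2 m1 hei hef.symm
    have n3 := hq.outL_iff_not m3 m4 hfi hef
    have n4 := hq.outL_iff_not m4 m3 hei hef.symm
    have p1 := fun k k' => hpg.1 e f ⟨hef, hei, hfi, m1, m2, k, k'⟩
    have p2 := fun k k' => hpg.2 e f ⟨hef, hei, hfi, m1, m2, k, k'⟩
    have q1 := fun k k' => hqg.1 e f ⟨hef, hei, hfi, m3, m4, k, k'⟩
    have q2 := fun k k' => hqg.2 e f ⟨hef, hei, hfi, m3, m4, k, k'⟩
    have hXs := hX.iff (a := e) (b := f)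
    have a1 := fun k : T.Agrees X p f => k e m1 hei hef
    have a2 := fun k : T.Agrees X p e => k f m2 hfi hef.symm
    have a3 := fun k : T.Agrees X q f => k e m3 hei hef
    have a4 := fun k : T.Agrees X q e => k f m4 hfi hef.symm
    have u1 : (f = a ∨ f = b) → (e = a ∨ e = b) → ¬ T.LL q e f := by
      intro k k' hl
      refine hpq (h.eq_of_good hq hqg ?_).symm
      rcases k with rfl | rfl <;> rcases k' with rfl | rfl
      · exact absurd rfl hef
      · exact hl.symm
      · exact hl
      · exact absurd rfl hef
    have u2 : (f = c ∨ f = d) → (e = c ∨ e = d) → ¬ T.RR p e f := by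
      intro k k' hl
      refine hpq (h'.eq_of_good hp hpg ?_)
      rcases k with rfl | rfl <;> rcases k' with rfl | rfl
      · exact absurd rfl hef
      · exact hl.symm
      · exact hl
      · exact absurd rfl hef
    have v1 := fun k k' k1 k2 => u1 k k' ⟨hef, hei, hfi, m3, m4, k1, k2⟩
    have v2 := fun k k' k1 k2 => u2 k k' ⟨hef, hei, hfi, m1, m2, k1, k2⟩
    have x1 := exit_spec T SegColor.red (T.path a b) e f
    have x2 := exit_spec T SegColor.red (T.path a b) f e
    have y1 := exit_spec T SegColor.green (T.path c d) e f
    have y2 := exit_spec T SegColor.green (T.path c d) f e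
    simp only [endPos] at x1 x2 y1 y2
    constructor
    · rintro ⟨l1, l2⟩
      have c1 : T.OutL p e f ∧ T.OutR q e f := by grind
      have c2 : T.OutL p f e ∧ T.OutR q f e := by grind
      grind
    · rintro ⟨l1, l2⟩
      by_cases k1 : T.OutR (T.path a b) e f <;> by_cases k2 : T.OutR (T.path a b) f e <;>
        by_cases k3 : T.OutL (T.path c d) e f <;> by_cases k4 : T.OutL (T.path c d) f e <;> grind

end LabelCurves

/-! ### Chains of lower labels -/

section RedPart

variable {T : PlaneTree V} {X : V → V → Prop} {p q r s t : Set V} {a b c d e f u v w n : V}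

/-- The vertices `u` and `v` are joined by a sequence of lower labels. -/
def RedConn (T : PlaneTree V) (X : V → V → Prop) : V → V → Prop :=
  Relation.ReflTransGen fun a b => ∃ p, T.LowerMark X p a b

lemma RedConn.symm (h : T.RedConn X u v) : T.RedConn X v u := by
  induction h with
  | refl => exact Relation.ReflTransGen.refl
  | tail _ h2 ih =>
    obtain ⟨p, hp⟩ := h2
    exact Relation.ReflTransGen.head ⟨p, hp.symm⟩ ih

/-- A label not carried by `r` stays on one side of `r`. A red chain that changes sides must
therefore use the label of `r`. -/
lemma RedConn.exists_mark (hX : T.Biclosed X) (h : T.RedConn X u v) (hr : T.IsArc r)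
    (hg : T.Good X r) (hs : T.Sep r u v) : ∃ a b, T.LowerMark X r a b := by
  by_contra hcon
  have key : T.IsInner u → T.IsInner v ∧ ¬ T.Sep r u v := by
    intro hu
    clear hs
    induction h with
    | refl => exact ⟨hu, not_sep_self⟩
    | tail h1 h2 ih =>
      obtain ⟨p, hp⟩ := h2
      have hrp : r ≠ p := by
        rintro rfl
        exact hcon ⟨_, _, hp⟩
      have h3 := hp.not_sep hX hr hg hrp
      have hci := hp.turns.inner_right
      refine ⟨hci, fun hs => ih.2 ?_⟩
      exact ((sep_trans hr hci ih.1 hu fun k => h3 k.symm).1 hs.symm).symm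
  by_cases hu : T.IsInner u
  · exact (key hu).2 hs
  · rcases Relation.ReflTransGen.cases_head h with rfl | ⟨c, ⟨p, hp⟩, -⟩
    · exact not_sep_self hs
    · exact hu hp.turns.inner_left

/-- From a lower label that does not lead from `w` to the other side of its arc, though it
starts towards `b`, one can move on away from `b`. -/
lemma RedConn.ascend [Finite V] (hX : T.Biclosed X) (h : T.RedConn X w b) (hbi : T.IsInner b)
    (hwb : w ≠ b) (hm : T.LowerMark X p w c) (hd : T.dir w c = T.dir w b)
    (hs : ¬ T.Sep p w b) : False := by
  -- Each step moves `w` further away from `b`, which cannot go on in a finite tree.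
  induction hk : Nat.card V - (T.path b w).ncard using Nat.strong_induction_on
    generalizing w p c with
  | _ k ih =>
  have hwi := hm.turns.inner_left
  have hadj := adj_dir (T := T) hwb
  obtain ⟨r, hr, r1, r2, r3, r4⟩ := exists_arc hwi hadj (X w)
  have hdp := hm.isArc.strip.isPathSet.dir_mem hm.turns.mem_left hm.turns.mem_right
  have hout := hm.turns.out_left
  rw [OutL] at hout
  rw [hd] at hdp hout
  have hsep := not_not.1 fun h' => hs (not_not.1 fun h'' => h'
    ((sep_iff_not_sep hwi hbi hwb hr hm.isArc r4 hm.agrees_left r1 hm.turns.mem_left r2 r3 hdp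
      hout).2 h''))
  have hag : T.Agrees X r w := r4
  have hrg := hag.good hX hr r1 hwi
  obtain ⟨w', hm'⟩ : ∃ w', T.LowerMark X r w w' := by
    obtain ⟨x, y, hxy⟩ := h.exists_mark hX hr hrg hsep
    rcases Mark.eq_or (Or.inl hxy) hX hag r1 hwi with rfl | rfl
    · exact ⟨_, hxy⟩
    · exact ⟨_, hxy.symm⟩
  have hne : T.dir w w' ≠ T.dir w b := by
    intro e
    have h1 := hm'.turns.out_left
    rw [OutL, e] at h1
    obtain ⟨x, y, hxy, rfl⟩ := isArc_iff.1 hr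
    have hb := hxy.btw r1 hwi
    have k1 := hxy.adj_mem hb hadj r2
    have k2 := hxy.adj_mem hb (rot_adj hadj) r3
    have k3 := hxy.adj_mem hb (rot_symm_adj hadj) h1
    have n1 := rot_ne hwi hadj
    have n2 := rot_symm_ne hwi hadj
    have n3 := rot_symm_ne_rot hwi hadj
    grind
  have hbt : T.Btw b w w' := btw_iff.2 ⟨hwb, hm'.turns.ne, hne.symm⟩
  have hconn : T.RedConn X w' b := Relation.ReflTransGen.head ⟨r, hm'.symm⟩ h
  refine ih _ ?_ hconn hbt.ne.symm hm'.symm hbt.dir_right ?_ rfl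
  · rw [← hk]
    have hlt : (T.path b w).ncard < (T.path b w').ncard := by
      refine Set.ncard_lt_ncard ⟨path_subset_left hbt.2.2, fun h' => ?_⟩ (path_finite _ _)
      exact hbt.2.1 (path_inter hbt.2.2 (h' (right_mem b w')) (right_mem _ _)).symm
    have hle := Set.ncard_le_card (T.path b w')
    omega
  · exact (sep_trans' hr hwi hm'.turns.inner_right hbi (hm'.turns.sep hr.strip)).1 hsep

/-- A vertex joined to `b` by lower labels has a lower label along the path to `b`. -/
lemma RedConn.exists_label [Finite V] (hX : T.Biclosed X) (h : T.RedConn X a b) (hab : a ≠ b)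
    (ha : T.IsInner a) (hb : T.IsInner b) :
    ∃ p w, T.LowerMark X p a w ∧ w ∈ T.path a b := by
  by_contra hcon
  push Not at hcon
  have hadj := adj_dir (T := T) hab
  obtain ⟨p, hp, h1, h2, h3, h4⟩ := exists_arc ha hadj (X a)
  obtain ⟨r, hr, k1, k2, k3, k4⟩ := exists_arc ha (rot_symm_adj hadj) (X a)
  rw [Equiv.apply_symm_apply] at k3
  have hsep := sep_iff_not_sep ha hb hab hp hr h4 k4 h1 k1 h2 h3 k3 k2
  obtain ⟨q, hq, hqa, hag, hqs⟩ : ∃ q, T.IsArc q ∧ a ∈ q ∧ T.Agrees X q a ∧ T.Sep q a b := by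
    by_cases hs : T.Sep p a b
    · exact ⟨p, hp, h1, h4, hs⟩
    · exact ⟨r, hr, k1, k4, not_not.1 fun h => hs (hsep.2 h)⟩
  obtain ⟨w, hm⟩ : ∃ w, T.LowerMark X q a w := by
    obtain ⟨x, y, hxy⟩ := h.exists_mark hX hq (hag.good hX hq hqa ha) hqs
    rcases Mark.eq_or (Or.inl hxy) hX hag hqa ha with rfl | rfl
    · exact ⟨_, hxy⟩
    · exact ⟨_, hxy.symm⟩
  have hw := hcon q w hm
  have hwb : w ≠ b := fun e => hw (e ▸ right_mem _ _)
  -- A label ending off the path to `b` reaches a vertex from which `a` and `b` lie in the same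
  -- direction, the situation excluded by `ascend`.
  have hd : T.dir w a = T.dir w b := by
    by_contra hd
    exact hw (mem_path_of_dir_ne hm.turns.ne.symm hwb hd)
  exact RedConn.ascend hX (Relation.ReflTransGen.head ⟨q, hm.symm⟩ h) hb hwb hm.symm hd
    ((sep_trans' hq ha hm.turns.inner_right hb (hm.turns.sep hq.strip)).1 hqs)

end RedPart

/-! ### Noncrossing tree partitions and their segments -/

section Partitions

variable {T : PlaneTree V} {P Q : Setoid T.Inner} {B : Set V} {s : Set V} {x y : V}

lemma isEndpoint_left (x y : V) : T.IsEndpoint (T.path x y) x := endpoint_iff.2 (Or.inl rfl)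

lemma isEndpoint_right (x y : V) : T.IsEndpoint (T.path x y) y := endpoint_iff.2 (Or.inr rfl)

lemma mem_blocks : B ∈ T.blocks P ↔ ∃ a : T.Inner, B = Subtype.val '' {u | P.r u a} := by
  constructor
  · rintro ⟨_, ⟨a, rfl⟩, rfl⟩
    exact ⟨a, rfl⟩
  · rintro ⟨a, rfl⟩
    exact ⟨_, ⟨a, rfl⟩, rfl⟩

/-- Parts of a segment between interior vertices are segments, so inclusion-minimality says exactly
that no further vertex of the block lies on it. -/
lemma mem_segOf_iff : s ∈ T.segOf P ↔ ∃ a b : T.Inner, T.IsSeg a.1 b.1 ∧ s = T.path a.1 b.1 ∧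
    P.r a b ∧ ∀ c : T.Inner, c.1 ∈ T.path a.1 b.1 → P.r a c → c = a ∨ c = b := by
  constructor
  · rintro ⟨B, hB, ⟨⟨hs, hend⟩, hmin⟩⟩
    obtain ⟨x, rfl⟩ := mem_blocks.1 hB
    obtain ⟨a, b, hab, rfl⟩ := isSegment_iff.1 hs
    obtain ⟨a', ha', rfl⟩ := hend _ (isEndpoint_left a b)
    obtain ⟨b', hb', rfl⟩ := hend _ (isEndpoint_right a'.1 b)
    refine ⟨a', b', hab, rfl, P.trans' ha' (P.symm' hb'), fun c hc hac => ?_⟩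
    by_contra hcon
    push Not at hcon
    have hca : c.1 ≠ a'.1 := fun e => hcon.1 (Subtype.ext e)
    have hcb : c.1 ≠ b'.1 := fun e => hcon.2 (Subtype.ext e)
    have h1 : T.IsSegment (T.path a'.1 c.1) :=
      isSegment_iff.2 ⟨_, _, hab.sub_left ⟨hca, hcb, hc⟩, rfl⟩
    have h2 := hmin ⟨h1, fun v hv => by
      rcases endpoint_iff.1 hv with rfl | rfl
      · exact ⟨_, ha', rfl⟩
      · exact ⟨_, P.trans' (P.symm' hac) ha', rfl⟩⟩ (path_subset_left hc)
    exact hcb (path_inter hc (h2 (right_mem _ _)) (right_mem _ _)).symm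
  · rintro ⟨a, b, hab, rfl, hr, hmin⟩
    refine ⟨_, mem_blocks.2 ⟨a, rfl⟩, ⟨isSegment_iff.2 ⟨_, _, hab, rfl⟩, fun v hv => ?_⟩, ?_⟩
    · rcases endpoint_iff.1 hv with rfl | rfl
      · exact ⟨a, P.refl' a, rfl⟩
      · exact ⟨b, P.symm' hr, rfl⟩
    · rintro t ⟨ht, hend⟩ hts
      obtain ⟨c, d, hcd, rfl⟩ := isSegment_iff.1 ht
      obtain ⟨c', hc', rfl⟩ := hend _ (isEndpoint_left c d)
      obtain ⟨d', hd', rfl⟩ := hend _ (isEndpoint_right c'.1 d)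
      have h1 := hmin c' (hts (left_mem _ _)) (P.symm' hc')
      have h2 := hmin d' (hts (right_mem _ _)) (P.symm' hd')
      have hne : c' ≠ d' := fun e => hcd.ne (congrArg _ e)
      rcases h1 with rfl | rfl <;> rcases h2 with rfl | rfl
      · exact absurd rfl hne
      · exact subset_rfl
      · exact (path_comm _ _).subset
      · exact absurd rfl hne

lemma isSegment_of_mem_segOf (h : s ∈ T.segOf P) : T.IsSegment s := by
  obtain ⟨a, b, hab, rfl, -⟩ := mem_segOf_iff.1 h
  exact isSegment_iff.2 ⟨_, _, hab, rfl⟩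

lemma rel_of_mem_segOf {a b : T.Inner} (h : T.path a.1 b.1 ∈ T.segOf P) : P.r a b := by
  obtain ⟨c, d, hcd, he, hr, -⟩ := mem_segOf_iff.1 h
  rcases path_eq_iff.1 he with ⟨h1, h2⟩ | ⟨h1, h2⟩
  · obtain rfl := Subtype.ext h1
    obtain rfl := Subtype.ext h2
    exact hr
  · obtain rfl := Subtype.ext h1
    obtain rfl := Subtype.ext h2
    exact P.symm' hr

lemma seg_of_mem_segOf (hB : B ∈ T.blocks P) (hx : x ∈ B) (h : T.path x y ∈ T.segOf P) :
    y ∈ B ∧ T.path x y ∈ T.seg B := by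
  obtain ⟨B', hB', h'⟩ := h
  have hx' := h'.1.2 x (isEndpoint_left x y)
  have hy' := h'.1.2 y (isEndpoint_right x y)
  have : B = B' := by
    obtain ⟨a, rfl⟩ := mem_blocks.1 hB
    obtain ⟨a', rfl⟩ := mem_blocks.1 hB'
    obtain ⟨u, hu, rfl⟩ := hx
    obtain ⟨u', hu', he⟩ := hx'
    obtain rfl := Subtype.ext he
    congr 1
    ext w
    exact ⟨fun h => P.trans' (P.trans' h (P.symm' hu)) hu',
      fun h => P.trans' (P.trans' h (P.symm' hu')) hu⟩
  rw [this]
  exact ⟨hy', h'⟩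

lemma segmentConnected_iff : (∀ B ∈ T.blocks P, T.SegmentConnected B) ↔
    ∀ u v : T.Inner, P.r u v →
      Relation.ReflTransGen (fun x y => T.path x y ∈ T.segOf P) u.1 v.1 := by
  constructor
  · intro h u v huv
    have hB : Subtype.val '' {w | P.r w v} ∈ T.blocks P := mem_blocks.2 ⟨v, rfl⟩
    exact Relation.ReflTransGen.mono (fun x y hxy => ⟨_, hB, hxy.2.2⟩) _ _
      (h _ hB u.1 ⟨u, huv, rfl⟩ v.1 ⟨v, P.refl' v, rfl⟩)
  · intro h B hB u hu v hv
    obtain ⟨a, rfl⟩ := mem_blocks.1 hB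
    obtain ⟨u', hu', rfl⟩ := id hu
    obtain ⟨v', hv', rfl⟩ := id hv
    have h1 := h u' v' (P.trans' hu' (P.symm' hv'))
    generalize v'.1 = z at h1
    clear hv
    have key : z ∈ Subtype.val '' {w : T.Inner | P.r w a} ∧ Relation.ReflTransGen
        (fun x y => x ∈ Subtype.val '' {w : T.Inner | P.r w a} ∧
          y ∈ Subtype.val '' {w : T.Inner | P.r w a} ∧
          T.path x y ∈ T.seg (Subtype.val '' {w : T.Inner | P.r w a})) u'.1 z := by
      induction h1 with
      | refl => exact ⟨hu, Relation.ReflTransGen.refl⟩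
      | tail _ h2 ih =>
        have h3 := seg_of_mem_segOf hB ih.1 h2
        exact ⟨h3.1, ih.2.tail ⟨ih.1, h3.1, h3.2⟩⟩
    exact key.2

lemma IsNCP.rel_iff (hP : T.IsNCP P) {u v : T.Inner} :
    P.r u v ↔ Relation.ReflTransGen (fun x y => T.path x y ∈ T.segOf P) u.1 v.1 := by
  refine ⟨segmentConnected_iff.1 hP.2 u v, fun h => ?_⟩
  have key : ∀ z, Relation.ReflTransGen (fun x y => T.path x y ∈ T.segOf P) u.1 z →
      ∃ hz : T.IsInner z, P.r u ⟨z, hz⟩ := by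
    intro z hz
    induction hz with
    | refl => exact ⟨u.2, P.refl' u⟩
    | @tail y z _ h2 ih =>
      obtain ⟨hy, hr⟩ := ih
      have hz : T.IsInner z := (isSegment_of_mem_segOf h2).inner (right_mem _ _)
      exact ⟨hz, P.trans' hr (rel_of_mem_segOf (a := ⟨y, hy⟩) (b := ⟨z, hz⟩) h2)⟩
  exact (key _ h).2

/-- Segment-connectedness makes the blocks the components under the chosen segments. -/
lemma IsNCP.eq_of_segOf (hP : T.IsNCP P) (hQ : T.IsNCP Q) (h : T.segOf P = T.segOf Q) :
    P = Q := by
  refine Setoid.ext fun u v => ?_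
  have h1 := hP.rel_iff (u := u) (v := v)
  have h2 := hQ.rel_iff (u := u) (v := v)
  rw [h] at h1
  exact h1.trans h2.symm

end Partitions

/-! ### The partition of a facet and its segments -/

section Rho

variable {T : PlaneTree V} {X : V → V → Prop} {F : T.Facet}

lemma path_mem_lowerLabels [Finite V] (hX : T.Biclosed X) (hF : F.1 = T.facetOf X) {x y : V} :
    T.path x y ∈ T.lowerLabels F ↔ ∃ p, T.LowerMark X p x y := by
  rw [mem_lowerLabels hX hF]
  constructor
  · rintro ⟨p, a, b, h, he⟩
    rcases path_eq_iff.1 he with ⟨rfl, rfl⟩ | ⟨rfl, rfl⟩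
    · exact ⟨p, h⟩
    · exact ⟨p, h.symm⟩
  · rintro ⟨p, h⟩
    exact ⟨p, x, y, h, rfl⟩

lemma rho_iff [Finite V] (hX : T.Biclosed X) (hF : F.1 = T.facetOf X) {u v : T.Inner} :
    (T.rho F).r u v ↔ T.RedConn X u.1 v.1 := by
  constructor
  · intro h
    change Relation.EqvGen _ u v at h
    induction h with
    | rel x y h =>
      exact Relation.ReflTransGen.single ((path_mem_lowerLabels hX hF).1 h)
    | refl x => exact Relation.ReflTransGen.refl
    | symm x y _ ih => exact ih.symm
    | trans x y z _ _ ih1 ih2 => exact Relation.ReflTransGen.trans ih1 ih2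
  · intro h
    have key : ∀ z, T.RedConn X u.1 z → ∃ hz : T.IsInner z, (T.rho F).r u ⟨z, hz⟩ := by
      intro z hz
      induction hz with
      | refl => exact ⟨u.2, (T.rho F).refl' u⟩
      | @tail y z _ h2 ih =>
        obtain ⟨hy, hr⟩ := ih
        obtain ⟨p, hp⟩ := h2
        have hz := hp.turns.inner_right
        refine ⟨hz, (T.rho F).trans' hr (Relation.EqvGen.rel _ _ ?_)⟩
        exact (path_mem_lowerLabels hX hF).2 ⟨p, hp⟩
    exact (key _ h).2

/-- Both carrying arcs are marked at the corner to the right of the common first edge, so they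
coincide, and an arc carries at most one label. -/
lemma LowerMark.eq_of_dir {p q : Set V} {a b c : V} (h : T.LowerMark X p a b)
    (h' : T.LowerMark X q a c) (hX : T.Biclosed X) (hd : T.dir a b = T.dir a c) :
    T.path a b = T.path a c := by
  have h1 := h.turns.out_left
  have h2 := h'.turns.out_left
  rw [OutL] at h1 h2
  have h3 := h.isArc.strip.isPathSet.dir_mem h.turns.mem_left h.turns.mem_right
  have h4 := h'.isArc.strip.isPathSet.dir_mem h'.turns.mem_left h'.turns.mem_right
  rw [← hd] at h2 h4
  have : p = q := h.agrees_left.eq_of_corner h'.agrees_left h.isArc h'.isArc h.turns.inner_left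
    (rot_symm_adj (adj_dir h.turns.ne)) h.turns.mem_left h'.turns.mem_left h1 h2
    (by rwa [Equiv.apply_symm_apply]) (by rwa [Equiv.apply_symm_apply])
  subst this
  exact Mark.eq_of_eq (Or.inl h) (Or.inl h') hX

/-- On a minimal segment `[a, b]` there is a lower label starting at `a`, and minimality makes it
reach `b`. Conversely, if a block vertex `c` lies on the label `[a, b]`, the lower label from `a`
along `[a, c]` starts in the same direction, so it is `[a, b]` itself and `c = b`. -/
lemma segOf_rho [Finite V] (F : T.Facet) : T.segOf (T.rho F) = T.lowerLabels F := by
  obtain ⟨X, hX, -, hF⟩ := exists_facetOf (isFacet_iff.1 F.2)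
  ext s
  rw [mem_segOf_iff, mem_lowerLabels hX hF]
  constructor
  · rintro ⟨a, b, hab, rfl, hr, hmin⟩
    obtain ⟨p, w, hm, hw⟩ := ((rho_iff hX hF).1 hr).exists_label hX hab.ne a.2 b.2
    refine ⟨p, a.1, w, hm, ?_⟩
    have hrw : (T.rho F).r a ⟨w, hm.turns.inner_right⟩ :=
      (rho_iff hX hF).2 (Relation.ReflTransGen.single ⟨p, hm⟩)
    rcases hmin ⟨w, hm.turns.inner_right⟩ hw hrw with e | e
    · exact absurd (congrArg Subtype.val e).symm hm.turns.ne
    · rw [← e]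
  · rintro ⟨p, a, b, hm, rfl⟩
    refine ⟨⟨a, hm.turns.inner_left⟩, ⟨b, hm.turns.inner_right⟩, hm.isSeg, rfl,
      (rho_iff hX hF).2 (Relation.ReflTransGen.single ⟨p, hm⟩), ?_⟩
    rintro ⟨c, hci⟩ hc hr
    dsimp only at hc
    by_cases hca : a = c
    · subst hca
      exact Or.inl rfl
    right
    obtain ⟨q, w, hm', hw⟩ := ((rho_iff hX hF).1 hr).exists_label hX hca hm.turns.inner_left hci
    dsimp only at hm' hw
    have h1 := hm.eq_of_dir hm' hX (by
      rw [dir_eq_of_mem hw hm'.turns.ne.symm, dir_eq_of_mem hc (Ne.symm hca)])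
    have h2 := path_inj_right h1
    subst h2
    exact Subtype.ext (path_inter hc hw (right_mem _ _)).symm

lemma isNCP_rho [Finite V] (F : T.Facet) : T.IsNCP (T.rho F) := by
  obtain ⟨X, hX, -, hF⟩ := exists_facetOf (isFacet_iff.1 F.2)
  refine ⟨?_, segmentConnected_iff.2 fun u v huv => ?_⟩
  · rw [segOf_rho]
    intro s hs t ht hne
    obtain ⟨p, a, b, h, rfl⟩ := (mem_lowerLabels hX hF).1 hs
    obtain ⟨q, c, d, h', rfl⟩ := (mem_lowerLabels hX hF).1 ht
    exact h.noncrossing hX h' hne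
  · rw [segOf_rho]
    exact Relation.ReflTransGen.mono (fun x y hxy => (path_mem_lowerLabels hX hF).2 hxy) _ _
      ((rho_iff hX hF).1 huv)

end Rho

/-! ### The biclosed set spanned by noncrossing red segments -/

section RedSegments

variable {T : PlaneTree V} {S : Set (Set V)} {p q r s t : Set V} {a b c d e f u v w m : V}

/-- The parts of the segments in `S` at whose ends the segment does not turn right, and all their
concatenations. -/
def span (T : PlaneTree V) (S : Set (Set V)) : V → V → Prop :=
  T.Gen fun e f => e ≠ f ∧ ∃ s ∈ S, e ∈ s ∧ f ∈ s ∧ ¬ T.OutR s e f ∧ ¬ T.OutR s f e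

/-- Pairwise noncrossing red segments. -/
structure RedFamily (T : PlaneTree V) (S : Set (Set V)) : Prop where
  isSegment : ∀ s ∈ S, T.IsSegment s
  eq_of_overlap : ∀ s ∈ S, ∀ t ∈ S, ∀ e f, T.Overlap s t e f → s = t

lemma redFamily_of_noncrossing [Finite V] (h : ∀ s ∈ S, T.IsSegment s)
    (h' : ∀ s ∈ S, ∀ t ∈ S, s ≠ t → T.Noncrossing (SegColor.red, s) (SegColor.red, t)) :
    T.RedFamily S := by
  refine ⟨h, fun s hs t ht e f ho => ?_⟩
  by_contra hne
  exact ((noncrossing_same_iff (h s hs) (h t ht) hne).1 (h' s hs t ht hne) e f).1 ho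

namespace RedFamily

lemma span_symm {a b : V} (h : T.span S a b) : T.span S b a :=
  h.symm fun _ _ ⟨h1, s, h2, h3, h4, h5, h6⟩ => ⟨h1.symm, s, h2, h4, h3, h6, h5⟩

/-- Cutting a generator at a left turn gives a generator, which is what makes the span satisfy
`Tors` and hence biclosed. -/
lemma quotient (hS : T.RedFamily S) (a b c : V)
    (h : a ≠ c ∧ ∃ s ∈ S, a ∈ s ∧ c ∈ s ∧ ¬ T.OutR s a c ∧ ¬ T.OutR s c a) (hb : T.Btw a b c)
    (hL : T.OutL (T.path a c) a b) :
    a ≠ b ∧ ∃ s ∈ S, a ∈ s ∧ b ∈ s ∧ ¬ T.OutR s a b ∧ ¬ T.OutR s b a := by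
  obtain ⟨-, s, hs, h1, h2, h3, h4⟩ := h
  have hst := (hS.isSegment s hs).strip
  have l := hst.line h1 h2 hb
  have := (hst.sub h1 h2).outL_sub hst (left_mem _ _) (right_mem _ _) h1 h2 hb
  exact ⟨hb.1.symm, s, hs, h1, hst.btw_mem h1 h2 hb, by grind, by grind⟩

lemma biclosed (hS : T.RedFamily S) : T.Biclosed (T.span S) :=
  Gen.biclosed (fun _ _ ⟨h1, s, h2, h3, h4, h5, h6⟩ => ⟨h1.symm, s, h2, h4, h3, h6, h5⟩)
    hS.quotient

lemma exists_overlap (hr : T.Strip r) (h : T.span S a b) (ha : a ∈ r)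
    (hb : b ∈ r) (h1 : ¬ T.OutL r a b) (h2 : ¬ T.OutL r b a) :
    ∃ t ∈ S, ∃ x y, x ∈ T.path a b ∧ y ∈ T.path a b ∧ T.Overlap t r x y := by
  obtain ⟨x, y, ⟨k1, t, k2, k3, k4, k5, k6⟩, hx, hy, k7, k8⟩ := h.exists_base hr ha hb h1 h2
  have hsub := hr.path_subset ha hb
  exact ⟨t, k2, x, y, hx, hy, k1, k3, k4, hsub hx, hsub hy, k5, k6, k7, k8⟩

/-- Some generator overlaps `s` inside `[a, b]`. It comes from `s` by noncrossing, so `s` turns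
neither way at the ends of the overlap; these are then the endpoints of `s`. -/
lemma isEndpoint_of_span (hS : T.RedFamily S) (hs : s ∈ S) (h : T.span S a b) (ha : a ∈ s)
    (hb : b ∈ s) (h1 : ¬ T.OutL s a b) (h2 : ¬ T.OutL s b a) : s = T.path a b := by
  have hseg := hS.isSegment s hs
  obtain ⟨t, ht, x, y, hx, hy, ho⟩ := exists_overlap hseg.strip h ha hb h1 h2
  obtain rfl := hS.eq_of_overlap t ht s hs x y ho
  have e1 := (hseg.isEndpoint_iff ho.2 ho.3 ho.1).2 ⟨ho.8, ho.6⟩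
  have e2 := (hseg.isEndpoint_iff ho.3 ho.2 ho.1.symm).2 ⟨ho.9, ho.7⟩
  have e3 := hseg.eq_path e2 e1 ho.1
  refine (hseg.strip.path_subset ha hb).antisymm' ?_
  rw [e3]
  exact path_subset hx hy

lemma span_self (hs : T.path a b ∈ S) (hab : T.IsSeg a b) : T.span S a b :=
  .base ⟨hab.ne, _, hs, left_mem _ _, right_mem _ _,
    (not_out_right hab.right (left_mem _ _) hab.ne).2,
    (not_out_left hab.left (right_mem _ _) hab.ne.symm).2⟩

lemma span_iff (hS : T.RedFamily S) (hs : T.path a b ∈ S) (hab : T.IsSeg a b)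
    (hm : T.Btw a m b) : T.span S a m ↔ T.OutL (T.path a b) a m := by
  have l := hab.strip.line (left_mem _ _) (right_mem _ _) hm
  have h1 := not_out_left hab.left hm.2.2 hm.1
  constructor
  · intro h
    by_contra hL
    have h2 := hS.isEndpoint_of_span hs h (left_mem _ _) hm.2.2 hL h1.1
    exact hm.2.1 (path_inj_right h2).symm
  · exact fun h => .base ⟨hm.1.symm, _, hs, left_mem _ _, hm.2.2, by grind, h1.2⟩

/-- This replaces `LowerMark.iff_beyond` before any mark is known. A single generator turning left
at `b` would overlap `s` and hence come from `s`, which ends there. For a concatenation, the factor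
containing the passage through `b` is treated by induction. -/
lemma span_beyond (hS : T.RedFamily S) (hs : s ∈ S) (hb : T.IsEndpoint s b)
    (h : T.span S u w) (hu : u ∈ s) (hub : u ≠ b) (hL : ¬ T.OutL s b u) (hbt : T.Btw u b w)
    (hturn : T.OutL (T.path u w) u b) : T.span S b w := by
  have hseg := hS.isSegment s hs
  have hbs : b ∈ s := by obtain ⟨c, hc⟩ := hb; rw [hc]; exact left_mem _ _
  unfold span at h
  induction h with
  | @base u w h =>
    obtain ⟨-, t, ht, h1, h2, h3, h4⟩ := h
    exfalso
    have htst := (hS.isSegment t ht).strip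
    have l := htst.line h1 h2 hbt
    have ho := (htst.sub h1 h2).outL_sub htst (left_mem _ _) (right_mem _ _) h1 h2 hbt
    have he := (hseg.isEndpoint_iff hu hbs hub).1 hb
    have := hS.eq_of_overlap t ht s hs u b
      ⟨hub, h1, htst.btw_mem h1 h2 hbt, hu, hbs, by grind, by grind, he.1, hL⟩
    subst this
    exact he.1 (ho.1 hturn)
  | @concat u m w huw hm h1 h2 ih1 ih2 =>
    have hst := huw.strip
    have hl := left_mem (T := T) u w
    have hr := right_mem (T := T) u w
    by_cases hmb : m = b
    · subst hmb; exact h2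
    have hmem := hm.2.2
    rw [path_split hbt.2.2] at hmem
    rcases hmem with h | h
    · have hm' : T.Btw u m b := ⟨hm.1, hmb, h⟩
      have hms := hseg.strip.btw_mem hu hbs hm'
      have l := hseg.strip.line hu hbs hm'
      have l' := hst.line hl hbt.2.2 hm'
      by_cases hL' : T.OutL s b m
      · exfalso
        have h3 : ¬ T.OutL s u m := by grind
        have h4 := hS.isEndpoint_of_span hs h1 hu hms h3 (by grind)
        rw [h4, endpoint_iff] at hb
        rcases hb with e | e
        · exact hub e.symm
        · exact hmb e.symm
      · have hbt' := hm'.trans_left hbt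
        refine ih2 hms hmb hL' hbt' ?_
        rw [(hst.sub hm.2.2 hr).outL_sub hst (left_mem _ _) (right_mem _ _) hm.2.2 hr hbt']
        exact l'.2.2.1.2 hturn
    · have hm' : T.Btw b m w := ⟨hmb, hm.2.1, h⟩
      have hbm : T.Btw u b m := (hm'.symm.trans_left hbt.symm).symm
      refine .concat (huw.sub_right hbt) hm' (ih1 hu hub hL hbm ?_) h2
      rwa [(hst.sub hl hm.2.2).outL_sub hst (left_mem _ _) (right_mem _ _) hl hm.2.2 hbm]

/-- Take the arc turning left at `a` with turns prescribed by the span from `a`. By `span_iff` it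
follows the segment to `b` and turns left there. Prescription at `b` comes from `span_iff` between
the ends, and from closedness with `span_beyond` outside. -/
lemma exists_lowerMark [Finite V] (hS : T.RedFamily S) (hs : T.path a b ∈ S) (hab : T.IsSeg a b) :
    ∃ p, T.LowerMark (T.span S) p a b := by
  have hX := hS.biclosed
  have hadj := adj_dir (T := T) hab.ne
  obtain ⟨p, hp, hap, hnp, hdp, hag⟩ := exists_arc hab.left (rot_symm_adj hadj) (T.span S a)
  rw [Equiv.apply_symm_apply] at hdp
  have hXab := span_self hs hab
  have hs' : T.path b a ∈ S := by rwa [path_comm]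
  have hbp : b ∈ p := by
    by_contra hbp
    obtain ⟨g, hbt, hgp, hgs, -, h1, h2⟩ :=
      hp.diverge hab.strip hap (left_mem a b) (right_mem a b) hbp hdp
    have a1 := hag g hgp hbt.inner hbt.1
    have a2 := hS.span_iff hs hab hbt
    have a3 := hp.outL_iff_not hap hgp hbt.inner hbt.1.symm
    grind
  have hLL : T.LL p a b := ⟨hab.ne, hab.left, hab.right, hap, hbp,
    (hag b hbp hab.right hab.ne.symm).1 hXab, hnp⟩
  refine ⟨p, hp, hag, fun w hwp hwi hwb => ?_, hLL⟩
  by_cases hwa : w = a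
  · subst hwa
    exact iff_of_true (hX.symm hXab) hLL.out_left
  have a1 := hag w hwp hwi hwa
  rcases hp.strip.isPathSet.btw_trichotomy hap hwp hbp (Ne.symm hwa) hab.ne hwb with hc | hc | hc
  · have h1 := hS.span_iff hs' hab.symm hc.symm
    rwa [hab.symm.strip.outL_sub hp.strip (left_mem b a) (right_mem b a) hbp hap hc.symm] at h1
  · have l := hp.strip.line hwp hbp hc
    have hsg := hp.isSeg hbp hwp (Ne.symm hwb) hab.right hwi
    have h1 := hX.closed hsg hc.symm (hX.symm hXab)
    have h2 : T.span S b w → T.span S a w := fun h =>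
      hS.span_beyond hs (isEndpoint_left a b) h (right_mem _ _) hab.ne.symm
        (not_out_right hab.right (left_mem _ _) hab.ne).1 hc.symm (by
          rw [hsg.strip.outL_sub hp.strip (left_mem _ _) (right_mem _ _) hbp hwp hc.symm]
          exact hLL.out_left)
    grind
  · have l := hp.strip.line hap hwp hc
    have hsg := hp.isSeg hap hwp (Ne.symm hwa) hab.left hwi
    have h1 := hX.closed hsg hc hXab
    have h2 : T.span S a w → T.span S b w := fun h =>
      hS.span_beyond hs (isEndpoint_right a b) h (left_mem _ _) hab.ne
        (not_out_left hab.left (right_mem _ _) hab.ne.symm).1 hc (by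
          rw [hsg.strip.outL_sub hp.strip (left_mem _ _) (right_mem _ _) hap hwp hc]
          exact hLL.out_right)
    grind

/-- By `xor_between` a lower label is not a concatenation, so it is a generator inside some `t` of
`S`. The arc that carries `t` turns left at both ends of it, hence is `p`; as an arc has one label,
`t` is the given segment. -/
lemma path_mem [Finite V] (hS : T.RedFamily S) (h : T.LowerMark (T.span S) p a b) :
    T.path a b ∈ S := by
  have hX := hS.biclosed
  have hab := h.mem
  unfold span at hab
  cases hab with
  | base hA =>
    obtain ⟨hne, t, ht, h1, h2, h3, h4⟩ := hA
    obtain ⟨c, d, hcd, rfl⟩ := isSegment_iff.1 (hS.isSegment t ht)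
    obtain ⟨q, hq⟩ := hS.exists_lowerMark ht hcd
    have key : ∀ e f, e ≠ f → e ∈ T.path c d → f ∈ T.path c d → ¬ T.OutR (T.path c d) e f →
        T.OutL q e f := by
      intro e f hef he hf hR
      by_cases hL : T.OutL (T.path c d) e f
      · exact hq.subset hL
      · exact (hq.out_of_end he hf hef hL hR).1
    have hqp := h.eq_of_good hq.isArc
      (hq.agrees_left.good hX hq.isArc hq.turns.mem_left hq.turns.inner_left)
      ⟨hne, h.turns.inner_left, h.turns.inner_right, hq.subset h1, hq.subset h2,
        key a b hne h1 h2 h3, key b a hne.symm h2 h1 h4⟩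
    subst hqp
    rw [Mark.eq_of_eq (Or.inl h) (Or.inl hq) hX]
    exact ht
  | concat hs hm h1 h2 => exact absurd (span_symm h2) ((h.xor_between hm).1 h1)

end RedFamily

end RedSegments

/-- A tree has the fewest edges among connected graphs on the same vertices; this is the counting
behind the classification of red-green trees. -/
lemma card_dart_le {W : Type*} [Finite W] {G H : SimpleGraph W} (hG : G.IsTree)
    (hH : H.Connected) : Nat.card G.Dart ≤ Nat.card H.Dart := by
  classical
  have := Fintype.ofFinite W
  have h1 := hG.card_edgeFinset
  have h2 := hH.card_vert_le_card_edgeSet_add_one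
  have h3 := G.dart_card_eq_twice_card_edges
  have h4 := H.dart_card_eq_twice_card_edges
  rw [Nat.card_eq_fintype_card, Nat.card_eq_fintype_card] at *
  rw [← SimpleGraph.edgeFinset_card] at h2
  omega

/-! ### Corners in which the curves of labels start -/

section Corners

variable {T : PlaneTree V} {X Y : V → V → Prop} {κ κ' : SegColor} {p q : Set V}
  {a b c d n u v w z : V}

/-- The corner in which the curve of a coloured segment from `a` to `b` starts, given by its first
edge. -/
noncomputable def startEdge (T : PlaneTree V) (κ : SegColor) (a b : V) : V :=
  match κ with
  | SegColor.red => (T.rot a).symm (T.dir a b)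
  | SegColor.green => T.dir a b

/-- The arc `p` is marked at `a` and `b`, and the segment between them is a label of the given
colour. -/
def ColorMark (T : PlaneTree V) (X : V → V → Prop) (κ : SegColor) (p : Set V) (a b : V) : Prop :=
  match κ with
  | SegColor.red => T.LowerMark X p a b
  | SegColor.green => T.UpperMark X p a b

/-- The arc `p` is marked at the corner of `a` that starts with the edge to `n`. -/
structure CornerMark (T : PlaneTree V) (X : V → V → Prop) (p : Set V) (a n : V) : Prop where
  isArc : T.IsArc p
  inner : T.IsInner a
  adj : T.graph.Adj a n
  mem : a ∈ p
  mem_next : n ∈ p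
  mem_rot : T.rot a n ∈ p
  agrees : T.Agrees X p a

lemma ColorMark.symm (h : T.ColorMark X κ p a b) : T.ColorMark X κ p b a := by
  cases κ
  · exact LowerMark.symm h
  · exact UpperMark.symm h

lemma ColorMark.mark (h : T.ColorMark X κ p a b) : T.Mark X p a b := by
  cases κ
  · exact Or.inl h
  · exact Or.inr h

lemma ColorMark.isSegment (h : T.ColorMark X κ p a b) : T.IsSegment (T.path a b) := by
  cases κ
  · exact LowerMark.isSegment h
  · exact UpperMark.isSegment h

lemma ColorMark.mem_iff (h : T.ColorMark X κ p a b) : X a b ↔ κ = SegColor.red := by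
  cases κ
  · exact iff_of_true (LowerMark.mem h) rfl
  · exact iff_of_false (UpperMark.notMem h) (by simp)

lemma Mark.exists_color (h : T.Mark X p a b) : ∃ κ, T.ColorMark X κ p a b :=
  h.elim (fun h => ⟨SegColor.red, h⟩) (fun h => ⟨SegColor.green, h⟩)

lemma startEdge_adj (hab : a ≠ b) : T.graph.Adj a (T.startEdge κ a b) := by
  cases κ
  · exact rot_symm_adj (adj_dir hab)
  · exact adj_dir hab

lemma ColorMark.cornerMark (h : T.ColorMark X κ p a b) :
    T.CornerMark X p a (T.startEdge κ a b) := by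
  have hd := h.mark.isArc.strip.isPathSet.dir_mem h.mark.mem_left h.mark.mem_right
  refine ⟨h.mark.isArc, h.mark.inner_left, startEdge_adj h.mark.ne, h.mark.mem_left, ?_, ?_,
    h.mark.agrees_left⟩
  · cases κ
    · exact LL.out_left (LowerMark.turns h)
    · exact hd
  · cases κ
    · change T.rot a ((T.rot a).symm _) ∈ p
      rwa [Equiv.apply_symm_apply]
    · exact RR.out_left (UpperMark.turns h)

lemma CornerMark.unique (h : T.CornerMark X p a n) (h' : T.CornerMark X q a n) : p = q :=
  h.agrees.eq_of_corner h'.agrees h.isArc h'.isArc h.inner h.adj h.mem h'.mem h.mem_next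
    h'.mem_next h.mem_rot h'.mem_rot

lemma exists_cornerMark [Finite V] (X : V → V → Prop) (ha : T.IsInner a)
    (hn : T.graph.Adj a n) : ∃ p, T.CornerMark X p a n := by
  obtain ⟨p, h1, h2, h3, h4, h5⟩ := exists_arc ha hn (X a)
  exact ⟨p, h1, ha, hn, h2, h3, h4, h5⟩

lemma CornerMark.corner_unique (h : T.CornerMark X p a n) (h' : T.CornerMark Y p a w) :
    n = w := by
  obtain ⟨x, y, hxy, rfl⟩ := isArc_iff.1 h.isArc
  have hb := hxy.btw h.mem h.inner
  have k1 := hxy.adj_mem hb h.adj h.mem_next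
  have k2 := hxy.adj_mem hb (rot_adj h.adj) h.mem_rot
  have k3 := hxy.adj_mem hb h'.adj h'.mem_next
  have k4 := hxy.adj_mem hb (rot_adj h'.adj) h'.mem_rot
  have n1 := rot_ne h.inner h.adj
  have n2 := rot_rot_ne h.inner h.adj
  have n3 := rot_ne h.inner h'.adj
  grind

lemma CornerMark.exists_colorMark (h : T.CornerMark X p a n) (hab : T.Mark X p a b) :
    ∃ κ, T.ColorMark X κ p a b ∧ n = T.startEdge κ a b := by
  obtain ⟨κ, hκ⟩ := hab.exists_color
  exact ⟨κ, hκ, h.corner_unique hκ.cornerMark⟩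

lemma CornerMark.good (h : T.CornerMark X p a n) (hX : T.Biclosed X) : T.Good X p :=
  h.agrees.good hX h.isArc h.mem h.inner

lemma CornerMark.exists_mark_of_sep [Finite V] (h : T.CornerMark X p a n) (hX : T.Biclosed X)
    (hb : T.IsInner b) (hs : T.Sep p a b) : ∃ c, T.Mark X p a c := by
  obtain ⟨c, hc, hci, hag, hcs⟩ := (h.good hX).exists_agrees_side hX h.isArc hb
  refine ⟨c, Agrees.sep hX h.isArc h.mem hc h.inner hci h.agrees hag ?_⟩
  rintro rfl
  exact hcs hs.symm

lemma isEndCorner_startEdge (ha : T.IsInner a) (hab : a ≠ b) :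
    T.IsEndCorner (κ, T.path a b) ⟨a, T.startEdge κ a b, ha, startEdge_adj hab⟩ := by
  refine ⟨isEndpoint_left a b, ?_⟩
  cases κ
  · change T.rot a ((T.rot a).symm _) ∈ T.path a b
    rw [Equiv.apply_symm_apply]
    exact dir_mem
  · exact dir_mem

/-- The arcs `p` and `q` do not divide the vertices into four parts. -/
lemma Mark.no_quadrant [Finite V] (hX : T.Biclosed X) (h : T.Mark X p a b)
    (h' : T.Mark X q c d) (hpq : p ≠ q) (hz : T.IsInner z) (h1 : T.Sep p z c)
    (h2 : T.Sep q z a) : False := by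
  have hp := h.isArc
  have hq := h'.isArc
  have h1' : T.Sep p z d := by
    have h3 := h'.not_sep hX hp (h.good hX) hpq
    exact ((sep_trans hp h'.inner_left h'.inner_right hz h3).1 h1.symm).symm
  have h2' : T.Sep q z b := by
    have h3 := h.not_sep hX hq (h'.good hX) hpq.symm
    exact ((sep_trans hq h.inner_left h.inner_right hz h3).1 h2.symm).symm
  -- A chain of labels starting at `z` never leaves the part on the side of `z` for both arcs:
  -- leaving it would use the label of `p` or `q`, whose ends lie across the other arc. This
  -- contradicts connectedness.
  have key : ∀ y, Relation.ReflTransGen (fun a b => ∃ p, T.Mark X p a b) z y →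
      T.IsInner y ∧ ¬ T.Sep p z y ∧ ¬ T.Sep q z y := by
    intro y hy
    induction hy with
    | refl => exact ⟨hz, not_sep_self, not_sep_self⟩
    | @tail x y _ hxy ih =>
      obtain ⟨hx, i1, i2⟩ := ih
      obtain ⟨r, hr⟩ := hxy
      have hrp : p ≠ r := by
        rintro rfl
        rcases h.eq_or hX hr.agrees_left hr.mem_left hr.inner_left with rfl | rfl
        · exact i2 h2
        · exact i2 h2'
      have hrq : q ≠ r := by
        rintro rfl
        rcases h'.eq_or hX hr.agrees_left hr.mem_left hr.inner_left with rfl | rfl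
        · exact i1 h1
        · exact i1 h1'
      have h3 := hr.not_sep hX hp (h.good hX) hrp
      have h4 := hr.not_sep hX hq (h'.good hX) hrq
      refine ⟨hr.inner_right, fun hs => i1 ?_, fun hs => i2 ?_⟩
      · exact ((sep_trans hp hr.inner_left hr.inner_right hz h3).2 hs.symm).symm
      · exact ((sep_trans hq hr.inner_left hr.inner_right hz h4).2 hs.symm).symm
  exact (key a (marks_connected hX hz h.inner_left)).2.2 h2

end Corners

/-! ### The labels of a facet form a red-green tree -/

section Trees

variable {T : PlaneTree V} {X Y : V → V → Prop} {κ κ' : SegColor} {p q : Set V}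
  {a b c d n u v w z : V}

/-- The graph of labels. -/
def labelGraph (T : PlaneTree V) (X : V → V → Prop) : SimpleGraph T.Inner where
  Adj a b := ∃ p, T.Mark X p a.1 b.1
  symm := ⟨fun _ _ ⟨p, hp⟩ => ⟨p, hp.symm⟩⟩
  loopless := ⟨fun _ ⟨_, hp⟩ => hp.ne rfl⟩

/-- Each label is a bridge, because it is the only one whose ends are separated by its arc. -/
lemma labelGraph_isTree [Finite V] [Nonempty T.Inner] (hX : T.Biclosed X) :
    (T.labelGraph X).IsTree := by
  have hconn : (T.labelGraph X).Connected := by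
    rw [SimpleGraph.connected_iff]
    refine ⟨fun u v => ?_, inferInstance⟩
    rw [SimpleGraph.reachable_iff_reflTransGen]
    have key : ∀ z, Relation.ReflTransGen (fun a b => ∃ p, T.Mark X p a b) u.1 z →
        ∃ hz : T.IsInner z, Relation.ReflTransGen (T.labelGraph X).Adj u ⟨z, hz⟩ := by
      intro z hz
      induction hz with
      | refl => exact ⟨u.2, Relation.ReflTransGen.refl⟩
      | tail _ h2 ih =>
        obtain ⟨hy, h3⟩ := ih
        obtain ⟨p, hp⟩ := h2
        exact ⟨hp.inner_right, h3.tail ⟨p, hp⟩⟩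
    exact (key _ (marks_connected hX u.2 v.2)).2
  refine ⟨hconn, SimpleGraph.isAcyclic_iff_forall_adj_isBridge.2 fun u v huv => ?_⟩
  rw [SimpleGraph.isBridge_iff, SimpleGraph.reachable_iff_reflTransGen]
  obtain ⟨p, hp⟩ := huv
  intro h
  suffices ∀ z, Relation.ReflTransGen ((T.labelGraph X).deleteEdges {s(u, v)}).Adj u z →
      ¬ T.Sep p u.1 z.1 from this v h hp.sep
  intro z hz
  induction hz with
  | refl => exact not_sep_self
  | @tail x y _ hxy ih =>
    rw [SimpleGraph.deleteEdges_adj] at hxy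
    obtain ⟨⟨q, hq⟩, hne⟩ := hxy
    have hpq : p ≠ q := by
      rintro rfl
      apply hne
      have h1 := Mark.eq_of_eq hp hq hX
      rw [path_eq_iff] at h1
      rw [Set.mem_singleton_iff, Sym2.eq_iff]
      rcases h1 with ⟨e1, e2⟩ | ⟨e1, e2⟩
      · exact Or.inl ⟨Subtype.ext e1.symm, Subtype.ext e2.symm⟩
      · exact Or.inr ⟨Subtype.ext e2.symm, Subtype.ext e1.symm⟩
    have h1 := hq.not_sep hX hp.isArc (hp.good hX) hpq
    exact fun hs => ih ((sep_trans hp.isArc x.2 y.2 u.2 h1).2 hs.symm).symm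

/-- The red-green tree of labels. -/
def labelTree (T : PlaneTree V) (X : V → V → Prop) : Set (SegColor × Set V) :=
  {x | ∃ p a b, T.ColorMark X x.1 p a b ∧ x.2 = T.path a b}

lemma labelTree_eq [Finite V] {F : T.Facet} (hX : T.Biclosed X) (hF : F.1 = T.facetOf X) :
    T.labelTree X = redGreen (T.lowerLabels F) (T.upperLabels F) := by
  ext ⟨κ, s⟩
  unfold labelTree redGreen
  cases κ
  · simp [mem_lowerLabels hX hF, ColorMark]
  · simp [mem_upperLabels hX hF, ColorMark]

lemma labelTree_isRedGreenTree [Finite V] (hX : T.Biclosed X) :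
    T.IsRedGreenTree (T.labelTree X) where
  isSegment := by
    rintro ⟨κ, s⟩ ⟨p, a, b, h, he⟩
    dsimp only at h he ⊢
    rw [he]
    exact h.isSegment
  noncrossing := by
    rintro ⟨κ, s⟩ ⟨p, a, b, h, he⟩ ⟨κ', t⟩ ⟨q, c, d, h', he'⟩ hne
    dsimp only at h he h' he'
    subst he he'
    cases κ <;> cases κ'
    · exact LowerMark.noncrossing hX h h' fun e => hne (by rw [e])
    · exact LowerMark.noncrossing_upperMark hX h h'
    · exact (LowerMark.noncrossing_upperMark hX h' h).symm h'.isSegment h.isSegment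
    · exact UpperMark.noncrossing hX h h' fun e => hne (by rw [e])
  connected u v hu hv := by
    refine Relation.ReflTransGen.mono ?_ _ _ (marks_connected hX hu hv)
    rintro a b ⟨p, hp⟩
    obtain ⟨κ, hκ⟩ := hp.exists_color
    exact ⟨(κ, T.path a b), ⟨p, a, b, hκ, rfl⟩, rfl⟩

end Trees

/-! ### Every red-green tree consists of labels -/

section Classification

variable {T : PlaneTree V} {X : V → V → Prop} {κ κ' : SegColor} {p q t : Set V}
  {a b c d e f n u v w z : V} {𝒯 : Set (SegColor × Set V)}

/-- A red-green tree whose red segments are the lower labels belonging to `X`. -/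
structure Extends (T : PlaneTree V) (X : V → V → Prop) (𝒯 : Set (SegColor × Set V)) : Prop where
  tree : T.IsRedGreenTree 𝒯
  red : ∀ a b, (SegColor.red, T.path a b) ∈ 𝒯 ↔ ∃ p, T.LowerMark X p a b
  green : ∀ t, (SegColor.green, t) ∈ 𝒯 → ∀ e f, e ∈ t → f ∈ t → X e f → ¬ T.OutL t e f →
    T.OutL t f e

namespace Extends

lemma isSeg (h : T.Extends X 𝒯) (hx : (κ, T.path a b) ∈ 𝒯) : T.IsSeg a b := by
  obtain ⟨c, d, hcd, he⟩ := isSegment_iff.1 (h.tree.isSegment _ hx)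
  rcases path_eq_iff.1 he with ⟨rfl, rfl⟩ | ⟨rfl, rfl⟩
  · exact hcd
  · exact hcd.symm

lemma eq_of_startEdge (h : T.Extends X 𝒯) (hx : (κ, T.path a b) ∈ 𝒯)
    (hy : (κ', T.path a c) ∈ 𝒯) (he : T.startEdge κ a b = T.startEdge κ' a c) :
    κ = κ' ∧ b = c := by
  have hb := h.isSeg hx
  have hc := h.isSeg hy
  by_cases hxy : (κ, T.path a b) = (κ', T.path a c)
  · rw [Prod.mk.injEq] at hxy
    exact ⟨hxy.1, path_inj_right hxy.2⟩
  · exfalso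
    have h1 := isEndCorner_startEdge (T := T) (κ := κ) hb.left hb.ne
    have h2 := isEndCorner_startEdge (T := T) (κ := κ') hc.left hc.ne
    simp only [he] at h1
    exact (h.tree.noncrossing _ hx _ hy hxy).1 _ ⟨h1, h2⟩

/-- The arc marked at the corner where the curve of a segment starts separates its endpoints. -/
lemma sep (h : T.Extends X 𝒯) (hx : (κ, T.path a b) ∈ 𝒯)
    (hp : T.CornerMark X p a (T.startEdge κ a b)) : T.Sep p a b := by
  have hab := h.isSeg hx
  cases κ
  · obtain ⟨q, hq⟩ := (h.red a b).1 hx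
    have : T.ColorMark X SegColor.red q a b := hq
    rw [hp.unique this.cornerMark]
    exact hq.turns.sep hq.isArc.strip
  · have hd : T.dir a b ∈ p := hp.mem_next
    have hr : T.rot a (T.dir a b) ∈ p := hp.mem_rot
    have hps := hp.isArc.strip.isPathSet
    have hg := gate_mem hps b
    have hgi := gate_inner hp.isArc hab.right
    have hge := gate_eq_or_dir_notMem hps b
    have hga : T.gate p b ≠ a := by
      intro e
      rw [e] at hge
      rcases hge with e' | e'
      · exact hab.ne e'
      · exact e' hd
    have hgp := gate_mem_path hps b hp.mem
    rw [path_comm] at hgp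
    have hda := dir_eq_of_mem hgp hga
    unfold Sep
    rw [gate_of_mem hps hp.mem]
    generalize T.gate p b = g at *
    have h1 : T.OutR p g a := by rw [OutR, hda]; exact hr
    have h2 := hp.isArc.outL_iff_not hg hp.mem hp.inner hga
    have h3 := hp.agrees g hg hgi hga
    have h4 := hp.isArc.outL_iff_not hp.mem hg hgi hga.symm
    have h5 := h.green _ hx a g (left_mem a b) hgp
    have h6 := not_out_left hab.left hgp hga
    -- If `p` turned left at the gate `g` of `b`, then `[a, g]` would be in `X`. The green segment,
    -- which does not turn at its end `a`, would have to turn left at `g` too, but there it ends or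
    -- leaves `p`.
    have h7 : ¬ T.OutL p a g := by
      intro h8
      have h9 : T.OutL (T.path a b) a g := by
        by_contra h9
        exact h6.1 (h5 (h3.2 h8) h9)
      by_cases hgb : g = b
      · subst hgb
        exact (not_out_right hab.right (left_mem _ _) hab.ne).1 h9
      · exact (hab.strip.not_outL_of_exit (left_mem _ _) (right_mem _ _) ⟨hga, hgb, hgp⟩
          (hge.resolve_left hgb)).1 h9 h8
    exact ⟨hga.symm, by grind⟩

/-- The corner where the curve of a segment starts belongs to a label. -/
lemma exists_colorMark [Finite V] (h : T.Extends X 𝒯) (hX : T.Biclosed X)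
    (hx : (κ, T.path a b) ∈ 𝒯) :
    ∃ κ' p c, T.ColorMark X κ' p a c ∧ T.startEdge κ a b = T.startEdge κ' a c ∧
      T.Sep p a b := by
  have hab := h.isSeg hx
  obtain ⟨p, hp⟩ := exists_cornerMark X hab.left (startEdge_adj (T := T) (κ := κ) hab.ne)
  have hs := h.sep hx hp
  obtain ⟨c, hc⟩ := hp.exists_mark_of_sep hX hab.right hs
  obtain ⟨κ', h1, h2⟩ := hp.exists_colorMark hc
  exact ⟨κ', p, c, h1, h2, hs⟩

/-- The graph of a red-green tree. -/
def toGraph (h : T.Extends X 𝒯) : SimpleGraph T.Inner where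
  Adj a b := ∃ κ, (κ, T.path a.1 b.1) ∈ 𝒯
  symm := ⟨fun a b ⟨κ, hκ⟩ => ⟨κ, by rwa [path_comm]⟩⟩
  loopless := ⟨fun _ ⟨_, hκ⟩ => (h.isSeg hκ).ne rfl⟩

lemma toGraph_connected [Nonempty T.Inner] (h : T.Extends X 𝒯) : h.toGraph.Connected := by
  rw [SimpleGraph.connected_iff]
  refine ⟨fun u v => ?_, inferInstance⟩
  rw [SimpleGraph.reachable_iff_reflTransGen]
  have key : ∀ z, Relation.ReflTransGen (fun a b => ∃ x ∈ 𝒯, x.2 = T.path a b) u.1 z →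
      ∃ hz : T.IsInner z, Relation.ReflTransGen h.toGraph.Adj u ⟨z, hz⟩ := by
    intro z hz
    induction hz with
    | refl => exact ⟨u.2, Relation.ReflTransGen.refl⟩
    | @tail y z _ h2 ih =>
      obtain ⟨hy, h3⟩ := ih
      obtain ⟨⟨κ, s⟩, hx, he⟩ := h2
      dsimp only at he
      subst he
      exact ⟨(h.isSeg hx).right, h3.tail ⟨κ, hx⟩⟩
  exact (key _ (h.tree.connected _ _ u.2 v.2)).2

/-- The curves of a red-green tree use all corners that belong to labels. -/
lemma exists_of_colorMark [Finite V] (h : T.Extends X 𝒯) (hX : T.Biclosed X)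
    (hm : T.ColorMark X κ p a b) :
    ∃ κ' c, (κ', T.path a c) ∈ 𝒯 ∧ T.startEdge κ' a c = T.startEdge κ a b := by
  classical
  have : Nonempty T.Inner := ⟨⟨a, hm.mark.inner_left⟩⟩
  -- `H` is the set of start corners of labels. The darts of the given graph inject into `H`, and
  -- the darts of the tree of labels map onto it; the colour of a label is recovered from its
  -- membership in `X`.
  let H : Set (V × V) := {y | ∃ κ p b, T.ColorMark X κ p y.1 b ∧ y.2 = T.startEdge κ y.1 b}
  have hadj : ∀ d : h.toGraph.Dart, ∃ κ, (κ, T.path d.fst.1 d.snd.1) ∈ 𝒯 := fun d => d.adj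
  choose col hcol using hadj
  let f : h.toGraph.Dart → V × V := fun d =>
    (d.fst.1, T.startEdge (col d) d.fst.1 d.snd.1)
  have hf : Function.Injective f := by
    rintro ⟨⟨⟨a, ha⟩, ⟨b, hb⟩⟩, hab⟩ ⟨⟨⟨c, hc⟩, ⟨d, hd⟩⟩, hcd⟩ he
    rw [Prod.mk.injEq] at he
    obtain ⟨hac, he⟩ := he
    dsimp only at hac
    subst hac
    obtain rfl := (h.eq_of_startEdge (hcol ⟨(⟨a, ha⟩, ⟨b, hb⟩), hab⟩)
      (hcol ⟨(⟨a, hc⟩, ⟨d, hd⟩), hcd⟩) he).2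
    rfl
  have hfH : Set.range f ⊆ H := by
    rintro _ ⟨d, rfl⟩
    obtain ⟨κ', p, c, h1, h2, -⟩ := h.exists_colorMark hX (hcol d)
    exact ⟨κ', p, c, h1, h2⟩
  let g : (T.labelGraph X).Dart → V × V := fun d =>
    (d.fst.1, T.startEdge (if X d.fst.1 d.snd.1 then SegColor.red else SegColor.green)
      d.fst.1 d.snd.1)
  have hg : H ⊆ Set.range g := by
    rintro ⟨a, n⟩ ⟨κ, p, b, h1, h2⟩
    dsimp only at h1 h2
    refine ⟨⟨(⟨a, h1.mark.inner_left⟩, ⟨b, h1.mark.inner_right⟩), ⟨p, h1.mark⟩⟩, ?_⟩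
    have h3 := h1.mem_iff
    simp only [g]
    rw [h2]
    cases κ <;> simp_all
  have hle : H.ncard ≤ (Set.range f).ncard := by
    rw [Set.ncard_range_of_injective hf]
    have h1 := card_dart_le (labelGraph_isTree hX) h.toGraph_connected
    have h2 : H.ncard ≤ (Set.range g).ncard := Set.ncard_le_ncard hg (Set.toFinite _)
    have := Fintype.ofFinite T.Inner
    have h3 : (Set.range g).ncard ≤ Nat.card (T.labelGraph X).Dart := Finite.card_range_le g
    omega
  have heq := Set.eq_of_subset_of_ncard_le hfH hle (Set.toFinite _)
  obtain ⟨d, hd⟩ : (a, T.startEdge κ a b) ∈ Set.range f := heq ▸ ⟨κ, p, b, hm, rfl⟩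
  rw [Prod.mk.injEq] at hd
  obtain ⟨rfl, hd⟩ := hd
  exact ⟨col d, d.snd.1, hcol d, hd⟩

/-- Induct on the number of vertices across `p` from `a`. Some curve starts in the corner of the
label at `a`; a red one is that label. A green one ends at a vertex `v` across `p`, in the corner of
a label carried by some `q`. If `q = p`, then `v = b`. Otherwise the label of `q` lies across `p`,
belongs to the tree by induction, and shares its corner at `v` with the green curve; so it ends at
`a`, which is not across `p`. -/
lemma mem_of_colorMark [Finite V] (h : T.Extends X 𝒯) (hX : T.Biclosed X)
    (hm : T.ColorMark X κ p a b) : (κ, T.path a b) ∈ 𝒯 := by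
  induction hk : {z | T.IsInner z ∧ T.Sep p a z}.ncard using Nat.strong_induction_on
    generalizing κ p a b with
  | _ k ih =>
  obtain ⟨κ', v, hx, he⟩ := h.exists_of_colorMark hX hm
  have hav := h.isSeg hx
  cases κ' with
  | red =>
    obtain ⟨q, hq⟩ := (h.red a v).1 hx
    have hq' : T.ColorMark X SegColor.red q a v := hq
    have hpq : q = p := (he ▸ hq'.cornerMark).unique hm.cornerMark
    subst hpq
    have h1 := path_inj_right (Mark.eq_of_eq hm.mark hq'.mark hX)
    subst h1
    rw [hm.mem_iff.1 hq.mem]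
    exact hx
  | green =>
    have hsep : T.Sep p a v := h.sep hx (he ▸ hm.cornerMark)
    have hx' : (SegColor.green, T.path v a) ∈ 𝒯 := by rwa [path_comm]
    obtain ⟨κ'', q, w, hq, he', -⟩ := h.exists_colorMark hX hx'
    by_cases hpq : p = q
    · subst hpq
      have hvb : v = b := (hm.mark.eq_or hX hq.mark.agrees_left hq.mark.mem_left
        hq.mark.inner_left).resolve_left hav.ne.symm
      subst hvb
      cases κ with
      | green => exact hx
      | red => exact absurd he.symm (rot_symm_ne hav.left (adj_dir hav.ne))
    · exfalso
      have hpa := hm.mark.isArc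
      have hqa := hq.mark.isArc
      have hvw := hq.mark.not_sep hX hpa (hm.mark.good hX) hpq
      have hsepw : T.Sep p a w :=
        ((sep_trans hpa hq.mark.inner_left hq.mark.inner_right hav.left hvw).1 hsep.symm).symm
      -- The far side of `q`, seen from its mark on the side of `a`, is strictly smaller: by
      -- `no_quadrant` it lies within the far side of `p`, and it omits that mark.
      have key : ∀ c d, T.ColorMark X κ'' q c d → T.Sep p a c → ¬ T.Sep q c a →
          (κ'', T.path c d) ∈ 𝒯 := by
        intro c d hcd hpc hqc
        refine ih _ ?_ hcd rfl
        rw [← hk]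
        refine Set.ncard_lt_ncard ⟨fun z hz => ⟨hz.1, ?_⟩, fun hsub => ?_⟩ (Set.toFinite _)
        · by_contra hz'
          have h1 := (sep_trans hpa hav.left hz.1 hcd.mark.inner_left hz').1 hpc
          have h2 : T.Sep q z a := by
            have := (sep_trans' hqa hcd.mark.inner_left hz.1 hav.left hz.2)
            exact not_not.1 fun h3 => hqc (this.2 h3)
          exact hm.mark.no_quadrant hX hcd.mark hpq hz.1 h1 h2
        · exact not_sep_self (hsub ⟨hcd.mark.inner_left, hpc⟩).2
      have hy : (κ'', T.path v w) ∈ 𝒯 := by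
        by_cases hqs : T.Sep q v a
        · rw [path_comm]
          exact key w v hq.symm hsepw
            ((sep_trans' hqa hq.mark.inner_left hq.mark.inner_right hav.left hq.mark.sep).1 hqs)
        · exact key v w hq hsep hqs
      have h1 := (h.eq_of_startEdge hx' hy he').2
      subst h1
      exact not_sep_self hsepw

lemma eq_labelTree [Finite V] (h : T.Extends X 𝒯) (hX : T.Biclosed X) : 𝒯 = T.labelTree X := by
  ext ⟨κ, s⟩
  constructor
  · intro hx
    obtain ⟨a, b, hab, he⟩ := isSegment_iff.1 (h.tree.isSegment _ hx)
    dsimp only at he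
    subst he
    obtain ⟨κ', p, c, h1, h2, -⟩ := h.exists_colorMark hX hx
    obtain ⟨rfl, rfl⟩ := h.eq_of_startEdge hx (h.mem_of_colorMark hX h1) h2
    exact ⟨p, a, b, h1, rfl⟩
  · rintro ⟨p, a, b, h1, h2⟩
    dsimp only at h1 h2
    rw [h2]
    exact h.mem_of_colorMark hX h1

end Extends

lemma IsRedGreenTree.redFamily [Finite V] (h : T.IsRedGreenTree 𝒯) :
    T.RedFamily (colorPart SegColor.red 𝒯) :=
  redFamily_of_noncrossing (fun _ hs => h.isSegment _ hs)
    fun _ hs _ ht hne => h.noncrossing _ hs _ ht fun e => hne (congrArg Prod.snd e)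

/-- A green segment violating the last condition would turn left at neither end of a spanned
segment, hence be overlapped by one of the red segments. -/
lemma IsRedGreenTree.extends [Finite V] (h : T.IsRedGreenTree 𝒯) :
    T.Extends (T.span (colorPart SegColor.red 𝒯)) 𝒯 where
  tree := h
  red a b := by
    constructor
    · intro hx
      obtain ⟨c, d, hcd, he⟩ := isSegment_iff.1 (h.isSegment _ hx)
      have hab : T.IsSeg a b := by
        rcases path_eq_iff.1 he with ⟨rfl, rfl⟩ | ⟨rfl, rfl⟩
        · exact hcd
        · exact hcd.symm
      exact h.redFamily.exists_lowerMark hx hab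
    · rintro ⟨p, hp⟩
      exact h.redFamily.path_mem hp
  green t ht e f he hf hef hL := by
    by_contra hL'
    have hseg := h.isSegment _ ht
    obtain ⟨s, hs, x, y, -, -, ho⟩ := RedFamily.exists_overlap hseg.strip hef he hf hL hL'
    exact (h.noncrossing _ hs _ ht (by simp)).not_overlap (h.isSegment _ hs) hseg ho

/-- A red-green tree consists of the labels of a facet. -/
lemma IsRedGreenTree.eq_labelTree [Finite V] (h : T.IsRedGreenTree 𝒯) :
    𝒯 = T.labelTree (T.span (colorPart SegColor.red 𝒯)) :=
  h.extends.eq_labelTree h.redFamily.biclosed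

end Classification

/-! ### A facet is determined by its labels -/

section Uniqueness

variable {T : PlaneTree V} {X Y : V → V → Prop} {κ : SegColor} {p q r : Set V}
  {a b c n u v w z : V}

lemma CornerMark.outL_iff (h : T.CornerMark X p a n) (hw : w ∈ p) (hwa : w ≠ a) :
    T.OutL p w a ↔ T.dir a w = T.rot a n := by
  have hadj := adj_dir (T := T) hwa.symm
  have hd := h.isArc.strip.isPathSet.dir_mem h.mem hw
  unfold OutL
  constructor
  · intro h1
    obtain ⟨x, y, hxy, rfl⟩ := isArc_iff.1 h.isArc
    have hb := hxy.btw h.mem h.inner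
    have k1 := hxy.adj_mem hb h.adj h.mem_next
    have k2 := hxy.adj_mem hb (rot_adj h.adj) h.mem_rot
    have k3 := hxy.adj_mem hb hadj hd
    have k4 := hxy.adj_mem hb (rot_symm_adj hadj) h1
    have n1 := rot_ne h.inner h.adj
    have n2 := rot_symm_ne h.inner hadj
    have n3 := rot_symm_ne_rot h.inner h.adj
    grind
  · intro h1
    rw [h1, Equiv.symm_apply_apply]
    exact h.mem_next

lemma exists_colorMark_of_labelTree (h : T.labelTree X ⊆ T.labelTree Y)
    (hm : T.ColorMark X κ p a b) : ∃ q, T.ColorMark Y κ q a b := by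
  obtain ⟨q, c, d, h1, h2⟩ := h (show (κ, T.path a b) ∈ T.labelTree X from ⟨p, a, b, hm, rfl⟩)
  dsimp only at h1 h2
  rcases path_eq_iff.1 h2 with ⟨rfl, rfl⟩ | ⟨rfl, rfl⟩
  · exact ⟨q, h1⟩
  · exact ⟨q, h1.symm⟩

/-- Walk from `a` along the labels: the side of the marked arc changes only along the label starting
in that corner, and this is the same label for `X` and `Y`. -/
lemma CornerMark.sep_congr [Finite V] (hX : T.Biclosed X) (hY : T.Biclosed Y)
    (h : T.labelTree X ⊆ T.labelTree Y) (hp : T.CornerMark X p a n) (hq : T.CornerMark Y q a n)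
    (hw : T.IsInner w) (hs : T.Sep p a w) : T.Sep q a w := by
  obtain ⟨c, hc⟩ := hp.exists_mark_of_sep hX hw hs
  obtain ⟨κ, hm, he⟩ := hp.exists_colorMark hc
  obtain ⟨q', hm'⟩ := exists_colorMark_of_labelTree h hm
  obtain rfl : q' = q := (he ▸ hm'.cornerMark).unique hq
  have hpa := hp.isArc
  have hqa := hq.isArc
  suffices ∀ z, Relation.ReflTransGen (fun a b => ∃ p, T.Mark X p a b) a z →
      T.IsInner z ∧ (T.Sep p a z ↔ T.Sep q' a z) from
    (this w (marks_connected hX hp.inner hw)).2.1 hs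
  intro z hz
  induction hz with
  | refl => exact ⟨hp.inner, iff_of_false not_sep_self not_sep_self⟩
  | @tail x y _ hxy ih =>
    obtain ⟨r, hr⟩ := hxy
    refine ⟨hr.inner_right, ?_⟩
    by_cases hxyc : T.path x y = T.path a c
    · have : y = a ∨ y = c := by
        rw [path_eq_iff] at hxyc
        grind
      rcases this with rfl | rfl
      · exact iff_of_false not_sep_self not_sep_self
      · exact iff_of_true hm.mark.sep hm'.mark.sep
    · obtain ⟨κ', hκ'⟩ := hr.exists_color
      obtain ⟨r', hr'⟩ := exists_colorMark_of_labelTree h hκ'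
      have h1 : p ≠ r := by
        rintro rfl
        exact hxyc (Mark.eq_of_eq hr hc hX)
      have h2 : q' ≠ r' := by
        rintro rfl
        exact hxyc (Mark.eq_of_eq hr'.mark hm'.mark hY)
      have h3 := hr.not_sep hX hpa (hp.good hX) h1
      have h4 := hr'.mark.not_sep hY hqa (hq.good hY) h2
      have h5 := sep_trans hpa hr.inner_left hr.inner_right hp.inner h3
      have h6 := sep_trans hqa hr.inner_left hr.inner_right hp.inner h4
      exact ⟨fun k => (h6.1 (ih.2.1 (h5.2 k.symm).symm).symm).symm,
        fun k => (h5.1 (ih.2.2 (h6.2 k.symm).symm).symm).symm⟩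

/-- The turn of an arc at `w` is determined by the direction of `w` from the corner and by whether
the arc separates `w` from the vertex of the corner. -/
lemma CornerMark.eq_of_labelTree [Finite V] (hX : T.Biclosed X) (hY : T.Biclosed Y)
    (h : T.labelTree X = T.labelTree Y) (hp : T.CornerMark X p a n)
    (hq : T.CornerMark Y q a n) : p = q := by
  refine hp.isArc.eq_of_turns hq.isArc hp.inner hp.adj hp.mem hq.mem hp.mem_next hq.mem_next
    hp.mem_rot hq.mem_rot fun w hwp hwq hwi hwa => ?_
  have h1 := hp.outL_iff hwp hwa
  have h2 := hq.outL_iff hwq hwa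
  have h3 := sep_iff_of_mem hp.isArc.strip hp.mem hwp
  have h4 := sep_iff_of_mem hq.isArc.strip hq.mem hwq
  have h5 := hp.sep_congr hX hY h.subset hq hwi
  have h6 := hq.sep_congr hY hX h.symm.subset hp hwi
  grind

lemma facetOf_subset_of_labelTree [Finite V] (hX : T.Biclosed X) (hY : T.Biclosed Y)
    (h : T.labelTree X = T.labelTree Y) : T.facetOf X ⊆ T.facetOf Y := by
  rintro p ⟨hp, hb, hg⟩
  obtain ⟨a, ha, hai⟩ : ∃ a ∈ p, T.IsInner a := by
    obtain ⟨a, b, hab | hab⟩ := hb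
    · exact ⟨a, hab.mem_left, hab.inner_left⟩
    · exact ⟨a, hab.mem_left, hab.inner_left⟩
  obtain ⟨v, hv, hvi, hag, -⟩ := hg.exists_agrees hX hp ha hai
  obtain ⟨n, hn, hnp, hrp⟩ := hp.exists_corner hv hvi
  have hpc : T.CornerMark X p v n := ⟨hp, hvi, hn, hv, hnp, hrp, hag⟩
  obtain ⟨q, hq⟩ := exists_cornerMark Y hvi hn
  rw [hpc.eq_of_labelTree hX hY h hq] at hb ⊢
  exact ⟨hq.isArc, hb, hq.good hY⟩

/-- A red-green tree is determined by its red part, so equal lower labels give equal trees of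
labels, and these determine all marked arcs. -/
lemma facet_eq_of_lowerLabels [Finite V] {F G : T.Facet}
    (h : T.lowerLabels F = T.lowerLabels G) : F = G := by
  obtain ⟨X, hX, -, hF⟩ := exists_facetOf (isFacet_iff.1 F.2)
  obtain ⟨Y, hY, -, hG⟩ := exists_facetOf (isFacet_iff.1 G.2)
  have h1 := (labelTree_isRedGreenTree hX).eq_labelTree
  have h2 := (labelTree_isRedGreenTree hY).eq_labelTree
  have key : ∀ {X : V → V → Prop} {F : T.Facet}, T.Biclosed X → F.1 = T.facetOf X →
      colorPart SegColor.red (T.labelTree X) = T.lowerLabels F := by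
    intro X F hX hF
    rw [labelTree_eq hX hF]
    ext s
    simp [colorPart, redGreen]
  rw [key hX hF] at h1
  rw [key hY hG, ← h, ← h1] at h2
  refine Subtype.ext ?_
  rw [hF, hG]
  exact (facetOf_subset_of_labelTree hX hY h2.symm).antisymm
    (facetOf_subset_of_labelTree hY hX h2)

end Uniqueness

/-! ### Bijections with noncrossing tree partitions and the Kreweras complement -/

section Kreweras

variable {T : PlaneTree V}

/-- The facet spanned by pairwise noncrossing red segments. -/
def RedFamily.facet [Finite V] {S : Set (Set V)} (hS : T.RedFamily S) : T.Facet :=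
  ⟨T.facetOf (T.span S), isFacet_iff.2 (facetOf_maximal hS.biclosed)⟩

lemma RedFamily.lowerLabels_facet [Finite V] {S : Set (Set V)} (hS : T.RedFamily S) :
    T.lowerLabels hS.facet = S := by
  ext s
  rw [mem_lowerLabels hS.biclosed rfl]
  constructor
  · rintro ⟨p, a, b, h, rfl⟩
    exact hS.path_mem h
  · intro hs
    obtain ⟨a, b, hab, rfl⟩ := isSegment_iff.1 (hS.isSegment s hs)
    obtain ⟨p, hp⟩ := hS.exists_lowerMark hs hab
    exact ⟨p, a, b, hp, rfl⟩

lemma isRedGreenTree_redGreen [Finite V] (F : T.Facet) :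
    T.IsRedGreenTree (redGreen (T.lowerLabels F) (T.upperLabels F)) := by
  obtain ⟨X, hX, -, hF⟩ := exists_facetOf (isFacet_iff.1 F.2)
  rw [← labelTree_eq hX hF]
  exact labelTree_isRedGreenTree hX

lemma IsRedGreenTree.exists_facet [Finite V] {𝒯 : Set (SegColor × Set V)}
    (h : T.IsRedGreenTree 𝒯) :
    ∃ F : T.Facet, 𝒯 = redGreen (T.lowerLabels F) (T.upperLabels F) :=
  ⟨h.redFamily.facet, h.eq_labelTree.trans (labelTree_eq h.redFamily.biclosed rfl)⟩

/-- The map from facets to noncrossing tree partitions. -/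
def facetNCP [Finite V] (F : T.Facet) : T.NCP := ⟨T.rho F, isNCP_rho F⟩

/-- The segments of the partition are the lower labels, which determine the facet; conversely, the
segments of any noncrossing tree partition span a facet with these lower labels. -/
lemma facetNCP_bijective [Finite V] : Function.Bijective (facetNCP (T := T)) := by
  constructor
  · intro F G h
    have h' : T.rho F = T.rho G := congrArg Subtype.val h
    refine facet_eq_of_lowerLabels ?_
    rw [← segOf_rho, ← segOf_rho, h']
  · rintro ⟨P, hP⟩
    have hS : T.RedFamily (T.segOf P) :=
      redFamily_of_noncrossing (fun _ => isSegment_of_mem_segOf) hP.1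
    refine ⟨hS.facet, Subtype.ext ?_⟩
    refine (isNCP_rho _).eq_of_segOf hP ?_
    rw [segOf_rho, hS.lowerLabels_facet]

lemma mirror_segOf (P : Setoid T.Inner) : T.mirror.segOf P = T.segOf P :=
  Set.ext fun _ => ((mem_segOf_iff (T := T.mirror) (P := P)).trans
    (exists₂_congr fun a b => and_congr_left fun _ => mirror_isSeg (T := T) a.1 b.1)).trans
      (mem_segOf_iff (T := T)).symm

lemma mirror_segmentConnected (P : Setoid T.Inner) :
    (∀ B ∈ T.mirror.blocks P, T.mirror.SegmentConnected B) ↔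
      ∀ B ∈ T.blocks P, T.SegmentConnected B := by
  refine ((segmentConnected_iff (T := T.mirror) (P := P)).trans ?_).trans
    (segmentConnected_iff (T := T)).symm
  refine forall₃_congr fun u v _ => ?_
  have h : (fun x y => T.mirror.path x y ∈ T.mirror.segOf P) =
      fun x y => T.path x y ∈ T.segOf P :=
    funext₂ fun x y => congrArg (T.path x y ∈ ·) (mirror_segOf P)
  exact iff_of_eq (congrArg (fun r => Relation.ReflTransGen r (u : V) v) h)

lemma mirror_isNCP [Finite V] (P : Setoid T.Inner) : T.mirror.IsNCP P ↔ T.IsNCP P := by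
  refine and_congr ?_ (mirror_segmentConnected P)
  have key : ∀ s ∈ T.segOf P, ∀ t ∈ T.segOf P, s ≠ t →
      (T.mirror.Noncrossing (SegColor.red, s) (SegColor.red, t) ↔
        T.Noncrossing (SegColor.red, s) (SegColor.red, t)) := fun s hs t ht hne =>
    noncrossing_mirror (isSegment_of_mem_segOf hs) (isSegment_of_mem_segOf ht) hne
  have e := mirror_segOf P
  constructor
  · intro h s hs t ht hne
    exact (key s hs t ht hne).1 (h s (e.symm.subset hs) t (e.symm.subset ht) hne)
  · intro h s hs t ht hne
    exact (key s (e.subset hs) t (e.subset ht) hne).2 (h s (e.subset hs) t (e.subset ht) hne)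

/-- A facet, as a facet of the reflected tree. -/
def mirrorFacet [Finite V] (F : T.Facet) : T.mirror.Facet := ⟨F.1, mirror_isFacet.2 F.2⟩

lemma mirror_lowerLabels [Finite V] (F : T.Facet) :
    T.mirror.lowerLabels (mirrorFacet F) = T.upperLabels F := by
  obtain ⟨X, hX, -, hF⟩ := exists_facetOf (isFacet_iff.1 F.2)
  ext s
  rw [mem_upperLabels hX hF, mem_lowerLabels hX.mirror (hF.trans mirror_facetOf.symm)]
  simp only [mirror_lowerMark, mirror_path]

/-- The noncrossing tree partition given by the upper labels of a facet. -/
def upperNCP [Finite V] (F : T.Facet) : T.NCP :=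
  ⟨T.mirror.rho (mirrorFacet F), (mirror_isNCP _).1 (isNCP_rho _)⟩

lemma segOf_upperNCP [Finite V] (F : T.Facet) : T.segOf (upperNCP F).1 = T.upperLabels F := by
  rw [← mirror_lowerLabels, ← segOf_rho, ← mirror_segOf]
  rfl

/-- This is the bijection of lower labels for the reflected tree, which has the same facets and
noncrossing tree partitions. -/
lemma upperNCP_bijective [Finite V] : Function.Bijective (upperNCP (T := T)) := by
  constructor
  · intro F G h
    have h0 : (upperNCP F).1 = (upperNCP G).1 := congrArg Subtype.val h
    have h1 : facetNCP (mirrorFacet F) = facetNCP (mirrorFacet G) := Subtype.ext h0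
    have h2 : (mirrorFacet F).1 = (mirrorFacet G).1 :=
      congrArg Subtype.val (facetNCP_bijective.1 h1)
    exact Subtype.ext h2
  · rintro ⟨P, hP⟩
    obtain ⟨G, hG⟩ := (facetNCP_bijective (T := T.mirror)).2 ⟨P, (mirror_isNCP P).2 hP⟩
    have h : (facetNCP G).1 = P := congrArg Subtype.val hG
    exact ⟨⟨G.1, mirror_isFacet.1 G.2⟩, Subtype.ext h⟩

lemma NCP.ext_segOf {B C : T.NCP} (h : T.segOf B.1 = T.segOf C.1) : B = C :=
  Subtype.ext (B.2.eq_of_segOf C.2 h)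

/-- The Kreweras complement. -/
noncomputable def kreweras [Finite V] (B : T.NCP) : T.NCP :=
  upperNCP ((Equiv.ofBijective _ facetNCP_bijective).symm B)

lemma kreweras_facetNCP [Finite V] (F : T.Facet) : kreweras (facetNCP F) = upperNCP F := by
  unfold kreweras
  congr 1
  exact (Equiv.ofBijective _ facetNCP_bijective).symm_apply_apply F

lemma kreweras_bijective [Finite V] : Function.Bijective (kreweras (T := T)) :=
  upperNCP_bijective.comp (Equiv.bijective _)

end Kreweras

end PlaneTree

/-! ### Assembly of the theorem -/

theorem theorem5p9 {V : Type*} [Finite V] (T : PlaneTree V) :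
    -- every facet gives a red-green tree
    (∀ F : T.Facet,
      T.IsRedGreenTree (PlaneTree.redGreen (T.lowerLabels F) (T.upperLabels F))) ∧
    -- every red-green tree arises from a facet
    (∀ 𝒯, T.IsRedGreenTree 𝒯 →
      ∃ F : T.Facet, 𝒯 = PlaneTree.redGreen (T.lowerLabels F) (T.upperLabels F)) ∧
    -- `ρ` is a well-defined bijection onto noncrossing tree partitions, with `Seg(ρ(F)) = S_r`
    (∀ F : T.Facet, T.IsNCP (T.rho F) ∧ T.segOf (T.rho F) = T.lowerLabels F) ∧
    (∀ B : T.NCP, ∃! F : T.Facet, T.rho F = B.1) ∧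
    -- Kreweras complementation is a well-defined bijection `Kr`
    ∃ Kr : T.NCP → T.NCP, Function.Bijective Kr ∧
      (∀ B B' : T.NCP, T.IsKrewerasComplement B B' ↔ Kr B = B') ∧
      -- the unique red-green tree with red segments `Seg(B)`; its green segments
      ∀ B : T.NCP, ∃ 𝒯, T.IsRedGreenTree 𝒯 ∧
        PlaneTree.colorPart SegColor.red 𝒯 = T.segOf B.1 ∧
        PlaneTree.colorPart SegColor.green 𝒯 = T.segOf (Kr B).1 ∧
        ∀ 𝒯', T.IsRedGreenTree 𝒯' →
          PlaneTree.colorPart SegColor.red 𝒯' = T.segOf B.1 → 𝒯' = 𝒯 := by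
  have hred : ∀ F : T.Facet, PlaneTree.colorPart SegColor.red
      (PlaneTree.redGreen (T.lowerLabels F) (T.upperLabels F)) = T.lowerLabels F := by
    intro F
    ext s
    simp [PlaneTree.colorPart, PlaneTree.redGreen]
  have hgreen : ∀ F : T.Facet, PlaneTree.colorPart SegColor.green
      (PlaneTree.redGreen (T.lowerLabels F) (T.upperLabels F)) = T.upperLabels F := by
    intro F
    ext s
    simp [PlaneTree.colorPart, PlaneTree.redGreen]
  refine ⟨PlaneTree.isRedGreenTree_redGreen, fun 𝒯 h => h.exists_facet,
    fun F => ⟨PlaneTree.isNCP_rho F, PlaneTree.segOf_rho F⟩, fun B => ?_, PlaneTree.kreweras,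
    PlaneTree.kreweras_bijective, fun B B' => ?_, fun B => ?_⟩
  · obtain ⟨F, rfl⟩ := PlaneTree.facetNCP_bijective.2 B
    exact ⟨F, rfl, fun G hG => PlaneTree.facetNCP_bijective.1 (Subtype.ext hG)⟩
  · constructor
    · rintro ⟨F, hF, hB'⟩
      obtain rfl : PlaneTree.facetNCP F = B := Subtype.ext hF
      rw [PlaneTree.kreweras_facetNCP]
      exact PlaneTree.NCP.ext_segOf ((PlaneTree.segOf_upperNCP F).trans hB'.symm)
    · rintro rfl
      obtain ⟨F, rfl⟩ := PlaneTree.facetNCP_bijective.2 B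
      refine ⟨F, rfl, ?_⟩
      rw [PlaneTree.kreweras_facetNCP]
      exact PlaneTree.segOf_upperNCP F
  · obtain ⟨F, rfl⟩ := PlaneTree.facetNCP_bijective.2 B
    refine ⟨_, PlaneTree.isRedGreenTree_redGreen F, ?_, ?_, fun 𝒯' h h' => ?_⟩
    · rw [hred]
      exact (PlaneTree.segOf_rho F).symm
    · rw [hgreen, PlaneTree.kreweras_facetNCP, PlaneTree.segOf_upperNCP]
    -- Both trees are the tree of labels of the span of their red parts, and the red parts are
    -- equal.
    · have h1 := (PlaneTree.isRedGreenTree_redGreen F).eq_labelTree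
      rw [h1, h.eq_labelTree, h', hred]
      exact congrArg (fun S => T.labelTree (T.span S)) (PlaneTree.segOf_rho F)
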